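/- **Theorem 5.1.** Let $\mathcal M=\mathbb R$ or $\mathcal M=\mathbb T=\mathbb R/2\pi\mathbb Z$, let $1\le p<\infty$ and $s<0$. Write $\langle\xi\rangle=(1+\xi^2)^{1/2}$. For a distribution $f$ on $\mathcal M$ (tempered if $\mathcal M=\mathbb R$) let $$\|f\|_{\mathcal FL^{s,p}(\mathbb R)}=\|\langle\xi\rangle^s\widehat f(\xi)\|_{L^p(\mathbb R,d\xi)},\qquad \|f\|_{\mathcal FL^{s,p}(\mathbb T)}=\|\langle n\rangle^s\widehat f(n)\|_{\ell^p(\mathbb Z)},$$ where $\widehat f(\xi)=\int_{\mathbb R}f(x)e^{-ix\xi}\,dx$ on $\mathbb R$ and $\widehat f(n)=\frac1{2\pi}\int_{0}^{2\pi}f(x)e^{-inx}\,dx$ on $\mathbb T$ (both in the sense of distributions; the norm on $\mathbb R$ is $\infty$ if $\widehat f$ is not a function), and let $\mathcal FL^{s,p}(\mathcal M)$ be the space of all $f$ of finite norm. Let $u_0\in\mathcal FL^{s,p}(\mathcal M)$ be real-valued. Then for every $\varepsilon>0$ there are a smooth real-valued solution $u_\varepsilon$ of the Benjamin–Bona–Mahony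 equation $$\partial_tu-\partial_{xxt}u+\partial_xu+\tfrac12\partial_x(u^2)=0\qquad\text{on }\mathcal M\times[0,\infty)$$ and a time $t_\varepsilon\in(0,\varepsilon)$ with $u_\varepsilon(t_\varepsilon)\in\mathcal FL^{s,p}(\mathcal M)$ such that $$\|u_\varepsilon(0)-u_0\|_{\mathcal FL^{s,p}(\mathcal M)}<\varepsilon\qquad\text{and}\qquad\|u_\varepsilon(t_\varepsilon)\|_{\mathcal FL^{s,p}(\mathcal M)}>\varepsilon^{-1}.$$ Here a smooth solution is a function that is $C^\infty$ on $\mathcal M\times[0,\infty)$ (up to $t=0$) and satisfies the equation pointwise; if $\mathcal M=\mathbb R$, it moreover belongs to $C([0,\infty);H^k(\mathbb R))$ for every $k\in\mathbb N$. -/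

import Mathlib

open MeasureTheory Set Filter Topology
open scoped ENNReal ContDiff SchwartzMap FourierTransform

namespace BBM

/-! ### The equation

A real function `u(x, t)` on `ℝ × [0, ∞)` is written `u t x`. A function on the torus
`𝕋 = ℝ / 2πℤ` is a `2π`-periodic function on `ℝ`. -/

/-- `u` satisfies `∂ₜu - ∂ₓₓₜu + ∂ₓu + ½ ∂ₓ(u²) = 0` pointwise for all `t > 0` and all `x`. -/
def SatisfiesBBM (u : ℝ → ℝ → ℝ) : Prop :=
  ∀ t : ℝ, 0 < t → ∀ x : ℝ,
    deriv (fun τ => u τ x) t - deriv (fun τ => iteratedDeriv 2 (u τ) x) t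
      + deriv (u t) x + (1 / 2 : ℝ) * deriv (fun y => u t y ^ 2) x = 0

/-- A smooth global solution on `ℝ`: it is `C^∞` on `[0, ∞) × ℝ` (up to `t = 0`), solves the
equation pointwise, and belongs to `C([0, ∞); H^k(ℝ))` for every `k`. -/
structure IsSmoothSolutionLine (u : ℝ → ℝ → ℝ) : Prop where
  smooth : ContDiffOn ℝ ∞ (Function.uncurry u) (Ici (0 : ℝ) ×ˢ (univ : Set ℝ))
  equation : SatisfiesBBM u
  memLp : ∀ (k : ℕ) (t : ℝ), 0 ≤ t → MemLp (iteratedDeriv k (u t)) 2 volume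
  continuous_in_time : ∀ (k : ℕ) (t : ℝ), 0 ≤ t →
    Tendsto (fun τ => eLpNorm (fun x => iteratedDeriv k (u τ) x - iteratedDeriv k (u t) x) 2 volume)
      (𝓝[Ici 0] t) (𝓝 0)

/-- A smooth global solution on `𝕋`: it is `2π`-periodic in `x`, `C^∞` on `[0, ∞) × ℝ`
(up to `t = 0`) and solves the equation pointwise. -/
structure IsSmoothSolutionTorus (u : ℝ → ℝ → ℝ) : Prop where
  smooth : ContDiffOn ℝ ∞ (Function.uncurry u) (Ici (0 : ℝ) ×ˢ (univ : Set ℝ))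
  periodic : ∀ t : ℝ, 0 ≤ t → Function.Periodic (u t) (2 * Real.pi)
  equation : SatisfiesBBM u

theorem IsSmoothSolutionLine.memLp_two {u : ℝ → ℝ → ℝ} (hu : IsSmoothSolutionLine u)
    {t : ℝ} (ht : 0 ≤ t) : MemLp (u t) 2 volume := by
  simpa using hu.memLp 0 t ht

theorem IsSmoothSolutionTorus.continuous {u : ℝ → ℝ → ℝ} (hu : IsSmoothSolutionTorus u)
    {t : ℝ} (ht : 0 ≤ t) : Continuous (u t) :=
  hu.smooth.continuousOn.comp_continuous (f := fun x : ℝ => (t, x)) (by fun_prop)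
    (fun x => by simp [ht])

/-- The Japanese bracket raised to a power: `⟨ξ⟩^s = (1 + ξ²)^(s/2)`. -/
noncomputable def bracketPow (s ξ : ℝ) : ℝ := (1 + ξ ^ 2) ^ (s / 2)

/-! ### Fourier–Lebesgue norms on `ℝ` -/

/-- A tempered distribution on `ℝ` is real if it takes real values on real test functions. -/
def IsRealLine (v : 𝓢'(ℝ, ℂ)) : Prop :=
  ∀ φ : 𝓢(ℝ, ℂ), (∀ x, (φ x).im = 0) → (v φ).im = 0

/-- The Fourier transform of `v`, normalised by `v̂(ξ) = ∫ v(x) exp(-i x ξ) dx`, is the function `f`.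
Mathlib's `𝓕` uses the kernel `exp(-2π i x ξ)`, so that `𝓕 v` has to be the function
`ξ ↦ f (2πξ)`. -/
def HasFourierTransform (v : 𝓢'(ℝ, ℂ)) (f : ℝ → ℂ) : Prop :=
  AEStronglyMeasurable f volume ∧
    ∀ φ : 𝓢(ℝ, ℂ), Integrable (fun ξ => f (2 * Real.pi * ξ) * φ ξ) volume ∧
      (𝓕 v) φ = ∫ ξ, f (2 * Real.pi * ξ) * φ ξ

/-- `‖v‖_{FL^{s,p}(ℝ)} = ‖⟨ξ⟩^s v̂(ξ)‖_{L^p(ℝ, dξ)}`. The function `v̂` is unique almost everywhere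
if it exists, so the infimum is over a single value; the norm is `∞` if `v̂` is not a function. -/
noncomputable def normFLLine (s : ℝ) (p : ℝ≥0∞) (v : 𝓢'(ℝ, ℂ)) : ℝ≥0∞ :=
  ⨅ (f : ℝ → ℂ) (_ : HasFourierTransform v f),
    eLpNorm (fun ξ => (bracketPow s ξ : ℂ) * f ξ) p volume

/-- The tempered distribution on `ℝ` given by a real function in `L²`. -/
noncomputable def lineDistribution (f : ℝ → ℝ) (hf : MemLp f 2 volume) : 𝓢'(ℝ, ℂ) :=
  Lp.toTemperedDistribution (hf.ofReal (K := ℂ)).toLp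

/-! ### Fourier–Lebesgue norms on `𝕋` -/

/-- The space `C^∞(𝕋)` of complex test functions on the torus. -/
def TorusTest : Submodule ℂ (ℝ → ℂ) where
  carrier := {φ | ContDiff ℝ ∞ φ ∧ Function.Periodic φ (2 * Real.pi)}
  add_mem' ha hb := ⟨ha.1.add hb.1, ha.2.add hb.2⟩
  zero_mem' := ⟨contDiff_const, fun _ => rfl⟩
  smul_mem' c _ ha := ⟨contDiff_const.smul ha.1, ha.2.smul c⟩

/-- The space `𝓓'(𝕋)` of distributions on the torus: the linear functionals on `C^∞(𝕋)` that are
continuous, that is, bounded by a constant times some `C^k` norm. -/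
def TorusDistribution : Submodule ℂ (TorusTest →ₗ[ℂ] ℂ) where
  carrier := {v | ∃ (C : ℝ) (k : ℕ), 0 ≤ C ∧ ∀ (φ : TorusTest) (M : ℝ),
    (∀ j ≤ k, ∀ x : ℝ, ‖iteratedDeriv j (φ : ℝ → ℂ) x‖ ≤ M) → ‖v φ‖ ≤ C * M}
  add_mem' := by
    rintro v w ⟨C, k, hC, hv⟩ ⟨D, l, hD, hw⟩
    refine ⟨C + D, max k l, add_nonneg hC hD, fun φ M h => ?_⟩
    have h1 := hv φ M fun j hj => h j (hj.trans (le_max_left _ _))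
    have h2 := hw φ M fun j hj => h j (hj.trans (le_max_right _ _))
    calc ‖(v + w) φ‖ ≤ ‖v φ‖ + ‖w φ‖ := norm_add_le _ _
      _ ≤ (C + D) * M := by rw [add_mul]; exact add_le_add h1 h2
  zero_mem' := ⟨0, 0, le_rfl, fun φ M _ => by simp⟩
  smul_mem' := by
    rintro c v ⟨C, k, hC, hv⟩
    refine ⟨‖c‖ * C, k, by positivity, fun φ M h => ?_⟩
    rw [LinearMap.smul_apply, norm_smul, mul_assoc]
    exact mul_le_mul_of_nonneg_left (hv φ M h) (norm_nonneg c)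

/-- A distribution on `𝕋` is real if it takes real values on real test functions. -/
def IsRealTorus (v : TorusDistribution) : Prop :=
  ∀ φ : TorusTest, (∀ x, ((φ : ℝ → ℂ) x).im = 0) → ((v : TorusTest →ₗ[ℂ] ℂ) φ).im = 0

/-- The test function `x ↦ exp(-i n x)` on `𝕋`. -/
noncomputable def torusExp (n : ℤ) : TorusTest :=
  ⟨fun x => Complex.exp (-(Complex.I * n * x)), by
    have hc : ContDiff ℝ ∞ fun x : ℝ => (x : ℂ) := Complex.ofRealCLM.contDiff
    refine ⟨by fun_prop, fun x => ?_⟩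
    have h : -(Complex.I * n * ((x + 2 * Real.pi : ℝ) : ℂ))
        = -(Complex.I * n * x) + (-n : ℤ) * (2 * Real.pi * Complex.I) := by
      push_cast; ring
    simp only [h, Complex.exp_add, Complex.exp_int_mul_two_pi_mul_I, mul_one]⟩

/-- The Fourier coefficient `v̂(n) = (2π)⁻¹ ⟨v, exp(-i n x)⟩`. -/
noncomputable def torusCoeff (v : TorusDistribution) (n : ℤ) : ℂ :=
  (2 * Real.pi : ℂ)⁻¹ * (v : TorusTest →ₗ[ℂ] ℂ) (torusExp n)

/-- `‖v‖_{FL^{s,p}(𝕋)} = ‖⟨n⟩^s v̂(n)‖_{ℓ^p(ℤ)}`. -/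
noncomputable def normFLTorus (s : ℝ) (p : ℝ≥0∞) (v : TorusDistribution) : ℝ≥0∞ :=
  eLpNorm (fun n : ℤ => (bracketPow s n : ℂ) * torusCoeff v n) p Measure.count

theorem TorusTest.continuous (φ : TorusTest) : Continuous (φ : ℝ → ℂ) := φ.2.1.continuous

/-- The distribution `φ ↦ ∫_0^{2π} f φ dx` on `𝕋` given by a real continuous function `f`. -/
noncomputable def torusDistribution (f : ℝ → ℝ) (hf : Continuous f) : TorusDistribution :=
  ⟨{ toFun := fun φ => ∫ x in (0 : ℝ)..(2 * Real.pi), (f x : ℂ) * (φ : ℝ → ℂ) x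
     map_add' := fun φ ψ => by
      have h1 := TorusTest.continuous φ
      have h2 := TorusTest.continuous ψ
      rw [← intervalIntegral.integral_add]
      · simp [mul_add]
      · exact Continuous.intervalIntegrable (by fun_prop) _ _
      · exact Continuous.intervalIntegrable (by fun_prop) _ _
     map_smul' := fun c φ => by
      rw [RingHom.id_apply, smul_eq_mul, ← intervalIntegral.integral_const_mul]
      congr 1
      ext x
      simp only [Submodule.coe_smul, Pi.smul_apply, smul_eq_mul]
      ring }, by
    obtain ⟨B, hB⟩ := (isCompact_uIcc (a := (0 : ℝ)) (b := 2 * Real.pi)).exists_bound_of_continuousOn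
      hf.continuousOn
    have hB0 : 0 ≤ B := (norm_nonneg _).trans (hB 0 left_mem_uIcc)
    refine ⟨B * |2 * Real.pi - 0|, 0, by positivity, fun φ M h => ?_⟩
    have h0 : ∀ x ∈ Set.uIoc (0 : ℝ) (2 * Real.pi), ‖(f x : ℂ) * (φ : ℝ → ℂ) x‖ ≤ B * M := by
      intro x hx
      rw [norm_mul, Complex.norm_real]
      have hx' := h 0 le_rfl x
      rw [iteratedDeriv_zero] at hx'
      exact mul_le_mul (hB x (uIoc_subset_uIcc hx)) hx' (norm_nonneg _) hB0
    calc _ ≤ B * M * |2 * Real.pi - 0| := intervalIntegral.norm_integral_le_of_norm_le_const h0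
      _ = _ := by ring⟩

end BBM

/-! # Norm inflation for the Benjamin–Bona–Mahony equation in negative Fourier–Lebesgue spaces

The equation is `∂ₜ u = K (u + u² / 2)` with the bounded operator `K = -∂ₓ (1 - ∂ₓ²)⁻¹`, so it is an
ordinary differential equation in a Banach algebra of functions. The inflation is a high-to-low
energy transfer in the quadratic term. Given a smooth approximation `φ` of `u₀`, take the data
`φ + N ^ a ψ cos (N x)` with a fixed `ψ` and `a = -s / 2 > 0`. The perturbation lives at frequencies
near `± N`, where the weight is about `N ^ s`, so it has norm `O (N ^ (a + s)) = O (N ^ (s / 2))`,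
which is small. But the square of the perturbation contains `N ^ (2 a) ψ² / 2`, which sits at
frequencies of order one, where the weight is harmless. It acts for a time `T / N ^ (2 a)`, which
tends to `0`, and changes the low frequencies by a multiple of `T`, as large as desired; the
remaining terms of the second-order Taylor expansion in time are only `O (N ^ (-a))`
(`Geometry.eventually_inflation`, `exists_inflation`).

Both domains are treated at once by means of a structure `Geometry`: functions are written `w · U`
with `U` bounded and continuous, and with a weight `w` that is `1` on the torus and `(1 + x²)⁻¹` on
the line. On this space the kernels `exp (-|x|) / 2` of `(1 - ∂ₓ²)⁻¹` and of its derivative are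
bounded, and all Fourier integrals converge absolutely. Global existence
(`Geometry.exists_solution`) follows by truncating the nonlinearity to a globally Lipschitz one,
which does not affect the conservation of `∫ u² + uₓ²`; the energy controls `sup |u|`, and a
sufficiently high truncation is never reached. Smoothness (`Geometry.spaceSmooth_solution`,
`Geometry.contDiff_val`) holds because the vector field gains a derivative.

What remains for each domain is the density of smooth functions: on the torus the truncated Fourier
series of `u₀` are real trigonometric polynomials (`exists_torus_approx`); on the line the real part
of the inverse Fourier transform of a smooth compactly supported approximation is a real Schwartz
function (`exists_line_approx`). On the line, the Fourier transform of a distribution, if it is a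
function, is moreover unique almost everywhere (`HasFourierTransform.ae_eq`), so that the infimum
defining the norm is the norm of any representative (`normFLLine_eq`). -/

open scoped BoundedContinuousFunction NNReal

namespace BBM

/-! ### Global flows of Lipschitz vector fields and joint smoothness -/

theorem norm_integral_le_of_norm_le_exp {E : Type*} [NormedAddCommGroup E] [NormedSpace ℝ E]
    {f : ℝ → E} {l C : ℝ} (hl : 0 < l) (hC : 0 ≤ C)
    (h : ∀ s, ‖f s‖ ≤ C * Real.exp (l * |s|)) (t : ℝ) :
    ‖∫ s in (0 : ℝ)..t, f s‖ ≤ C / l * Real.exp (l * |t|) := by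
  have key : ∀ (f : ℝ → E) (t : ℝ), (∀ s, ‖f s‖ ≤ C * Real.exp (l * |s|)) → 0 ≤ t →
      ‖∫ s in (0 : ℝ)..t, f s‖ ≤ C / l * Real.exp (l * |t|) := by
    intro f t h ht
    have h1 : ∀ x ∈ uIcc (0 : ℝ) t,
        HasDerivAt (fun s => C / l * Real.exp (l * s)) (C * Real.exp (l * x)) x := by
      intro x _
      have := ((((hasDerivAt_id x).const_mul l).exp).const_mul (C / l))
      exact this.congr_deriv (by simp only [id]; field_simp)
    have h2 : ∫ s in (0 : ℝ)..t, C * Real.exp (l * s)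
        = C / l * Real.exp (l * t) - C / l * Real.exp (l * 0) :=
      intervalIntegral.integral_eq_sub_of_hasDerivAt h1
        (Continuous.intervalIntegrable (by fun_prop) _ _)
    have h3 : ‖∫ s in (0 : ℝ)..t, f s‖ ≤ ∫ s in (0 : ℝ)..t, C * Real.exp (l * s) := by
      refine intervalIntegral.norm_integral_le_of_norm_le ht ?_
        (Continuous.intervalIntegrable (by fun_prop) _ _)
      refine Eventually.of_forall fun s hs => ?_
      simpa [abs_of_pos hs.1] using h s
    rw [abs_of_nonneg ht]
    refine h3.trans ?_
    rw [h2]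
    have : 0 ≤ C / l * Real.exp (l * 0) := by positivity
    linarith
  rcases le_total 0 t with ht | ht
  · exact key f t h ht
  · have h1 : ∫ s in (0 : ℝ)..t, f s = -∫ s in (0 : ℝ)..(-t), f (-s) := by
      rw [intervalIntegral.integral_comp_neg]
      simp [intervalIntegral.integral_symm t 0]
    rw [h1, norm_neg]
    simpa using key (fun s => f (-s)) (-t) (fun s => by simpa using h (-s)) (by linarith)

/-- A globally Lipschitz vector field on a Banach space has a global flow. The Picard operator is a
contraction for the norm `sup_t exp (-l |t|) ‖u t‖` when `l` exceeds the Lipschitz constant; the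
unknown of the fixed point problem is `g t = exp (-l |t|) u t`. -/
theorem exists_global_solution {E : Type*} [NormedAddCommGroup E] [NormedSpace ℝ E]
    [CompleteSpace E] {F : E → E} {L : ℝ≥0} (hF : LipschitzWith L F) (x₀ : E) :
    ∃ u : ℝ → E, u 0 = x₀ ∧ ∀ t, HasDerivAt u (F (u t)) t := by
  set l : ℝ := 2 * (L + 1) with hl
  have hl0 : 0 < l := by positivity
  have hFc := hF.continuous
  have hcont : ∀ g : ℝ →ᵇ E, Continuous fun s => F (Real.exp (l * |s|) • g s) := by
    intro g; fun_prop
  have hprim : ∀ g : ℝ →ᵇ E, ∀ t, HasDerivAt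
      (fun t => x₀ + ∫ s in (0 : ℝ)..t, F (Real.exp (l * |s|) • g s))
      (F (Real.exp (l * |t|) • g t)) t := fun g t =>
    (intervalIntegral.integral_hasDerivAt_right ((hcont g).intervalIntegrable _ _)
      ((hcont g).stronglyMeasurableAtFilter _ _) (hcont g).continuousAt).const_add _
  have hexp : ∀ t : ℝ, Real.exp (-(l * |t|)) * Real.exp (l * |t|) = 1 := fun t => by
    rw [← Real.exp_add]; simp
  have hgrow : ∀ g : ℝ →ᵇ E, ∀ s, ‖F (Real.exp (l * |s|) • g s)‖
      ≤ (‖F 0‖ + L * ‖g‖) * Real.exp (l * |s|) := by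
    intro g s
    have h1 : ‖F (Real.exp (l * |s|) • g s) - F 0‖ ≤ L * (Real.exp (l * |s|) * ‖g‖) := by
      refine (hF.norm_sub_le _ _).trans ?_
      rw [sub_zero, norm_smul, Real.norm_of_nonneg (Real.exp_pos _).le]
      gcongr
      exact g.norm_coe_le_norm s
    have h2 : 1 ≤ Real.exp (l * |s|) := Real.one_le_exp (by positivity)
    have h3 := norm_add_le (F (Real.exp (l * |s|) • g s) - F 0) (F 0)
    rw [sub_add_cancel] at h3
    nlinarith [norm_nonneg (F 0)]
  let Φ : (ℝ →ᵇ E) → (ℝ →ᵇ E) := fun g =>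
    BoundedContinuousFunction.ofNormedAddCommGroup
      (fun t => Real.exp (-(l * |t|)) • (x₀ + ∫ s in (0 : ℝ)..t, F (Real.exp (l * |s|) • g s)))
      (by
        have : Continuous fun t => x₀ + ∫ s in (0 : ℝ)..t, F (Real.exp (l * |s|) • g s) :=
          continuous_iff_continuousAt.2 fun t => (hprim g t).continuousAt
        fun_prop)
      (‖x₀‖ + (‖F 0‖ + L * ‖g‖) / l)
      (fun t => by
        rw [norm_smul, Real.norm_of_nonneg (Real.exp_pos _).le]
        have h1 := norm_integral_le_of_norm_le_exp hl0 (by positivity) (hgrow g) t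
        have h2 : Real.exp (-(l * |t|)) ≤ 1 := Real.exp_le_one_iff.2 (by
          have := abs_nonneg t
          nlinarith)
        calc Real.exp (-(l * |t|)) * ‖x₀ + ∫ s in (0 : ℝ)..t, F (Real.exp (l * |s|) • g s)‖
            ≤ Real.exp (-(l * |t|)) *
              (‖x₀‖ + (‖F 0‖ + L * ‖g‖) / l * Real.exp (l * |t|)) := by
              gcongr
              exact (norm_add_le _ _).trans (by gcongr)
          _ = Real.exp (-(l * |t|)) * ‖x₀‖ + (‖F 0‖ + L * ‖g‖) / l := by
              linear_combination (‖F 0‖ + L * ‖g‖) / l * hexp t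
          _ ≤ _ := by
              have := mul_le_mul_of_nonneg_right h2 (norm_nonneg x₀)
              linarith)
  have hΦ : ContractingWith (1 / 2) Φ := by
    refine ⟨by rw [← NNReal.coe_lt_coe]; norm_num, LipschitzWith.of_dist_le_mul fun g h => ?_⟩
    rw [BoundedContinuousFunction.dist_le (by positivity)]
    intro t
    rw [dist_eq_norm]
    have h1 : Φ g t - Φ h t = Real.exp (-(l * |t|)) • ∫ s in (0 : ℝ)..t,
        (F (Real.exp (l * |s|) • g s) - F (Real.exp (l * |s|) • h s)) := by
      rw [intervalIntegral.integral_sub ((hcont g).intervalIntegrable _ _)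
        ((hcont h).intervalIntegrable _ _)]
      simp only [Φ, BoundedContinuousFunction.coe_ofNormedAddCommGroup]
      rw [← smul_sub]
      congr 1
      abel
    have h2 : ∀ s, ‖F (Real.exp (l * |s|) • g s) - F (Real.exp (l * |s|) • h s)‖
        ≤ (L * dist g h) * Real.exp (l * |s|) := by
      intro s
      refine (hF.norm_sub_le _ _).trans ?_
      rw [← smul_sub, norm_smul, Real.norm_of_nonneg (Real.exp_pos _).le, ← dist_eq_norm]
      calc _ ≤ L * (Real.exp (l * |s|) * dist g h) := by
            gcongr
            exact BoundedContinuousFunction.dist_coe_le_dist s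
        _ = _ := by ring
    have h3 := norm_integral_le_of_norm_le_exp hl0 (by positivity) h2 t
    rw [h1, norm_smul, Real.norm_of_nonneg (Real.exp_pos _).le]
    calc _ ≤ Real.exp (-(l * |t|)) * (L * dist g h / l * Real.exp (l * |t|)) := by gcongr
      _ = L / l * dist g h := by linear_combination (L * dist g h / l) * hexp t
      _ ≤ _ := by
        gcongr
        rw [hl, div_le_iff₀ (by positivity)]
        push_cast
        linarith
  set g := hΦ.fixedPoint Φ with hg
  have hfix : Φ g = g := hΦ.fixedPoint_isFixedPt
  have hu : ∀ t, Real.exp (l * |t|) • g t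
      = x₀ + ∫ s in (0 : ℝ)..t, F (Real.exp (l * |s|) • g s) := by
    intro t
    conv_lhs => rw [← hfix]
    simp only [Φ, BoundedContinuousFunction.coe_ofNormedAddCommGroup]
    rw [smul_smul, mul_comm, hexp, one_smul]
  refine ⟨fun t => Real.exp (l * |t|) • g t, by simpa using hu 0, fun t => ?_⟩
  have := hprim g t
  rwa [← funext hu] at this

/-- A family of functions of `(t, x)` that is closed under both partial derivatives and consists of
continuous functions consists of smooth functions. -/
theorem contDiff_of_closed_under_partials {S : Set (ℝ → ℝ → ℝ)}
    (hc : ∀ f ∈ S, Continuous (Function.uncurry f))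
    (ht : ∀ f ∈ S, ∃ g ∈ S, ∀ t x, HasDerivAt (fun τ => f τ x) (g t x) t)
    (hx : ∀ f ∈ S, ∃ g ∈ S, ∀ t x, HasDerivAt (f t) (g t x) x)
    {f : ℝ → ℝ → ℝ} (hf : f ∈ S) : ContDiff ℝ ∞ (Function.uncurry f) := by
  rw [contDiff_infty]
  intro n
  induction n generalizing f with
  | zero => exact contDiff_zero.2 (hc f hf)
  | succ n ih =>
    obtain ⟨g, hg, hg'⟩ := ht f hf
    obtain ⟨h, hh, hh'⟩ := hx f hf
    rw [show ((n + 1 : ℕ) : WithTop ℕ∞) = n + 1 by push_cast; rfl,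
      contDiff_succ_iff_hasFDerivAt]
    let T : ℝ → ℝ → (ℝ →L[ℝ] ℝ) := fun t x => ContinuousLinearMap.toSpanSingleton ℝ (g t x)
    let Y : ℝ → ℝ → (ℝ →L[ℝ] ℝ) := fun t x => ContinuousLinearMap.toSpanSingleton ℝ (h t x)
    let e : ℝ →L[ℝ] (ℝ →L[ℝ] ℝ) := ContinuousLinearMap.toSpanSingletonCLE.toContinuousLinearMap
    have hT : ContDiff ℝ n (Function.uncurry T) := e.contDiff.comp (ih hg)
    have hY : ContDiff ℝ n (Function.uncurry Y) := e.contDiff.comp (ih hh)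
    refine ⟨fun q => (Function.uncurry T q).coprod (Function.uncurry Y q), ?_, fun q => ?_⟩
    · have : (fun q => (Function.uncurry T q).coprod (Function.uncurry Y q))
          = fun q => (Function.uncurry T q).comp (ContinuousLinearMap.fst ℝ ℝ ℝ)
            + (Function.uncurry Y q).comp (ContinuousLinearMap.snd ℝ ℝ ℝ) := by
        ext q <;> simp
      rw [this]
      exact (hT.clm_comp contDiff_const).add (hY.clm_comp contDiff_const)
    · refine (hasStrictFDerivAt_uncurry_coprod (u := q) (f := f) (f₁ := T) (f₂ := Y)
        (Eventually.of_forall fun v => ?_) (Eventually.of_forall fun v => ?_)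
        hT.continuous.continuousAt hY.continuous.continuousAt).hasFDerivAt
      · exact (hg' v.1 v.2).hasFDerivAt
      · exact (hh' v.1 v.2).hasFDerivAt

/-! ### Weighted spaces and the resolvent kernels -/

/-- The data that distinguish the line from the torus. A function `u` is represented as `w · U`
with `U : ℝ →ᵇ ℝ`; it has the period `σ` and is integrated over one period by means of `μ`. The
torus has `w = 1`, `σ = 2π`; the line has an integrable weight `w` and `σ = 0`, so that periodicity
is void. -/
structure Geometry where
  /-- The weight. -/
  w : ℝ → ℝ
  /-- The period. -/
  σ : ℝ
  /-- The measure on a period. -/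
  μ : Measure ℝ
  /-- The constant in the moderate growth of the weight. -/
  c : ℝ
  w_cont : Continuous w
  w_pos : ∀ x, 0 < w x
  w_le_one : ∀ x, w x ≤ 1
  w_shift : ∀ x z, w (x + z) ≤ c * Real.exp (|z| / 2) * w x
  w_periodic : Function.Periodic w σ
  w_integrable : Integrable w μ
  integral_deriv_eq_zero : ∀ (F F' : ℝ → ℂ) (C : ℝ), (∀ x, HasDerivAt F (F' x) x) →
    Continuous F' → Function.Periodic F σ → (∀ x, ‖F x‖ ≤ C * w x) → (∀ x, ‖F' x‖ ≤ C * w x) →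
    ∫ x, F' x ∂μ = 0
  unit_integral_le : ∀ (g : ℝ → ℝ) (C : ℝ), Continuous g → (∀ x, 0 ≤ g x) →
    Function.Periodic g σ → (∀ x, g x ≤ C * w x) → ∀ x, ∫ y in x..(x + 1), g y ≤ ∫ y, g y ∂μ

theorem integrableOn_exp_neg_mul {f : ℝ → ℝ} (hf : Continuous f) {C : ℝ} (hC : ∀ x, |f x| ≤ C) :
    IntegrableOn (fun z => Real.exp (-z) * f z) (Ioi 0) := by
  refine (integrableOn_exp_neg_Ioi 0 |>.mul_const C).mono'
    (by fun_prop) (Eventually.of_forall fun z => ?_)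
  rw [norm_mul, Real.norm_of_nonneg (Real.exp_pos _).le]
  exact mul_le_mul_of_nonneg_left (hC z) (Real.exp_pos _).le

/-- `∫_{z > 0} exp (-z) f (x - z) dz` is the bounded solution `v` of `v' = f - v`. -/
theorem hasDerivAt_integral_exp_left {f : ℝ → ℝ} (hf : Continuous f) {C : ℝ}
    (hC : ∀ x, |f x| ≤ C) (x : ℝ) :
    HasDerivAt (fun x => ∫ z in Ioi (0 : ℝ), Real.exp (-z) * f (x - z))
      (f x - ∫ z in Ioi (0 : ℝ), Real.exp (-z) * f (x - z)) x := by
  have hint : ∀ a : ℝ, IntegrableOn (fun y => Real.exp y * f y) (Iic a) := fun a => by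
    refine (integrableOn_exp_Iic a |>.mul_const C).mono' (by fun_prop)
      (Eventually.of_forall fun z => ?_)
    rw [norm_mul, Real.norm_of_nonneg (Real.exp_pos _).le]
    exact mul_le_mul_of_nonneg_left (hC z) (Real.exp_pos _).le
  have hrep : ∀ x : ℝ, ∫ z in Ioi (0 : ℝ), Real.exp (-z) * f (x - z)
      = Real.exp (-x) * ((∫ y in Iic (0 : ℝ), Real.exp y * f y)
        + ∫ y in (0 : ℝ)..x, Real.exp y * f y) := by
    intro x
    have h1 : (∫ y in Iic x, Real.exp y * f y) - ∫ y in Iic (0 : ℝ), Real.exp y * f y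
        = ∫ y in (0 : ℝ)..x, Real.exp y * f y :=
      intervalIntegral.integral_Iic_sub_Iic (hint 0) (hint x)
    rw [← h1, add_sub_cancel, ← integral_const_mul, integral_Iic_eq_integral_Iio,
      ← integral_indicator measurableSet_Ioi, ← integral_indicator measurableSet_Iio,
      ← integral_sub_left_eq_self _ volume x]
    congr 1
    ext y
    by_cases hy : y < x
    · rw [indicator_of_mem (by simpa using hy), indicator_of_mem (by simpa using hy),
        ← mul_assoc, ← Real.exp_add]
      ring_nf
    · rw [indicator_of_notMem (by simpa using hy), indicator_of_notMem (by simpa using hy)]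
  have hc : Continuous fun y => Real.exp y * f y := by fun_prop
  have h2 : HasDerivAt (fun x => (∫ y in Iic (0 : ℝ), Real.exp y * f y)
      + ∫ y in (0 : ℝ)..x, Real.exp y * f y) (Real.exp x * f x) x :=
    (intervalIntegral.integral_hasDerivAt_right (hc.intervalIntegrable _ _)
      (hc.stronglyMeasurableAtFilter _ _) hc.continuousAt).const_add _
  have h3 := (hasDerivAt_neg x).exp.mul h2
  rw [hrep x]
  rw [show (fun x => ∫ z in Ioi (0 : ℝ), Real.exp (-z) * f (x - z))
    = _ from funext hrep]
  refine h3.congr_deriv ?_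
  have : Real.exp (-x) * Real.exp x = 1 := by rw [← Real.exp_add]; simp
  linear_combination f x * this

/-- `∫_{z > 0} exp (-z) f (x + z) dz` is the bounded solution `v` of `v' = v - f`. -/
theorem hasDerivAt_integral_exp_right {f : ℝ → ℝ} (hf : Continuous f) {C : ℝ}
    (hC : ∀ x, |f x| ≤ C) (x : ℝ) :
    HasDerivAt (fun x => ∫ z in Ioi (0 : ℝ), Real.exp (-z) * f (x + z))
      ((∫ z in Ioi (0 : ℝ), Real.exp (-z) * f (x + z)) - f x) x := by
  have h := (hasDerivAt_integral_exp_left (hf.comp continuous_neg) (fun x => hC (-x)) (-x)).scomp x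
    (hasDerivAt_neg x)
  simp only [Function.comp_def, neg_sub, sub_neg_eq_add, neg_neg] at h
  simp only [smul_eq_mul, neg_mul, one_mul, neg_sub] at h
  simpa only [add_comm] using h

namespace Geometry

variable (G : Geometry)

/-- The function `w · U` represented by `U`. -/
def val (U : ℝ →ᵇ ℝ) (x : ℝ) : ℝ := G.w x * U x

theorem continuous_val (U : ℝ →ᵇ ℝ) : Continuous (G.val U) := G.w_cont.mul U.continuous

theorem abs_val_le (U : ℝ →ᵇ ℝ) (x : ℝ) : |G.val U x| ≤ ‖U‖ * G.w x := by
  rw [val, abs_mul, abs_of_pos (G.w_pos x), mul_comm]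
  exact mul_le_mul_of_nonneg_right (U.norm_coe_le_norm x) (G.w_pos x).le

theorem abs_val_le_norm (U : ℝ →ᵇ ℝ) (x : ℝ) : |G.val U x| ≤ ‖U‖ :=
  (G.abs_val_le U x).trans (mul_le_of_le_one_right (norm_nonneg U) (G.w_le_one x))

@[simp] theorem val_add (U V : ℝ →ᵇ ℝ) (x : ℝ) : G.val (U + V) x = G.val U x + G.val V x := by
  simp [val, mul_add]

@[simp] theorem val_sub (U V : ℝ →ᵇ ℝ) (x : ℝ) : G.val (U - V) x = G.val U x - G.val V x := by
  simp [val, mul_sub]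

@[simp] theorem val_neg (U : ℝ →ᵇ ℝ) (x : ℝ) : G.val (-U) x = -G.val U x := by
  simp [val]

@[simp] theorem val_smul (a : ℝ) (U : ℝ →ᵇ ℝ) (x : ℝ) : G.val (a • U) x = a * G.val U x := by
  simp [val, mul_left_comm]

/-- The element of `ℝ →ᵇ ℝ` representing a continuous function `f` with `|f| ≤ C w`. -/
noncomputable def lift (f : ℝ → ℝ) (hf : Continuous f) (C : ℝ) (hC : ∀ x, |f x| ≤ C * G.w x) :
    ℝ →ᵇ ℝ :=
  BoundedContinuousFunction.ofNormedAddCommGroup (fun x => f x / G.w x)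
    (hf.div₀ G.w_cont fun x => (G.w_pos x).ne') C (fun x => by
      rw [Real.norm_eq_abs, abs_div, abs_of_pos (G.w_pos x), div_le_iff₀ (G.w_pos x)]
      exact hC x)

@[simp] theorem val_lift {f : ℝ → ℝ} (hf : Continuous f) {C : ℝ} (hC : ∀ x, |f x| ≤ C * G.w x)
    (x : ℝ) : G.val (G.lift f hf C hC) x = f x := by
  simp [val, lift, mul_div_cancel₀ _ (G.w_pos x).ne']

theorem norm_lift_le {f : ℝ → ℝ} (hf : Continuous f) {C : ℝ} (hC : ∀ x, |f x| ≤ C * G.w x) :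
    ‖G.lift f hf C hC‖ ≤ C := by
  refine BoundedContinuousFunction.norm_ofNormedAddCommGroup_le _ ?_ _
  have := (abs_nonneg _).trans (hC 0)
  exact nonneg_of_mul_nonneg_left this (G.w_pos 0)

theorem val_injective {U V : ℝ →ᵇ ℝ} (h : ∀ x, G.val U x = G.val V x) : U = V := by
  ext x
  exact mul_left_cancel₀ (G.w_pos x).ne' (h x)

theorem w_sub_mul_le {θ : ℝ} (hθ : |θ| = 1) (x : ℝ) {z : ℝ} (hz : 0 < z) :
    G.w (x - θ * z) ≤ G.c * Real.exp (z / 2) * G.w x := by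
  have h := G.w_shift x (-(θ * z))
  rwa [abs_neg, abs_mul, hθ, one_mul, abs_of_pos hz, ← sub_eq_add_neg] at h

theorem integral_exp_neg_half : ∫ z in Ioi (0 : ℝ), Real.exp (-z / 2) = 2 := by
  have h := integral_exp_mul_Ioi (a := -(1 / 2 : ℝ)) (by norm_num) 0
  have h2 : ∀ z : ℝ, -z / 2 = -(1 / 2) * z := fun z => by ring
  simp only [h2, h]
  norm_num

theorem integrable_exp_neg_half : IntegrableOn (fun z : ℝ => Real.exp (-z / 2)) (Ioi 0) := by
  have h := integrableOn_exp_mul_Ioi (a := -(1 / 2 : ℝ)) (by norm_num) 0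
  refine h.congr_fun (fun z _ => ?_) measurableSet_Ioi
  simp only
  ring_nf

theorem abs_kernel_le {θ : ℝ} (hθ : |θ| = 1) (U : ℝ →ᵇ ℝ) (x : ℝ) {z : ℝ} (hz : 0 < z) :
    |Real.exp (-z) * G.val U (x - θ * z)| ≤ (G.c * ‖U‖ * G.w x) * Real.exp (-z / 2) := by
  rw [abs_mul, abs_of_pos (Real.exp_pos _)]
  calc Real.exp (-z) * |G.val U (x - θ * z)|
      ≤ Real.exp (-z) * (‖U‖ * (G.c * Real.exp (z / 2) * G.w x)) := by
        gcongr
        exact (G.abs_val_le U _).trans (by gcongr; exact G.w_sub_mul_le hθ x hz)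
    _ = (G.c * ‖U‖ * G.w x) * (Real.exp (-z) * Real.exp (z / 2)) := by ring
    _ = _ := by
        rw [← Real.exp_add]
        ring_nf

theorem abs_integral_kernel_le {θ : ℝ} (hθ : |θ| = 1) (U : ℝ →ᵇ ℝ) (x : ℝ) :
    |∫ z in Ioi (0 : ℝ), Real.exp (-z) * G.val U (x - θ * z)| ≤ (2 * G.c * ‖U‖) * G.w x := by
  have h : ‖∫ z in Ioi (0 : ℝ), Real.exp (-z) * G.val U (x - θ * z)‖
      ≤ ∫ z in Ioi (0 : ℝ), (G.c * ‖U‖ * G.w x) * Real.exp (-z / 2) := by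
    refine norm_integral_le_of_norm_le (integrable_exp_neg_half.const_mul _) ?_
    exact (ae_restrict_mem measurableSet_Ioi).mono fun z hz => G.abs_kernel_le hθ U x hz
  rw [integral_const_mul, integral_exp_neg_half] at h
  rw [← Real.norm_eq_abs]
  linarith

theorem integrable_kernel {θ : ℝ} (U : ℝ →ᵇ ℝ) (x : ℝ) :
    IntegrableOn (fun z => Real.exp (-z) * G.val U (x - θ * z)) (Ioi 0) :=
  integrableOn_exp_neg_mul ((G.continuous_val U).comp (by fun_prop))
    fun _ => G.abs_val_le_norm U _

theorem continuous_integral_kernel {θ : ℝ} (U : ℝ →ᵇ ℝ) :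
    Continuous fun x => ∫ z in Ioi (0 : ℝ), Real.exp (-z) * G.val U (x - θ * z) := by
  have hc := G.continuous_val U
  refine continuous_of_dominated (bound := fun z => Real.exp (-z) * ‖U‖)
    (fun x => (by fun_prop : Continuous fun z =>
      Real.exp (-z) * G.val U (x - θ * z)).aestronglyMeasurable)
    (fun x => Eventually.of_forall fun z => ?_) ((integrableOn_exp_neg_Ioi 0).mul_const _)
    (Eventually.of_forall fun z => by fun_prop)
  rw [norm_mul, Real.norm_of_nonneg (Real.exp_pos _).le]
  exact mul_le_mul_of_nonneg_left (G.abs_val_le_norm U _) (Real.exp_pos _).le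

/-- The operator `f ↦ ∫_{z > 0} exp (-z) f (x - θ z) dz`, for a sign `θ`, on the weighted space. -/
noncomputable def halfKernel (θ : ℝ) (hθ : |θ| = 1) : (ℝ →ᵇ ℝ) →L[ℝ] (ℝ →ᵇ ℝ) :=
  LinearMap.mkContinuous
    { toFun := fun U => G.lift _ (G.continuous_integral_kernel (θ := θ) U) _
        (G.abs_integral_kernel_le hθ U)
      map_add' := fun U V => G.val_injective fun x => by
        simp only [val_lift, val_add, mul_add]
        exact integral_add (G.integrable_kernel U x) (G.integrable_kernel V x)
      map_smul' := fun a U => G.val_injective fun x => by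
        simp only [val_lift, val_smul, RingHom.id_apply, ← integral_const_mul]
        congr 1
        ext z
        ring }
    (2 * G.c) fun U => G.norm_lift_le (G.continuous_integral_kernel (θ := θ) U)
      (G.abs_integral_kernel_le hθ U)

theorem val_halfKernel {θ : ℝ} (hθ : |θ| = 1) (U : ℝ →ᵇ ℝ) (x : ℝ) :
    G.val (G.halfKernel θ hθ U) x = ∫ z in Ioi (0 : ℝ), Real.exp (-z) * G.val U (x - θ * z) :=
  G.val_lift (G.continuous_integral_kernel (θ := θ) U) (G.abs_integral_kernel_le hθ U) x

/-- `J = (1 - ∂ₓ²)⁻¹` on the weighted space. -/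
noncomputable def J : (ℝ →ᵇ ℝ) →L[ℝ] (ℝ →ᵇ ℝ) :=
  (1 / 2 : ℝ) • (G.halfKernel 1 (by simp) + G.halfKernel (-1) (by simp))

/-- `K = -∂ₓ (1 - ∂ₓ²)⁻¹` on the weighted space. -/
noncomputable def K : (ℝ →ᵇ ℝ) →L[ℝ] (ℝ →ᵇ ℝ) :=
  (1 / 2 : ℝ) • (G.halfKernel 1 (by simp) - G.halfKernel (-1) (by simp))

/-- `V` represents the derivative of the function represented by `U`. -/
def IsDeriv (U V : ℝ →ᵇ ℝ) : Prop := ∀ x, HasDerivAt (G.val U) (G.val V x) x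

variable {G}

theorem IsDeriv.add {U V U' V' : ℝ →ᵇ ℝ} (h : G.IsDeriv U V) (h' : G.IsDeriv U' V') :
    G.IsDeriv (U + U') (V + V') := fun x => by
  rw [val_add]
  exact ((h x).add (h' x)).congr_of_eventuallyEq (Eventually.of_forall fun y => G.val_add _ _ y)

theorem IsDeriv.smul {U V : ℝ →ᵇ ℝ} (h : G.IsDeriv U V) (a : ℝ) :
    G.IsDeriv (a • U) (a • V) := fun x => by
  rw [val_smul]
  exact ((h x).const_mul a).congr_of_eventuallyEq (Eventually.of_forall fun y => G.val_smul _ _ y)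

theorem IsDeriv.sub {U V U' V' : ℝ →ᵇ ℝ} (h : G.IsDeriv U V) (h' : G.IsDeriv U' V') :
    G.IsDeriv (U - U') (V - V') := fun x => by
  rw [val_sub]
  exact ((h x).sub (h' x)).congr_of_eventuallyEq (Eventually.of_forall fun y => G.val_sub _ _ y)

variable (G)

theorem isDeriv_halfKernel_one (U : ℝ →ᵇ ℝ) :
    G.IsDeriv (G.halfKernel 1 (by simp) U) (U - G.halfKernel 1 (by simp) U) := fun x => by
  have h := hasDerivAt_integral_exp_left (G.continuous_val U) (G.abs_val_le_norm U) x
  rw [val_sub, show G.val (G.halfKernel 1 (by simp) U) = _ from funext (G.val_halfKernel _ U)]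
  simpa only [one_mul] using h

theorem isDeriv_halfKernel_neg_one (U : ℝ →ᵇ ℝ) :
    G.IsDeriv (G.halfKernel (-1) (by simp) U) (G.halfKernel (-1) (by simp) U - U) := fun x => by
  have h := hasDerivAt_integral_exp_right (G.continuous_val U) (G.abs_val_le_norm U) x
  rw [val_sub, show G.val (G.halfKernel (-1) (by simp) U) = _ from funext (G.val_halfKernel _ U)]
  simpa only [neg_mul, one_mul, sub_neg_eq_add] using h

theorem isDeriv_J (U : ℝ →ᵇ ℝ) : G.IsDeriv (G.J U) (-G.K U) := by
  have h := ((G.isDeriv_halfKernel_one U).add (G.isDeriv_halfKernel_neg_one U)).smul (1 / 2 : ℝ)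
  have e : -G.K U = (1 / 2 : ℝ) • (U - G.halfKernel 1 (by simp) U
      + (G.halfKernel (-1) (by simp) U - U)) := by
    simp only [K, smul_apply, sub_apply]
    module
  rw [e]
  exact h

theorem isDeriv_K (U : ℝ →ᵇ ℝ) : G.IsDeriv (G.K U) (U - G.J U) := by
  have h := ((G.isDeriv_halfKernel_one U).sub (G.isDeriv_halfKernel_neg_one U)).smul (1 / 2 : ℝ)
  have e : U - G.J U = (1 / 2 : ℝ) • (U - G.halfKernel 1 (by simp) U
      - (G.halfKernel (-1) (by simp) U - U)) := by
    simp only [J, smul_apply, add_apply]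
    module
  rw [e]
  exact h

/-- The multiplication of functions: `W * U * V` represents the product of the functions represented
by `U` and `V`, where `W` is the weight as an element of the space. -/
noncomputable def W : ℝ →ᵇ ℝ :=
  BoundedContinuousFunction.ofNormedAddCommGroup G.w G.w_cont 1 fun x => by
    rw [Real.norm_of_nonneg (G.w_pos x).le]; exact G.w_le_one x

@[simp] theorem W_apply (x : ℝ) : G.W x = G.w x := rfl

theorem norm_W_le : ‖G.W‖ ≤ 1 :=
  BoundedContinuousFunction.norm_ofNormedAddCommGroup_le _ zero_le_one _

@[simp] theorem val_W_mul (U V : ℝ →ᵇ ℝ) (x : ℝ) :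
    G.val (G.W * U * V) x = G.val U x * G.val V x := by
  simp only [val, BoundedContinuousFunction.coe_mul, Pi.mul_apply, W_apply]
  ring

theorem norm_W_mul_le (U V : ℝ →ᵇ ℝ) : ‖G.W * U * V‖ ≤ ‖U‖ * ‖V‖ := by
  refine (norm_mul_le _ _).trans (mul_le_mul_of_nonneg_right ?_ (norm_nonneg V))
  exact (norm_mul_le _ _).trans (mul_le_of_le_one_left (norm_nonneg U) G.norm_W_le)

variable {G} in
theorem IsDeriv.mul {U V U' V' : ℝ →ᵇ ℝ} (h : G.IsDeriv U V) (h' : G.IsDeriv U' V') :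
    G.IsDeriv (G.W * U * U') (G.W * V * U' + G.W * U * V') := fun x => by
  simp only [val_add, val_W_mul]
  exact ((h x).mul (h' x)).congr_of_eventuallyEq (Eventually.of_forall fun y => G.val_W_mul _ _ y)

/-- Point evaluation of the represented function. -/
noncomputable def valCLM (x : ℝ) : (ℝ →ᵇ ℝ) →L[ℝ] ℝ :=
  G.w x • BoundedContinuousFunction.evalCLM ℝ x

@[simp] theorem valCLM_apply (x : ℝ) (U : ℝ →ᵇ ℝ) : G.valCLM x U = G.val U x := rfl

/-- Integration of the represented function from `0` to `x`. -/
noncomputable def primCLM (x : ℝ) : (ℝ →ᵇ ℝ) →L[ℝ] ℝ :=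
  LinearMap.mkContinuous
    { toFun := fun U => ∫ y in (0 : ℝ)..x, G.val U y
      map_add' := fun U V => by
        simp only [val_add]
        exact intervalIntegral.integral_add ((G.continuous_val U).intervalIntegrable _ _)
          ((G.continuous_val V).intervalIntegrable _ _)
      map_smul' := fun a U => by simp }
    |x| fun U => by
      have h := intervalIntegral.norm_integral_le_of_norm_le_const (a := (0 : ℝ)) (b := x)
        (f := G.val U) (C := ‖U‖) fun y _ => G.abs_val_le_norm U y
      rw [sub_zero, mul_comm] at h
      exact h

@[simp] theorem primCLM_apply (x : ℝ) (U : ℝ →ᵇ ℝ) :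
    G.primCLM x U = ∫ y in (0 : ℝ)..x, G.val U y := rfl

theorem isDeriv_iff {U V : ℝ →ᵇ ℝ} :
    G.IsDeriv U V ↔ ∀ x, G.valCLM x U - G.valCLM 0 U - G.primCLM x V = 0 := by
  have hp : ∀ x, HasDerivAt (fun x => ∫ y in (0 : ℝ)..x, G.val V y) (G.val V x) x := fun x =>
    intervalIntegral.integral_hasDerivAt_right ((G.continuous_val V).intervalIntegrable _ _)
      ((G.continuous_val V).stronglyMeasurableAtFilter _ _) (G.continuous_val V).continuousAt
  constructor
  · intro h x
    have := intervalIntegral.integral_eq_sub_of_hasDerivAt (a := 0) (b := x) (fun y _ => h y)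
      ((G.continuous_val V).intervalIntegrable _ _)
    simp [this]
  · intro h x
    have h1 : G.val U = fun x => G.val U 0 + ∫ y in (0 : ℝ)..x, G.val V y := by
      ext y
      have := h y
      simp only [valCLM_apply, primCLM_apply] at this
      linarith
    rw [h1]
    exact (hp x).const_add _

variable {G}

/-- The relation `IsDeriv` is a closed linear relation, so it passes to the time derivative. -/
theorem IsDeriv.of_hasDerivAt {U V : ℝ → ℝ →ᵇ ℝ} {U' V' : ℝ →ᵇ ℝ} {t : ℝ}
    (h : ∀ t, G.IsDeriv (U t) (V t)) (hU : HasDerivAt U U' t) (hV : HasDerivAt V V' t) :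
    G.IsDeriv U' V' := by
  rw [isDeriv_iff]
  intro x
  have h1 := (((G.valCLM x).hasFDerivAt.comp_hasDerivAt t hU).sub
    ((G.valCLM 0).hasFDerivAt.comp_hasDerivAt t hU)).sub
    ((G.primCLM x).hasFDerivAt.comp_hasDerivAt t hV)
  refine h1.unique ((hasDerivAt_const t (0 : ℝ)).congr_of_eventuallyEq
    (Eventually.of_forall fun τ => ?_))
  exact G.isDeriv_iff.1 (h τ) x

/-- The relation `IsDeriv` passes to primitives in time. -/
theorem IsDeriv.of_deriv {U V U' V' : ℝ → ℝ →ᵇ ℝ} (h0 : G.IsDeriv (U 0) (V 0))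
    (h : ∀ t, G.IsDeriv (U' t) (V' t)) (hU : ∀ t, HasDerivAt U (U' t) t)
    (hV : ∀ t, HasDerivAt V (V' t) t) (t : ℝ) : G.IsDeriv (U t) (V t) := by
  rw [isDeriv_iff]
  intro x
  have h1 : ∀ t, HasDerivAt (fun t => G.valCLM x (U t) - G.valCLM 0 (U t) - G.primCLM x (V t))
      0 t := fun t =>
    ((((G.valCLM x).hasFDerivAt.comp_hasDerivAt t (hU t)).sub
      ((G.valCLM 0).hasFDerivAt.comp_hasDerivAt t (hU t))).sub
      ((G.primCLM x).hasFDerivAt.comp_hasDerivAt t (hV t))).congr_deriv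
        (G.isDeriv_iff.1 (h t) x)
  have h2 := is_const_of_deriv_eq_zero (fun t => (h1 t).differentiableAt)
    (fun t => (h1 t).deriv) t 0
  rw [h2]
  exact G.isDeriv_iff.1 h0 x

/-! ### Integration by parts and the Fourier transform on a geometry -/

variable (G)

theorem norm_le_of_abs_val_le {U : ℝ →ᵇ ℝ} {C : ℝ} (hC : ∀ x, |G.val U x| ≤ C * G.w x) :
    ‖U‖ ≤ C := by
  have h : G.lift (G.val U) (G.continuous_val U) C hC = U := G.val_injective fun x => by simp
  rw [← h]
  exact G.norm_lift_le _ hC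

/-- The oscillating factor `exp (-i ξ x)`. -/
noncomputable def osc (ξ x : ℝ) : ℂ := Complex.exp (-(Complex.I * ξ * x))

theorem continuous_osc (ξ : ℝ) : Continuous (osc ξ) := by
  unfold osc
  fun_prop

theorem norm_osc (ξ x : ℝ) : ‖osc ξ x‖ = 1 := by
  rw [osc, show -(Complex.I * ξ * x) = ((-(ξ * x) : ℝ) : ℂ) * Complex.I by push_cast; ring,
    Complex.norm_exp_ofReal_mul_I]

theorem hasDerivAt_osc (ξ x : ℝ) : HasDerivAt (osc ξ) (-(Complex.I * ξ) * osc ξ x) x := by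
  have h1 : HasDerivAt (fun x : ℝ => -(Complex.I * ξ * x)) (-(Complex.I * ξ)) x := by
    have := ((Complex.ofRealCLM.hasDerivAt (x := x)).const_mul (Complex.I * ξ)).neg
    exact this.congr_deriv (by simp)
  exact h1.cexp.congr_deriv (by rw [osc]; ring)

theorem integrable_val_mul (U : ℝ →ᵇ ℝ) {k : ℝ → ℂ} (hk : Continuous k) (hk1 : ∀ x, ‖k x‖ ≤ 1) :
    Integrable (fun x => (G.val U x : ℂ) * k x) G.μ := by
  have hc := G.continuous_val U
  refine (G.w_integrable.const_mul ‖U‖).mono'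
    (by fun_prop : Continuous fun x => (G.val U x : ℂ) * k x).aestronglyMeasurable
    (Eventually.of_forall fun x => ?_)
  rw [norm_mul, Complex.norm_real, Real.norm_eq_abs]
  calc _ ≤ |G.val U x| * 1 := by gcongr; exact hk1 x
    _ ≤ _ := by rw [mul_one]; exact G.abs_val_le U x

/-- The Fourier transform `∫ u exp (-i ξ x) dμ` of the function represented by an element. -/
noncomputable def fourier (ξ : ℝ) : (ℝ →ᵇ ℝ) →L[ℝ] ℂ :=
  LinearMap.mkContinuous
    { toFun := fun U => ∫ x, (G.val U x : ℂ) * osc ξ x ∂G.μ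
      map_add' := fun U V => by
        simp only [val_add, Complex.ofReal_add, add_mul]
        exact integral_add (G.integrable_val_mul U (continuous_osc ξ) fun x => (norm_osc ξ x).le)
          (G.integrable_val_mul V (continuous_osc ξ) fun x => (norm_osc ξ x).le)
      map_smul' := fun a U => by
        simp only [val_smul, Complex.ofReal_mul, mul_assoc, RingHom.id_apply, Complex.real_smul,
          ← integral_const_mul] }
    (∫ x, G.w x ∂G.μ) fun U => by
      have h := norm_integral_le_of_norm_le (f := fun x => (G.val U x : ℂ) * osc ξ x)
        (G.w_integrable.const_mul ‖U‖) (Eventually.of_forall fun x => by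
          rw [norm_mul, Complex.norm_real, Real.norm_eq_abs, norm_osc, mul_one]
          exact G.abs_val_le U x)
      rw [integral_const_mul, mul_comm] at h
      exact h

theorem fourier_apply (ξ : ℝ) (U : ℝ →ᵇ ℝ) :
    G.fourier ξ U = ∫ x, (G.val U x : ℂ) * osc ξ x ∂G.μ := rfl

theorem integral_w_nonneg : 0 ≤ ∫ x, G.w x ∂G.μ := integral_nonneg fun x => (G.w_pos x).le

theorem norm_fourier_apply_le (ξ : ℝ) (U : ℝ →ᵇ ℝ) :
    ‖G.fourier ξ U‖ ≤ (∫ x, G.w x ∂G.μ) * ‖U‖ :=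
  (G.fourier ξ).le_of_opNorm_le (LinearMap.mkContinuous_norm_le _ G.integral_w_nonneg _) U

/-- Translation by the period. -/
noncomputable def shift : (ℝ →ᵇ ℝ) →L[ℝ] (ℝ →ᵇ ℝ) :=
  LinearMap.mkContinuous
    { toFun := fun U => U.compContinuous ⟨fun x => x + G.σ, by fun_prop⟩
      map_add' := fun U V => rfl
      map_smul' := fun a U => rfl }
    1 fun U => by
      rw [one_mul]
      refine (BoundedContinuousFunction.norm_le (norm_nonneg U)).2 fun x => ?_
      exact U.norm_coe_le_norm _

@[simp] theorem val_shift (U : ℝ →ᵇ ℝ) (x : ℝ) : G.val (G.shift U) x = G.val U (x + G.σ) := by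
  rw [val, val, G.w_periodic]
  rfl

/-- The element represents a function with the period of the geometry. -/
def IsPeriodic (U : ℝ →ᵇ ℝ) : Prop := G.shift U = U

theorem isPeriodic_iff {U : ℝ →ᵇ ℝ} : G.IsPeriodic U ↔ Function.Periodic (G.val U) G.σ :=
  ⟨fun h x => by rw [← val_shift, h], fun h => G.val_injective fun x => by rw [val_shift, h]⟩

theorem shift_halfKernel {θ : ℝ} (hθ : |θ| = 1) (U : ℝ →ᵇ ℝ) :
    G.shift (G.halfKernel θ hθ U) = G.halfKernel θ hθ (G.shift U) := G.val_injective fun x => by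
  simp only [val_shift, val_halfKernel]
  congr 1
  ext z
  congr 2
  ring

theorem shift_K (U : ℝ →ᵇ ℝ) : G.shift (G.K U) = G.K (G.shift U) := by
  simp [K, shift_halfKernel]

theorem shift_J (U : ℝ →ᵇ ℝ) : G.shift (G.J U) = G.J (G.shift U) := by
  simp [J, shift_halfKernel]

theorem shift_W_mul (U V : ℝ →ᵇ ℝ) :
    G.shift (G.W * U * V) = G.W * G.shift U * G.shift V := G.val_injective fun x => by
  simp

variable {G}

theorem IsPeriodic.K {U : ℝ →ᵇ ℝ} (h : G.IsPeriodic U) : G.IsPeriodic (G.K U) := by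
  rw [IsPeriodic, shift_K, h]

theorem IsPeriodic.J {U : ℝ →ᵇ ℝ} (h : G.IsPeriodic U) : G.IsPeriodic (G.J U) := by
  rw [IsPeriodic, shift_J, h]

theorem IsPeriodic.W_mul {U V : ℝ →ᵇ ℝ} (hU : G.IsPeriodic U) (hV : G.IsPeriodic V) :
    G.IsPeriodic (G.W * U * V) := by
  rw [IsPeriodic, shift_W_mul, hU, hV]

theorem IsPeriodic.add {U V : ℝ →ᵇ ℝ} (hU : G.IsPeriodic U) (hV : G.IsPeriodic V) :
    G.IsPeriodic (U + V) := by
  rw [IsPeriodic, map_add, hU, hV]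

theorem IsPeriodic.sub {U V : ℝ →ᵇ ℝ} (hU : G.IsPeriodic U) (hV : G.IsPeriodic V) :
    G.IsPeriodic (U - V) := by
  rw [IsPeriodic, map_sub, hU, hV]

theorem IsPeriodic.smul {U : ℝ →ᵇ ℝ} (hU : G.IsPeriodic U) (a : ℝ) :
    G.IsPeriodic (a • U) := by
  rw [IsPeriodic, map_smul, hU]

theorem IsDeriv.isPeriodic {U V : ℝ →ᵇ ℝ} (h : G.IsDeriv U V) (hU : G.IsPeriodic U) :
    G.IsPeriodic V := by
  rw [isPeriodic_iff] at hU ⊢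
  intro x
  have h1 := (h (x + G.σ)).comp_add_const x G.σ
  simp only [hU _] at h1
  exact h1.unique (h x)

/-- Integration by parts: the Fourier transform of a derivative. -/
theorem IsDeriv.fourier_eq {U V : ℝ →ᵇ ℝ} (h : G.IsDeriv U V) (hU : G.IsPeriodic U) {ξ : ℝ}
    (hξ : Function.Periodic (osc ξ) G.σ) :
    G.fourier ξ V = Complex.I * ξ * G.fourier ξ U := by
  have hUc := G.continuous_val U
  have hVc := G.continuous_val V
  have hoc := continuous_osc ξ
  have h1 := G.integral_deriv_eq_zero (fun x => (G.val U x : ℂ) * osc ξ x)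
    (fun x => (G.val V x : ℂ) * osc ξ x + (G.val U x : ℂ) * (-(Complex.I * ξ) * osc ξ x))
    (‖V‖ + ‖U‖ * |ξ| + ‖U‖)
    (fun x => (h x).ofReal_comp.mul (hasDerivAt_osc ξ x)) (by fun_prop)
    (fun x => by simp only [G.isPeriodic_iff.1 hU x, hξ x])
    (fun x => by
      rw [norm_mul, Complex.norm_real, Real.norm_eq_abs, norm_osc, mul_one]
      refine (G.abs_val_le U x).trans ?_
      have h1 := G.w_pos x
      have : 0 ≤ (‖V‖ + ‖U‖ * |ξ|) * G.w x := by positivity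
      linarith)
    (fun x => by
      refine (norm_add_le _ _).trans ?_
      simp only [norm_mul, norm_neg, Complex.norm_real, Real.norm_eq_abs, norm_osc, mul_one,
        Complex.norm_I, one_mul]
      have h1 := G.abs_val_le V x
      have h2 := mul_le_mul_of_nonneg_right (G.abs_val_le U x) (abs_nonneg ξ)
      have : 0 ≤ ‖U‖ * G.w x := mul_nonneg (norm_nonneg U) (G.w_pos x).le
      nlinarith)
  have e : ∀ x, (G.val V x : ℂ) * osc ξ x + (G.val U x : ℂ) * (-(Complex.I * ξ) * osc ξ x)
      = (G.val V x : ℂ) * osc ξ x - Complex.I * ξ * ((G.val U x : ℂ) * osc ξ x) := fun x => by ring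
  simp only [e] at h1
  rw [integral_sub (G.integrable_val_mul V hoc fun x => (norm_osc ξ x).le)
    ((G.integrable_val_mul U hoc fun x => (norm_osc ξ x).le).const_mul _), integral_const_mul,
    sub_eq_zero] at h1
  exact h1

theorem IsDeriv.fourier_zero {U V : ℝ →ᵇ ℝ} (h : G.IsDeriv U V) (hU : G.IsPeriodic U) :
    G.fourier 0 V = 0 := by
  rw [h.fourier_eq hU (fun x => by simp [osc])]
  simp

/-- The Sobolev embedding of `H¹` of a period into `L^∞`. -/
theorem IsDeriv.sq_val_le {U V : ℝ →ᵇ ℝ} (h : G.IsDeriv U V) (hU : G.IsPeriodic U) (x : ℝ) :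
    G.val U x ^ 2 ≤ 2 * (G.fourier 0 (G.W * U * U + G.W * V * V)).re := by
  have hUc := G.continuous_val U
  have hVc := G.continuous_val V
  have hV := h.isPeriodic hU
  set Q := G.W * U * U + G.W * V * V with hQ
  have hQv : ∀ y, G.val Q y = G.val U y ^ 2 + G.val V y ^ 2 := fun y => by
    rw [hQ, val_add, val_W_mul, val_W_mul]; ring
  have hQp : G.IsPeriodic Q := (hU.W_mul hU).add (hV.W_mul hV)
  have e1 : (G.fourier 0 Q).re = ∫ y, G.val Q y ∂G.μ := by
    have : ∀ y, (G.val Q y : ℂ) * osc 0 y = (G.val Q y : ℂ) := fun y => by simp [osc]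
    rw [fourier_apply]
    simp only [this, integral_complex_ofReal, Complex.ofReal_re]
  have h1 : ∫ y in x..(x + 1), G.val Q y ≤ (G.fourier 0 Q).re := by
    rw [e1]
    exact G.unit_integral_le _ ‖Q‖ (G.continuous_val Q) (fun y => by rw [hQv]; positivity)
      (G.isPeriodic_iff.1 hQp) (fun y => (le_abs_self _).trans (G.abs_val_le Q y)) x
  -- the function `-(x + 1 - y) u(y)²` vanishes at `x + 1` and equals `-u(x)²` at `x`
  have h2 : ∀ y ∈ uIcc x (x + 1), HasDerivAt (fun y => -((x + 1 - y) * G.val U y ^ 2))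
      (G.val U y ^ 2 - 2 * (x + 1 - y) * (G.val U y * G.val V y)) y := fun y _ => by
    have := (((hasDerivAt_id y).const_sub (x + 1)).mul ((h y).pow 2)).neg
    refine this.congr_deriv ?_
    simp
    ring
  have h3 := intervalIntegral.integral_eq_sub_of_hasDerivAt h2
    (Continuous.intervalIntegrable (by fun_prop) _ _)
  have h4 : ∫ y in x..(x + 1), (G.val U y ^ 2 - 2 * (x + 1 - y) * (G.val U y * G.val V y))
      ≤ ∫ y in x..(x + 1), 2 * G.val Q y := by
    refine intervalIntegral.integral_mono_on (by linarith)
      (Continuous.intervalIntegrable (by fun_prop) _ _)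
      (((G.continuous_val Q).const_smul (2 : ℝ)).intervalIntegrable _ _) fun y hy => ?_
    rw [hQv]
    have a1 : 0 ≤ x + 1 - y := by linarith [hy.2]
    have a2 : x + 1 - y ≤ 1 := by linarith [hy.1]
    nlinarith [mul_nonneg a1 (sq_nonneg (G.val U y + G.val V y)), sq_nonneg (G.val U y),
      sq_nonneg (G.val V y)]
  rw [intervalIntegral.integral_const_mul] at h4
  rw [h3] at h4
  simp at h4
  linarith

end Geometry

/-! ### Global solutions from the conserved energy -/

/-- The nonlinearity `u ^ 2 / 2` with `u` truncated to `[-M, M]`, which makes it Lipschitz. -/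
noncomputable def truncSq (M u : ℝ) : ℝ := (max (-M) (min M u)) ^ 2 / 2

theorem continuous_truncSq (M : ℝ) : Continuous (truncSq M) := by
  unfold truncSq
  fun_prop

theorem truncSq_of_abs_le {M u : ℝ} (h : |u| ≤ M) : truncSq M u = u ^ 2 / 2 := by
  obtain ⟨h1, h2⟩ := abs_le.1 h
  rw [truncSq, min_eq_right h2, max_eq_right h1]

theorem abs_truncSq_sub_le {M : ℝ} (hM : 0 ≤ M) (u v : ℝ) :
    |truncSq M u - truncSq M v| ≤ M * |u - v| := by
  have hb : ∀ u, |max (-M) (min M u)| ≤ M := fun u =>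
    abs_le.2 ⟨le_max_left _ _, max_le (by linarith) (min_le_left _ _)⟩
  have hd : |max (-M) (min M u) - max (-M) (min M v)| ≤ |u - v| := by
    rw [max_comm (-M), max_comm (-M), min_comm M u, min_comm M v]
    exact (abs_max_sub_max_le_abs _ _ _).trans (by
      simpa using abs_min_sub_min_le_max u M v M)
  have e : truncSq M u - truncSq M v = (max (-M) (min M u) + max (-M) (min M v)) / 2 *
      (max (-M) (min M u) - max (-M) (min M v)) := by
    rw [truncSq, truncSq]; ring
  rw [e, abs_mul]
  refine mul_le_mul ?_ hd (abs_nonneg _) hM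
  rw [abs_div, abs_two, div_le_iff₀ two_pos]
  have := abs_add_le (max (-M) (min M u)) (max (-M) (min M v))
  linarith [hb u, hb v]

theorem abs_truncSq_le {M : ℝ} (hM : 0 ≤ M) (u : ℝ) : |truncSq M u| ≤ M * |u| := by
  have h := abs_truncSq_sub_le hM u 0
  have h0 : truncSq M 0 = 0 := by simp [truncSq_of_abs_le (M := M) (u := 0) (by simpa using hM)]
  rwa [h0, sub_zero, sub_zero] at h

theorem truncSq_le {M : ℝ} (hM : 0 ≤ M) (u : ℝ) : |truncSq M u| ≤ M ^ 2 / 2 := by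
  have hb : |max (-M) (min M u)| ≤ M :=
    abs_le.2 ⟨le_max_left _ _, max_le (by linarith) (min_le_left _ _)⟩
  rw [truncSq, abs_of_nonneg (by positivity), ← sq_abs]
  gcongr

namespace Geometry

variable (G : Geometry)

/-- The truncated nonlinearity on the weighted space. -/
noncomputable def trunc {M : ℝ} (hM : 0 ≤ M) (U : ℝ →ᵇ ℝ) : ℝ →ᵇ ℝ :=
  G.lift (fun x => truncSq M (G.val U x)) ((continuous_truncSq M).comp (G.continuous_val U))
    (M * ‖U‖) fun x => (abs_truncSq_le hM _).trans (by
      rw [mul_assoc]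
      gcongr
      exact G.abs_val_le U x)

@[simp] theorem val_trunc {M : ℝ} (hM : 0 ≤ M) (U : ℝ →ᵇ ℝ) (x : ℝ) :
    G.val (G.trunc hM U) x = truncSq M (G.val U x) := by simp [trunc]

theorem lipschitzWith_trunc {M : ℝ} (hM : 0 ≤ M) :
    LipschitzWith M.toNNReal (G.trunc hM) := by
  refine LipschitzWith.of_dist_le_mul fun U V => ?_
  rw [Real.coe_toNNReal M hM, dist_eq_norm, dist_eq_norm]
  refine G.norm_le_of_abs_val_le fun x => ?_
  rw [val_sub, val_trunc, val_trunc, mul_assoc]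
  refine (abs_truncSq_sub_le hM _ _).trans ?_
  rw [← val_sub]
  gcongr
  exact G.abs_val_le _ x

/-- A representative of a primitive of the truncated nonlinearity, evaluated along `U`. -/
theorem exists_isDeriv_trunc {M : ℝ} (hM : 0 ≤ M) {U V : ℝ →ᵇ ℝ} (h : G.IsDeriv U V)
    (hU : G.IsPeriodic U) :
    ∃ P, G.IsPeriodic P ∧ G.IsDeriv P (G.W * G.trunc hM U * V) := by
  have hc := continuous_truncSq M
  have hd : ∀ y, HasDerivAt (fun y => ∫ z in (0 : ℝ)..y, truncSq M z) (truncSq M y) y := fun y =>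
    intervalIntegral.integral_hasDerivAt_right (hc.intervalIntegrable _ _)
      (hc.stronglyMeasurableAtFilter _ _) hc.continuousAt
  have hdc : Continuous fun y => ∫ z in (0 : ℝ)..y, truncSq M z :=
    continuous_iff_continuousAt.2 fun y => (hd y).continuousAt
  refine ⟨G.lift (fun x => ∫ z in (0 : ℝ)..G.val U x, truncSq M z)
    (hdc.comp (G.continuous_val U)) (M ^ 2 / 2 * ‖U‖) fun x => ?_, ?_, fun x => ?_⟩
  · have h1 := intervalIntegral.norm_integral_le_of_norm_le_const (a := (0 : ℝ)) (b := G.val U x)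
      (f := truncSq M) (C := M ^ 2 / 2) fun y _ => truncSq_le hM y
    rw [sub_zero, Real.norm_eq_abs] at h1
    refine h1.trans ?_
    rw [mul_assoc]
    gcongr
    exact G.abs_val_le U x
  · rw [isPeriodic_iff] at hU ⊢
    intro x
    simp only [val_lift, hU x]
  · rw [show G.val (G.lift _ _ _ _) = _ from funext fun x => G.val_lift _ _ x, val_W_mul, val_trunc]
    exact (hd _).comp x (h x)

theorem shift_trunc {M : ℝ} (hM : 0 ≤ M) (U : ℝ →ᵇ ℝ) :
    G.shift (G.trunc hM U) = G.trunc hM (G.shift U) := G.val_injective fun x => by simp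

/-- The right-hand side `K (u + u ^ 2 / 2)` of the equation in its integrated form. -/
noncomputable def field (U : ℝ →ᵇ ℝ) : ℝ →ᵇ ℝ := G.K (U + (1 / 2 : ℝ) • (G.W * U * U))

/-- Global existence for `u' = K (u + u ^ 2 / 2)`. The equation with truncated nonlinearity has a
global solution since its vector field is Lipschitz, and it conserves the same energy
`∫ u ^ 2 + uₓ ^ 2`, because every nonlinearity `f u` contributes the integral of the derivative
`f u uₓ`. The energy bounds `|u|`, so a high truncation is never active. -/
theorem exists_solution {U₀ V₀ : ℝ →ᵇ ℝ} (h₀ : G.IsDeriv U₀ V₀) (hp : G.IsPeriodic U₀) :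
    ∃ U : ℝ → ℝ →ᵇ ℝ, U 0 = U₀ ∧ (∀ t, HasDerivAt U (G.field (U t)) t) ∧
      ∀ t, G.IsPeriodic (U t) := by
  set E₀ := (G.fourier 0 (G.W * U₀ * U₀ + G.W * V₀ * V₀)).re with hE₀
  set M := √(2 * E₀) with hM
  have hM0 : 0 ≤ M := Real.sqrt_nonneg _
  set N := G.trunc hM0 with hN
  have hLip : LipschitzWith (‖G.K‖₊ * (1 + M.toNNReal)) fun U => G.K (U + N U) :=
    G.K.lipschitz.comp (LipschitzWith.id.add (G.lipschitzWith_trunc hM0))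
  obtain ⟨U, hU0, hU⟩ := exists_global_solution hLip U₀
  have hper : ∀ t, G.IsPeriodic (U t) := by
    have hS : ∀ t, HasDerivAt (fun t => G.shift (U t))
        (G.K (G.shift (U t) + N (G.shift (U t)))) t :=
      fun t => by
        have h1 := G.shift.hasFDerivAt.comp_hasDerivAt t (hU t)
        refine h1.congr_deriv ?_
        rw [shift_K, map_add, hN, shift_trunc]
    have h2 : (fun t => G.shift (U t)) = U :=
      ODE_solution_unique_univ (t₀ := 0) (s := fun _ => univ)
        (v := fun _ U => G.K (U + N U)) (fun _ => hLip.lipschitzOnWith)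
        (fun t => ⟨hS t, mem_univ _⟩) (fun t => ⟨hU t, mem_univ _⟩)
        (by simp only [hU0]; exact hp)
    exact fun t => congrFun h2 t
  have hUc : Continuous U := continuous_iff_continuousAt.2 fun t => (hU t).continuousAt
  let h : ℝ → ℝ →ᵇ ℝ := fun t => U t + N (U t)
  have hhc : Continuous h := hUc.add ((G.lipschitzWith_trunc hM0).continuous.comp hUc)
  have hgc : Continuous fun t => h t - G.J (h t) := hhc.sub (G.J.continuous.comp hhc)
  let V : ℝ → ℝ →ᵇ ℝ := fun t => V₀ + ∫ s in (0 : ℝ)..t, (h s - G.J (h s))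
  have hV : ∀ t, HasDerivAt V (h t - G.J (h t)) t := fun t =>
    (intervalIntegral.integral_hasDerivAt_right (hgc.intervalIntegrable _ _)
      (hgc.stronglyMeasurableAtFilter _ _) hgc.continuousAt).const_add _
  have hV0 : V 0 = V₀ := by simp [V]
  have hD : ∀ t, G.IsDeriv (U t) (V t) :=
    IsDeriv.of_deriv (by rw [hU0, hV0]; exact h₀) (fun t => G.isDeriv_K (h t)) hU hV
  have hE : ∀ t, HasDerivAt (fun t => G.fourier 0 (G.W * U t * U t + G.W * V t * V t)) 0 t := by
    intro t
    have hW := hasDerivAt_const t G.W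
    have h1 := ((hW.mul (hU t)).mul (hU t)).add ((hW.mul (hV t)).mul (hV t))
    have h2 := (G.fourier 0).hasFDerivAt.comp_hasDerivAt t h1
    refine h2.congr_deriv ?_
    obtain ⟨P, hPp, hP⟩ := G.exists_isDeriv_trunc hM0 (hD t) (hper t)
    have hhp : G.IsPeriodic (h t) := (hper t).add (by
      rw [IsPeriodic, hN, shift_trunc, hper t])
    -- the time derivative of `u² + uₓ²` is the `x`-derivative of `2 P + u² - 2 u J h`, where
    -- `Pₓ = f u uₓ` for the truncated nonlinearity `f` and `h = u + f u`
    have hF : G.IsDeriv ((2 : ℝ) • P + G.W * U t * U t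
        - (2 : ℝ) • (G.W * U t * G.J (h t))) _ :=
      ((hP.smul 2).add ((hD t).mul (hD t))).sub (((hD t).mul (G.isDeriv_J (h t))).smul 2)
    have hFp := ((hPp.smul 2).add ((hper t).W_mul (hper t))).sub
      (((hper t).W_mul hhp.J).smul 2)
    rw [← hF.fourier_zero hFp]
    congr 1
    refine G.val_injective fun x => ?_
    simp only [Pi.mul_apply, zero_mul, zero_add, val_add, val_W_mul, val_sub, val_smul, val_neg, h,
      hN]
    ring
  have hEc : ∀ t, (G.fourier 0 (G.W * U t * U t + G.W * V t * V t)).re = E₀ := fun t => by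
    rw [is_const_of_deriv_eq_zero (fun t => (hE t).differentiableAt) (fun t => (hE t).deriv) t 0,
      hU0, hV0]
  have hb : ∀ t x, |G.val (U t) x| ≤ M := fun t x => by
    refine Real.abs_le_sqrt ?_
    rw [← hEc t]
    exact (hD t).sq_val_le (hper t) x
  refine ⟨U, hU0, fun t => ?_, hper⟩
  have e : N (U t) = (1 / 2 : ℝ) • (G.W * U t * U t) := G.val_injective fun x => by
    rw [hN, val_trunc, truncSq_of_abs_le (hb t x), val_smul, val_W_mul]
    ring
  have := hU t
  rw [e] at this
  exact this

/-! ### Smoothness of solutions -/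

/-- `U` is a smooth curve in the weighted space whose values have `n` spatial derivatives, each of
which is a smooth curve in the weighted space. -/
def SpaceSmooth : ℕ → (ℝ → ℝ →ᵇ ℝ) → Prop
  | 0, U => ContDiff ℝ ∞ U
  | n + 1, U => ContDiff ℝ ∞ U ∧ ∃ V, SpaceSmooth n V ∧ ∀ t, G.IsDeriv (U t) (V t)

variable {G}

theorem SpaceSmooth.contDiff {n : ℕ} {U : ℝ → ℝ →ᵇ ℝ} (h : G.SpaceSmooth n U) :
    ContDiff ℝ ∞ U := by
  cases n with
  | zero => exact h
  | succ n => exact h.1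

theorem SpaceSmooth.of_succ {n : ℕ} {U : ℝ → ℝ →ᵇ ℝ} (h : G.SpaceSmooth (n + 1) U) :
    G.SpaceSmooth n U := by
  induction n generalizing U with
  | zero => exact h.1
  | succ n ih =>
    obtain ⟨hU, V, hV, hd⟩ := h
    exact ⟨hU, V, ih hV, hd⟩

theorem SpaceSmooth.add {n : ℕ} {U V : ℝ → ℝ →ᵇ ℝ} (hU : G.SpaceSmooth n U)
    (hV : G.SpaceSmooth n V) : G.SpaceSmooth n (fun t => U t + V t) := by
  induction n generalizing U V with
  | zero => exact ContDiff.add hU hV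
  | succ n ih =>
    obtain ⟨hU, U', hU', hdU⟩ := hU
    obtain ⟨hV, V', hV', hdV⟩ := hV
    exact ⟨hU.add hV, _, ih hU' hV', fun t => (hdU t).add (hdV t)⟩

theorem SpaceSmooth.smul {n : ℕ} {U : ℝ → ℝ →ᵇ ℝ} (hU : G.SpaceSmooth n U) (a : ℝ) :
    G.SpaceSmooth n (fun t => a • U t) := by
  induction n generalizing U with
  | zero => exact ContDiff.const_smul a (show ContDiff ℝ ∞ U from hU)
  | succ n ih =>
    obtain ⟨hU, U', hU', hdU⟩ := hU
    exact ⟨hU.const_smul a, _, ih hU', fun t => (hdU t).smul a⟩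

theorem SpaceSmooth.sub {n : ℕ} {U V : ℝ → ℝ →ᵇ ℝ} (hU : G.SpaceSmooth n U)
    (hV : G.SpaceSmooth n V) : G.SpaceSmooth n (fun t => U t - V t) := by
  have e : (fun t => U t - V t) = fun t => U t + (-1 : ℝ) • V t :=
    funext fun t => G.val_injective fun x => by simp [sub_eq_add_neg]
  rw [e]
  exact hU.add (hV.smul (-1))

theorem SpaceSmooth.W_mul {n : ℕ} {U V : ℝ → ℝ →ᵇ ℝ} (hU : G.SpaceSmooth n U)
    (hV : G.SpaceSmooth n V) : G.SpaceSmooth n (fun t => G.W * U t * V t) := by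
  induction n generalizing U V with
  | zero => exact (contDiff_const.mul (show ContDiff ℝ ∞ U from hU)).mul hV
  | succ n ih =>
    have hU0 := hU.of_succ
    have hV0 := hV.of_succ
    obtain ⟨hU, U', hU', hdU⟩ := hU
    obtain ⟨hV, V', hV', hdV⟩ := hV
    exact ⟨(contDiff_const.mul hU).mul hV, _, (ih hU' hV0).add (ih hU0 hV'),
      fun t => (hdU t).mul (hdV t)⟩

theorem SpaceSmooth.J_and_K {n : ℕ} {U : ℝ → ℝ →ᵇ ℝ} (hU : G.SpaceSmooth n U) :
    G.SpaceSmooth n (fun t => G.J (U t)) ∧ G.SpaceSmooth n (fun t => G.K (U t)) := by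
  induction n generalizing U with
  | zero => exact ⟨G.J.contDiff.comp (show ContDiff ℝ ∞ U from hU),
      G.K.contDiff.comp (show ContDiff ℝ ∞ U from hU)⟩
  | succ n ih =>
    obtain ⟨hJ, hK⟩ := ih hU.of_succ
    refine ⟨⟨G.J.contDiff.comp hU.contDiff, fun t => -G.K (U t), ?_, fun t => G.isDeriv_J _⟩,
      ⟨G.K.contDiff.comp hU.contDiff, fun t => U t - G.J (U t), hU.of_succ.sub hJ,
        fun t => G.isDeriv_K _⟩⟩
    have e : (fun t => -G.K (U t)) = fun t => (-1 : ℝ) • G.K (U t) :=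
      funext fun t => G.val_injective fun x => by simp
    rw [e]
    exact hK.smul (-1)

/-- The operator `K` gains a derivative: `n` derivatives of `U` give `n + 1` derivatives of
`K U`. -/
theorem SpaceSmooth.K {n : ℕ} {U : ℝ → ℝ →ᵇ ℝ} (hU : G.SpaceSmooth n U) :
    G.SpaceSmooth (n + 1) (fun t => G.K (U t)) :=
  ⟨G.K.contDiff.comp hU.contDiff, _, hU.sub hU.J_and_K.1, fun _ => G.isDeriv_K _⟩

theorem contDiff_of_hasDerivAt {U U' : ℝ → ℝ →ᵇ ℝ} (h : ∀ t, HasDerivAt U (U' t) t)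
    (h' : ContDiff ℝ ∞ U') : ContDiff ℝ ∞ U := by
  rw [contDiff_infty_iff_deriv]
  refine ⟨fun t => (h t).differentiableAt, ?_⟩
  rwa [show deriv U = U' from funext fun t => (h t).deriv]

theorem SpaceSmooth.of_deriv {n : ℕ} {U U' : ℝ → ℝ →ᵇ ℝ} (h : ∀ t, HasDerivAt U (U' t) t)
    (h' : G.SpaceSmooth n U') (h0 : G.SpaceSmooth n (fun _ => U 0)) : G.SpaceSmooth n U := by
  induction n generalizing U U' with
  | zero => exact contDiff_of_hasDerivAt h h'
  | succ n ih =>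
    obtain ⟨hU', V', hV', hd⟩ := h'
    obtain ⟨-, V₀, hV₀, hd₀⟩ := h0
    have hc := hV'.contDiff.continuous
    let V : ℝ → ℝ →ᵇ ℝ := fun t => V₀ 0 + ∫ s in (0 : ℝ)..t, V' s
    have hV : ∀ t, HasDerivAt V (V' t) t := fun t =>
      (intervalIntegral.integral_hasDerivAt_right (hc.intervalIntegrable _ _)
        (hc.stronglyMeasurableAtFilter _ _) hc.continuousAt).const_add _
    have e : V 0 = V₀ 0 := by simp [V]
    have e' : V₀ = fun _ => V 0 := by
      funext t
      rw [e]
      exact G.val_injective fun x => (hd₀ t x).unique (hd₀ 0 x)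
    exact ⟨contDiff_of_hasDerivAt h hU', V, ih hV hV' (e' ▸ hV₀),
      IsDeriv.of_deriv (e ▸ hd₀ 0) hd h hV⟩

theorem SpaceSmooth.deriv {n : ℕ} {U : ℝ → ℝ →ᵇ ℝ} (h : G.SpaceSmooth n U) :
    G.SpaceSmooth n (deriv U) := by
  induction n generalizing U with
  | zero => exact (contDiff_infty_iff_deriv.1 h).2
  | succ n ih =>
    obtain ⟨hU, V, hV, hd⟩ := h
    refine ⟨(contDiff_infty_iff_deriv.1 hU).2, _, ih hV, fun t => IsDeriv.of_hasDerivAt hd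
      ((contDiff_infty_iff_deriv.1 hU).1 t).hasDerivAt
      ((contDiff_infty_iff_deriv.1 hV.contDiff).1 t).hasDerivAt⟩

theorem exists_isDeriv_of_forall_spaceSmooth {U : ℝ → ℝ →ᵇ ℝ} (h : ∀ n, G.SpaceSmooth n U) :
    ∃ V, (∀ n, G.SpaceSmooth n V) ∧ ∀ t, G.IsDeriv (U t) (V t) := by
  obtain ⟨-, V, -, hd⟩ := h 1
  refine ⟨V, fun n => ?_, hd⟩
  obtain ⟨-, V', hV', hd'⟩ := h (n + 1)
  have : V = V' := funext fun t => G.val_injective fun x => (hd t x).unique (hd' t x)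
  rwa [this]

theorem exists_iteratedDeriv_eq {U : ℝ → ℝ →ᵇ ℝ} (h : ∀ n, G.SpaceSmooth n U) (k : ℕ) :
    ∃ V, (∀ n, G.SpaceSmooth n V) ∧ ∀ t, iteratedDeriv k (G.val (U t)) = G.val (V t) := by
  induction k with
  | zero => exact ⟨U, h, fun t => iteratedDeriv_zero⟩
  | succ k ih =>
    obtain ⟨V, hV, e⟩ := ih
    obtain ⟨V', hV', hd⟩ := exists_isDeriv_of_forall_spaceSmooth hV
    refine ⟨V', hV', fun t => ?_⟩
    rw [iteratedDeriv_succ, e]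
    exact funext fun x => (hd t x).deriv

theorem contDiff_val {U : ℝ → ℝ →ᵇ ℝ} (h : ∀ n, G.SpaceSmooth n U) :
    ContDiff ℝ ∞ (Function.uncurry fun t x => G.val (U t) x) := by
  refine contDiff_of_closed_under_partials
    (S := {f | ∃ U, (∀ n, G.SpaceSmooth n U) ∧ f = fun t x => G.val (U t) x}) ?_ ?_ ?_ ⟨U, h, rfl⟩
  · rintro _ ⟨U, hU, rfl⟩
    have h1 := (hU 0).contDiff.continuous
    have h2 := G.w_cont
    have h3 : Continuous fun q : ℝ × ℝ => (U q.1) q.2 :=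
      (h1.comp continuous_fst).eval continuous_snd
    exact (h2.comp continuous_snd).mul h3
  · rintro _ ⟨U, hU, rfl⟩
    refine ⟨_, ⟨deriv U, fun n => (hU n).deriv, rfl⟩, fun t x => ?_⟩
    exact (G.valCLM x).hasFDerivAt.comp_hasDerivAt t
      ((contDiff_infty_iff_deriv.1 (hU 0).contDiff).1 t).hasDerivAt
  · rintro _ ⟨U, hU, rfl⟩
    obtain ⟨V, hV, hd⟩ := exists_isDeriv_of_forall_spaceSmooth hU
    exact ⟨_, ⟨V, hV, rfl⟩, hd⟩

variable (G)

theorem contDiff_field : ContDiff ℝ ∞ G.field := by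
  unfold field
  exact G.K.contDiff.comp (contDiff_id.add (ContDiff.const_smul (1 / 2 : ℝ)
    ((contDiff_const.mul contDiff_id).mul contDiff_id)))

variable {G}

theorem contDiff_solution {U : ℝ → ℝ →ᵇ ℝ} (hU : ∀ t, HasDerivAt U (G.field (U t)) t) :
    ContDiff ℝ ∞ U := by
  have hd : deriv U = fun t => G.field (U t) := funext fun t => (hU t).deriv
  rw [contDiff_infty]
  intro n
  induction n with
  | zero => exact contDiff_zero.2 (continuous_iff_continuousAt.2 fun t => (hU t).continuousAt)
  | succ n ih =>
    rw [show ((n + 1 : ℕ) : WithTop ℕ∞) = n + 1 by push_cast; rfl, contDiff_succ_iff_deriv]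
    refine ⟨fun t => (hU t).differentiableAt, by simp, ?_⟩
    rw [hd]
    exact (G.contDiff_field.of_le (by exact_mod_cast le_top)).comp ih

/-- Solutions inherit the spatial smoothness of the data: the vector field gains a derivative. -/
theorem spaceSmooth_solution {U : ℝ → ℝ →ᵇ ℝ} (hU : ∀ t, HasDerivAt U (G.field (U t)) t)
    (h0 : ∀ n, G.SpaceSmooth n (fun _ => U 0)) (n : ℕ) : G.SpaceSmooth n U := by
  induction n with
  | zero => exact contDiff_solution hU
  | succ n ih => exact SpaceSmooth.of_deriv hU (ih.add ((ih.W_mul ih).smul _)).K (h0 (n + 1))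

/-- A curve solving the integrated equation solves the Benjamin–Bona–Mahony equation pointwise. -/
theorem satisfiesBBM {U : ℝ → ℝ →ᵇ ℝ} (hU : ∀ t, HasDerivAt U (G.field (U t)) t)
    (h : ∀ n, G.SpaceSmooth n U) : SatisfiesBBM fun t x => G.val (U t) x := by
  intro t _ x
  obtain ⟨V, hV, hd⟩ := exists_isDeriv_of_forall_spaceSmooth h
  obtain ⟨V₂, hV₂, hd₂⟩ := exists_isDeriv_of_forall_spaceSmooth hV
  have hVt := ((contDiff_infty_iff_deriv.1 (hV 0).contDiff).1 t).hasDerivAt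
  have hV₂t := ((contDiff_infty_iff_deriv.1 (hV₂ 0).contDiff).1 t).hasDerivAt
  set q := U t + (1 / 2 : ℝ) • (G.W * U t * U t) with hq
  have hqd : G.IsDeriv q (V t + (1 / 2 : ℝ) • (G.W * V t * U t + G.W * U t * V t)) :=
    (hd t).add (((hd t).mul (hd t)).smul _)
  have e1 : deriv V t = q - G.J q := G.val_injective fun y =>
    (IsDeriv.of_hasDerivAt hd (hU t) hVt y).unique (G.isDeriv_K q y)
  have e2 : deriv V₂ t = V t + (1 / 2 : ℝ) • (G.W * V t * U t + G.W * U t * V t) - -G.K q :=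
    G.val_injective fun y =>
      (IsDeriv.of_hasDerivAt hd₂ hVt hV₂t y).unique (e1 ▸ hqd.sub (G.isDeriv_J q) y)
  have d1 : deriv (fun τ => G.val (U τ) x) t = G.val (G.K q) x :=
    ((G.valCLM x).hasFDerivAt.comp_hasDerivAt t (hU t)).deriv
  have i2 : ∀ τ, iteratedDeriv 2 (G.val (U τ)) = G.val (V₂ τ) := fun τ => by
    rw [iteratedDeriv_succ, iteratedDeriv_one, show deriv (G.val (U τ)) = G.val (V τ) from
      funext fun y => (hd τ y).deriv]
    exact funext fun y => (hd₂ τ y).deriv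
  have d2 : deriv (fun τ => iteratedDeriv 2 (G.val (U τ)) x) t = G.val (deriv V₂ t) x := by
    simp only [i2]
    exact ((G.valCLM x).hasFDerivAt.comp_hasDerivAt t hV₂t).deriv
  have d3 : deriv (G.val (U t)) x = G.val (V t) x := (hd t x).deriv
  have d4 : deriv (fun y => G.val (U t) y ^ 2) x = 2 * G.val (U t) x * G.val (V t) x := by
    refine ((hd t x).pow 2).deriv.trans ?_
    simp
  change deriv (fun τ => G.val (U τ) x) t
    - deriv (fun τ => iteratedDeriv 2 (G.val (U τ)) x) t
    + deriv (G.val (U t)) x + (1 / 2 : ℝ) * deriv (fun y => G.val (U t) y ^ 2) x = 0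
  rw [d1, d2, d3, d4, e2]
  simp only [val_sub, val_add, val_smul, val_neg, val_W_mul]
  ring

variable (G)

/-- Smooth functions with the period of the geometry all of whose derivatives are bounded by
multiples of the weight. -/
structure IsNice (f : ℝ → ℝ) : Prop where
  contDiff : ContDiff ℝ ∞ f
  periodic : Function.Periodic f G.σ
  bound : ∀ k, ∃ C, ∀ x, |iteratedDeriv k f x| ≤ C * G.w x

variable {G}

theorem IsNice.spaceSmooth {f : ℝ → ℝ} (hf : G.IsNice f) {U : ℝ →ᵇ ℝ} (hU : G.val U = f) (n : ℕ) :
    G.SpaceSmooth n (fun _ => U) := by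
  have key : ∀ (n k : ℕ) (U : ℝ →ᵇ ℝ), G.val U = iteratedDeriv k f →
      G.SpaceSmooth n (fun _ => U) := by
    intro n
    induction n with
    | zero => exact fun _ _ _ => contDiff_const
    | succ n ih =>
      intro k U hU
      obtain ⟨C, hC⟩ := hf.bound (k + 1)
      have hc := hf.contDiff.continuous_iteratedDeriv (k + 1) (by exact_mod_cast le_top)
      refine ⟨contDiff_const, _, ih (k + 1) (G.lift _ hc C hC) (funext (G.val_lift hc hC)),
        fun _ x => ?_⟩
      rw [hU, val_lift, iteratedDeriv_succ]
      exact (hf.contDiff.differentiable_iteratedDeriv k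
        (by exact_mod_cast WithTop.coe_lt_top k) x).hasDerivAt
  exact key n 0 U (by rw [iteratedDeriv_zero]; exact hU)

theorem IsNice.exists_val_eq {f : ℝ → ℝ} (hf : G.IsNice f) :
    ∃ U, G.val U = f ∧ G.IsPeriodic U := by
  obtain ⟨C, hC⟩ := hf.bound 0
  simp only [iteratedDeriv_zero] at hC
  have e := G.val_lift hf.contDiff.continuous hC
  refine ⟨_, funext e, ?_⟩
  rw [isPeriodic_iff, funext e]
  exact hf.periodic

/-- Global existence for smooth data. -/
theorem IsNice.exists_solution {f : ℝ → ℝ} (hf : G.IsNice f) :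
    ∃ U : ℝ → ℝ →ᵇ ℝ, G.val (U 0) = f ∧ (∀ t, HasDerivAt U (G.field (U t)) t) ∧
      (∀ t, G.IsPeriodic (U t)) ∧ ∀ n, G.SpaceSmooth n U := by
  obtain ⟨U₀, e, hp⟩ := hf.exists_val_eq
  obtain ⟨-, V₀, -, hd⟩ := hf.spaceSmooth e 1
  obtain ⟨U, h0, hU, hper⟩ := G.exists_solution (hd 0) hp
  refine ⟨U, h0 ▸ e, hU, hper, spaceSmooth_solution hU fun n => ?_⟩
  rw [h0]
  exact hf.spaceSmooth e n

/-! ### Short-time expansion and norm inflation at low frequency -/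

variable (G)

theorem norm_quadratic_le (U : ℝ →ᵇ ℝ) :
    ‖(1 / 2 : ℝ) • (G.W * U * U)‖ ≤ ‖U‖ ^ 2 / 2 := by
  rw [norm_smul, Real.norm_of_nonneg (by norm_num)]
  have := G.norm_W_mul_le U U
  nlinarith

theorem norm_field_le (U : ℝ →ᵇ ℝ) : ‖G.field U‖ ≤ ‖G.K‖ * (‖U‖ + ‖U‖ ^ 2 / 2) := by
  refine (G.K.le_opNorm _).trans ?_
  gcongr
  exact (norm_add_le _ _).trans (by gcongr; exact G.norm_quadratic_le U)

theorem norm_field_sub_le (U V : ℝ →ᵇ ℝ) :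
    ‖G.field U - G.field V‖ ≤ ‖G.K‖ * ((1 + (‖U‖ + ‖V‖) / 2) * ‖U - V‖) := by
  rw [field, field, ← map_sub]
  refine (G.K.le_opNorm _).trans ?_
  gcongr
  have e : U + (1 / 2 : ℝ) • (G.W * U * U) - (V + (1 / 2 : ℝ) • (G.W * V * V))
      = (U - V) + (1 / 2 : ℝ) • (G.W * (U + V) * (U - V)) := G.val_injective fun x => by
    simp only [val_add, val_sub, val_smul, val_W_mul]
    ring
  rw [e]
  refine (norm_add_le _ _).trans ?_
  rw [norm_smul, Real.norm_of_nonneg (by norm_num)]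
  have h1 := G.norm_W_mul_le (U + V) (U - V)
  have h2 := mul_le_mul_of_nonneg_right (norm_add_le U V) (norm_nonneg (U - V))
  linarith

variable {G}

/-- Second-order Taylor expansion in time: data of size `A` evolve linearly up to an error
`A ^ 3 t ^ 2`, for times `t` below a multiple of `A⁻¹`. -/
theorem norm_solution_sub_le {U : ℝ → ℝ →ᵇ ℝ} (hU : ∀ t, HasDerivAt U (G.field (U t)) t)
    {A κ t : ℝ} (hA : 1 ≤ A) (hκ : ‖G.K‖ < κ) (h0 : ‖U 0‖ ≤ A) (ht : 0 ≤ t)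
    (htA : 8 * κ * A * t ≤ 1) :
    ‖U t - U 0 - t • G.field (U 0)‖ ≤ 12 * κ ^ 2 * A ^ 3 * t ^ 2 := by
  have hκ0 : 0 < κ := G.K.opNorm_nonneg.trans_lt hκ
  have hUc : ContinuousOn U (Icc 0 t) := fun s _ => (hU s).continuousAt.continuousWithinAt
  have hF : ∀ s, ‖U s‖ ≤ 2 * A → ‖G.field (U s)‖ ≤ 4 * κ * A ^ 2 := fun s hs => by
    refine (G.norm_field_le _).trans ?_
    have h1 : ‖U s‖ + ‖U s‖ ^ 2 / 2 ≤ 4 * A ^ 2 := by nlinarith [norm_nonneg (U s)]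
    calc _ ≤ κ * (4 * A ^ 2) := by gcongr
      _ = _ := by ring
  have hlin : ∀ s ∈ Icc 0 t, A + 8 * κ * A ^ 2 * s ≤ 2 * A := fun s hs => by
    have : 8 * κ * A * s ≤ 8 * κ * A * t := by gcongr; exact hs.2
    nlinarith
  have hb : ∀ s ∈ Icc 0 t, ‖U s‖ ≤ A + 8 * κ * A ^ 2 * s :=
    image_norm_le_of_norm_deriv_right_lt_deriv_boundary hUc
      (fun s _ => (hU s).hasDerivWithinAt) (by simpa using h0)
      (B' := fun _ => 8 * κ * A ^ 2)
      (fun s => by simpa using ((hasDerivAt_id s).const_mul (8 * κ * A ^ 2)).const_add A)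
      (fun s hs he => by
        refine (hF s (he ▸ hlin s (Ico_subset_Icc_self hs))).trans_lt ?_
        have : 0 < κ * A ^ 2 := by positivity
        linarith)
  have hb2 : ∀ s ∈ Icc 0 t, ‖U s‖ ≤ 2 * A := fun s hs => (hb s hs).trans (hlin s hs)
  have hd : ∀ s ∈ Icc 0 t, ‖U s - U 0‖ ≤ 4 * κ * A ^ 2 * (s - 0) :=
    norm_image_sub_le_of_norm_deriv_right_le_segment hUc (fun s _ => (hU s).hasDerivWithinAt)
      fun s hs => hF s (hb2 s (Ico_subset_Icc_self hs))
  have hR : ∀ s, HasDerivAt (fun s => U s - s • G.field (U 0)) (G.field (U s) - G.field (U 0)) s :=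
    fun s => ((hU s).sub ((hasDerivAt_id s).smul_const (G.field (U 0)))).congr_deriv (by simp)
  have := norm_image_sub_le_of_norm_deriv_right_le_segment (a := 0) (b := t)
    (C := 12 * κ ^ 2 * A ^ 3 * t)
    (fun s _ => (hR s).continuousAt.continuousWithinAt) (fun s _ => (hR s).hasDerivWithinAt)
    (fun s hs => by
      refine (G.norm_field_sub_le _ _).trans ?_
      have h1 := hb2 s (Ico_subset_Icc_self hs)
      have h2 := hd s (Ico_subset_Icc_self hs)
      have h3 : 1 + (‖U s‖ + ‖U 0‖) / 2 ≤ 3 * A := by linarith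
      calc _ ≤ κ * ((3 * A) * (4 * κ * A ^ 2 * (t - 0))) := by
            gcongr
            refine h2.trans ?_
            have := hs.2.le
            gcongr
        _ = _ := by ring) t ⟨ht, le_rfl⟩
  simp only [zero_smul, sub_zero] at this
  calc ‖U t - U 0 - t • G.field (U 0)‖ = ‖U t - t • G.field (U 0) - U 0‖ := by
        congr 1
        abel
    _ ≤ 12 * κ ^ 2 * A ^ 3 * t * t := this
    _ = _ := by ring

theorem osc_add (ξ η x : ℝ) : osc (ξ + η) x = osc ξ x * osc η x := by
  rw [osc, osc, osc, ← Complex.exp_add]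
  congr 1
  push_cast
  ring

theorem osc_neg_mul (ξ x : ℝ) : osc (-ξ) x * osc ξ x = 1 := by
  rw [← osc_add]
  simp [osc]

theorem periodic_osc_add {ξ η σ : ℝ} (hξ : Function.Periodic (osc ξ) σ)
    (hη : Function.Periodic (osc η) σ) : Function.Periodic (osc (ξ + η)) σ := fun x => by
  rw [osc_add, osc_add, hξ, hη]

theorem periodic_osc_neg {ξ σ : ℝ} (hξ : Function.Periodic (osc ξ) σ) :
    Function.Periodic (osc (-ξ)) σ := fun x => by
  have h1 := osc_neg_mul ξ (x + σ)
  rw [hξ x, ← osc_neg_mul ξ x] at h1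
  refine mul_right_cancel₀ ?_ h1
  rw [← norm_pos_iff, norm_osc]
  exact one_pos

theorem cos_eq_osc (η x : ℝ) : ((Real.cos (η * x) : ℝ) : ℂ) = (osc η x + osc (-η) x) / 2 := by
  rw [osc, osc, Complex.ofReal_cos, Complex.cos]
  push_cast
  ring_nf

theorem conj_osc (ξ x : ℝ) : (starRingEnd ℂ) (osc ξ x) = osc (-ξ) x := by
  rw [osc, osc, ← Complex.exp_conj]
  simp

/-- The multiplier of `K` is `-i ξ / (1 + ξ ^ 2)`. -/
theorem fourier_K {U : ℝ →ᵇ ℝ} (hU : G.IsPeriodic U) {ξ : ℝ}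
    (hξ : Function.Periodic (osc ξ) G.σ) :
    (1 + ξ ^ 2) * G.fourier ξ (G.K U) = -(Complex.I * ξ) * G.fourier ξ U := by
  have h1 := (G.isDeriv_K U).fourier_eq hU.K hξ
  have h2 := (G.isDeriv_J U).fourier_eq hU.J hξ
  rw [map_sub] at h1
  rw [map_neg] at h2
  linear_combination Complex.I * ξ * h1 - h2 + ξ ^ 2 * G.fourier ξ (G.K U) * Complex.I_sq

/-- Decay of the Fourier transform at high frequency. -/
theorem IsDeriv.norm_fourier_le {U V : ℝ →ᵇ ℝ} (h : G.IsDeriv U V) (hU : G.IsPeriodic U) {ξ : ℝ}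
    (hξ : Function.Periodic (osc ξ) G.σ) :
    |ξ| * ‖G.fourier ξ U‖ ≤ (∫ x, G.w x ∂G.μ) * ‖V‖ := by
  have h1 := G.norm_fourier_apply_le ξ V
  rw [h.fourier_eq hU hξ] at h1
  simpa using h1

/-- Modulating a function by `cos (N x)` and squaring leaves half of the square at low frequency;
the remainder sits at frequencies near `± 2 N`. -/
theorem fourier_sq_modulated {Q Qc : ℝ →ᵇ ℝ} {N : ℝ}
    (h : ∀ x, G.val Qc x = G.val Q x * Real.cos (N * x)) (ξ : ℝ) :
    G.fourier ξ (G.W * Qc * Qc) = G.fourier ξ (G.W * Q * Q) / 2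
      + (G.fourier (ξ + (N + N)) (G.W * Q * Q) + G.fourier (ξ + -(N + N)) (G.W * Q * Q)) / 4 := by
  have hi : ∀ η, Integrable (fun x => (G.val (G.W * Q * Q) x : ℂ) * osc η x) G.μ := fun η =>
    G.integrable_val_mul _ (continuous_osc η) fun x => (norm_osc η x).le
  have hs : Integrable (fun x => ((G.val (G.W * Q * Q) x : ℂ) * osc (ξ + (N + N)) x
      + (G.val (G.W * Q * Q) x : ℂ) * osc (ξ + -(N + N)) x) / 4) G.μ :=
    ((hi _).add (hi _)).div_const 4
  simp only [fourier_apply]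
  rw [← integral_add (hi _) (hi _), ← integral_div, ← integral_div,
    ← integral_add ((hi ξ).div_const 2) hs]
  congr 1
  ext x
  have e := osc_neg_mul N x
  rw [val_W_mul, val_W_mul, h]
  simp only [osc_add, neg_add, Complex.ofReal_mul, cos_eq_osc]
  linear_combination (G.val Q x : ℂ) ^ 2 * osc ξ x / 2 * e

set_option maxHeartbeats 1000000 in
/-- Data `φ + N ^ a ψ cos (N x)` drive an order-one frequency `ξ` to arbitrary height: the square of
the high-frequency part has a component of size `N ^ (2 a)` at frequency `ξ`, which acts for a time
of order `N ^ (- 2 a)`, while the error of the linearization in time is only `O (N ^ (- a))`. -/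
theorem eventually_inflation {Ξ : Set ℝ} {φ ψ : ℝ → ℝ} {a c : ℝ} (ha : 0 < a) (hc : 0 < c)
    (hφ : G.IsNice φ) (hψ : G.IsNice ψ)
    (hnice : ∀ (A : ℝ) (N : ℕ), G.IsNice fun x => φ x + A * (ψ x * Real.cos (N * x)))
    (hΞ : Ξ ⊆ Icc (1 / 2) (3 / 2)) (hosc : ∀ ξ ∈ Ξ, Function.Periodic (osc ξ) G.σ)
    (hoscN : ∀ N : ℕ, Function.Periodic (osc N) G.σ)
    (hlow : ∀ ξ ∈ Ξ, c ≤ ‖∫ x, ((ψ x ^ 2 : ℝ) : ℂ) * osc ξ x ∂G.μ‖) (R : ℝ) {δ : ℝ} (hδ : 0 < δ) :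
    ∀ᶠ N : ℕ in atTop, ∃ U : ℝ → ℝ →ᵇ ℝ,
      (∀ x, G.val (U 0) x = φ x + (N : ℝ) ^ a * (ψ x * Real.cos (N * x))) ∧
      (∀ t, HasDerivAt U (G.field (U t)) t) ∧ (∀ t, G.IsPeriodic (U t)) ∧
      (∀ n, G.SpaceSmooth n U) ∧
      ∃ t, 0 < t ∧ t < δ ∧ ∀ ξ ∈ Ξ, R ≤ ‖G.fourier ξ (U t) - G.fourier ξ (U 0)‖ := by
  obtain ⟨P, hP, -⟩ := hφ.exists_val_eq
  obtain ⟨Q, hQ, hQp⟩ := hψ.exists_val_eq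
  obtain ⟨-, Q', -, hQd⟩ := hψ.spaceSmooth hQ 1
  set S := G.W * Q * Q with hS
  have hSd := (hQd 0).mul (hQd 0)
  set S' := G.W * Q' 0 * Q + G.W * Q * Q' 0 with hS'
  have hSp : G.IsPeriodic S := hQp.W_mul hQp
  set m := ∫ x, G.w x ∂G.μ with hm
  have hm0 : 0 ≤ m := G.integral_w_nonneg
  set κ := ‖G.K‖ + 1 with hκ
  have hκ0 : 0 < κ := by positivity
  set B := ‖P‖ + ‖Q‖ + 1 with hB
  have hB1 : 1 ≤ B := by rw [hB]; linarith [norm_nonneg P, norm_nonneg Q]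
  -- at the time `T / A ^ 2` the square of the modulated bump contributes at least `T c / 32`, and
  -- all the errors together at most `D / A`
  set T := 32 * (|R| + 1) / c with hT
  have hT0 : 0 < T := by positivity
  set D := T * m * B ^ 2 + 12 * m * κ ^ 2 * B ^ 3 * T ^ 2 with hD
  have hAlim : Tendsto (fun N : ℕ => (N : ℝ) ^ a) atTop atTop :=
    (tendsto_rpow_atTop ha).comp tendsto_natCast_atTop_atTop
  filter_upwards [hAlim.eventually_ge_atTop 1, hAlim.eventually_ge_atTop D,
    hAlim.eventually_ge_atTop (8 * κ * B * T), hAlim.eventually_gt_atTop (T / δ),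
    tendsto_natCast_atTop_atTop.eventually_ge_atTop (4 * m * ‖S'‖ / c),
    eventually_ge_atTop 1] with N hA1 hAD hAT hAδ hNS hN1
  set A := (N : ℝ) ^ a with hA
  have hA0 : 0 < A := by linarith
  have hN1' : (1 : ℝ) ≤ N := by exact_mod_cast hN1
  obtain ⟨U, hU0, hU, hper, hsm⟩ := (hnice A N).exists_solution
  refine ⟨U, fun x => congrFun hU0 x, hU, hper, hsm, T / A ^ 2, by positivity, ?_, fun ξ hξ => ?_⟩
  · rw [div_lt_iff₀ (by positivity)]
    rw [div_lt_iff₀ hδ] at hAδ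
    nlinarith [mul_pos hA0 hδ]
  have hQcb : ∀ x, |ψ x * Real.cos (N * x)| ≤ ‖Q‖ * G.w x := fun x => by
    rw [abs_mul, ← hQ]
    refine (mul_le_of_le_one_right (abs_nonneg _) (Real.abs_cos_le_one _)).trans ?_
    exact G.abs_val_le Q x
  have hQcc : Continuous fun x => ψ x * Real.cos (N * x) := by
    have := hψ.contDiff.continuous
    fun_prop
  set Qc := G.lift _ hQcc _ hQcb with hQc
  have hQcn : ‖Qc‖ ≤ ‖Q‖ := G.norm_lift_le hQcc hQcb
  have hQcv : ∀ x, G.val Qc x = G.val Q x * Real.cos (N * x) := fun x => by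
    rw [hQc, val_lift, hQ]
  have hU0' : U 0 = P + A • Qc := G.val_injective fun x => by
    rw [hU0, val_add, val_smul, hP, hQcv, hQ]
  have hU0n : ‖U 0‖ ≤ B * A := by
    rw [hU0']
    refine (norm_add_le _ _).trans ?_
    rw [norm_smul, Real.norm_of_nonneg hA0.le, hB]
    nlinarith [norm_nonneg P]
  set q := U 0 + (1 / 2 : ℝ) • (G.W * U 0 * U 0) with hq
  have hqp : G.IsPeriodic q := (hper 0).add (((hper 0).W_mul (hper 0)).smul _)
  have hqe : q = (U 0 + (1 / 2 : ℝ) • (G.W * P * P) + A • (G.W * P * Qc))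
      + (A ^ 2 / 2) • (G.W * Qc * Qc) := G.val_injective fun x => by
    simp only [hq, hU0', val_add, val_smul, val_W_mul]
    ring
  have hPB : ‖P‖ ≤ B := by linarith [norm_nonneg Q]
  have hQB : ‖Q‖ ≤ B := by linarith [norm_nonneg P]
  -- everything in the nonlinearity but the square of the high-frequency part has size `O (A)`
  have hlower : ‖G.fourier ξ (U 0 + (1 / 2 : ℝ) • (G.W * P * P) + A • (G.W * P * Qc))‖
      ≤ m * (3 * B ^ 2 * A) := by
    refine (G.norm_fourier_apply_le ξ _).trans ?_
    gcongr
    refine (norm_add₃_le).trans ?_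
    rw [norm_smul, norm_smul, Real.norm_of_nonneg hA0.le, Real.norm_of_nonneg (by norm_num)]
    have h1 : ‖G.W * P * P‖ ≤ B * B :=
      (G.norm_W_mul_le P P).trans (by gcongr)
    have h2 : ‖G.W * P * Qc‖ ≤ B * B :=
      (G.norm_W_mul_le P Qc).trans (by gcongr; exact hQcn.trans hQB)
    have h3 : A * ‖G.W * P * Qc‖ ≤ A * (B * B) := by gcongr
    have h4 : B * A ≤ B * B * A := by
      have : B ≤ B * B := by nlinarith
      gcongr
    have h6 : 0 ≤ B * B := by positivity
    have h5 : B * B ≤ B * B * A := le_mul_of_one_le_right (by positivity) hA1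
    linarith
  have hhigh : ∀ η, Function.Periodic (osc η) G.σ → (N : ℝ) / 2 ≤ |η| →
      ‖G.fourier η S‖ ≤ c / 2 := fun η hη hηN => by
    have h1 := hSd.norm_fourier_le hSp hη
    rw [div_le_iff₀ hc] at hNS
    have h2 : (N : ℝ) / 2 * ‖G.fourier η S‖ ≤ m * ‖S'‖ :=
      (mul_le_mul_of_nonneg_right hηN (norm_nonneg _)).trans h1
    by_contra hcon
    push Not at hcon
    nlinarith
  have h2N : Function.Periodic (osc (N + N)) G.σ := periodic_osc_add (hoscN N) (hoscN N)
  obtain ⟨hξ1, hξ2⟩ := hΞ hξ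
  have hsq : c / 4 ≤ ‖G.fourier ξ (G.W * Qc * Qc)‖ := by
    rw [fourier_sq_modulated hQcv, ← hS]
    have h1 := hhigh _ (periodic_osc_add (hosc ξ hξ) h2N)
      (by rw [abs_of_nonneg (by linarith)]; linarith)
    have h2 := hhigh _ (periodic_osc_add (hosc ξ hξ) (periodic_osc_neg h2N))
      (by rw [abs_of_nonpos (by linarith)]; linarith)
    have h3 : c ≤ ‖G.fourier ξ S‖ := by
      refine (hlow ξ hξ).trans (le_of_eq ?_)
      rw [fourier_apply]
      congr 2
      ext x
      rw [hS, val_W_mul, hQ, sq]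
    have h4 := norm_sub_le_norm_add (G.fourier ξ S / 2)
      ((G.fourier (ξ + (N + N)) S + G.fourier (ξ + -(N + N)) S) / 4)
    have h5 := norm_add_le (G.fourier (ξ + (N + N)) S) (G.fourier (ξ + -(N + N)) S)
    simp only [norm_div, Complex.norm_ofNat] at h4 ⊢
    linarith
  have hFq : A ^ 2 * c / 8 - m * (3 * B ^ 2 * A) ≤ ‖G.fourier ξ q‖ := by
    rw [hqe, map_add, map_smul, add_comm]
    have h1 := norm_sub_le_norm_add ((A ^ 2 / 2) • G.fourier ξ (G.W * Qc * Qc))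
      (G.fourier ξ (U 0 + (1 / 2 : ℝ) • (G.W * P * P) + A • (G.W * P * Qc)))
    rw [norm_smul, Real.norm_of_nonneg (by positivity)] at h1
    have h2 : A ^ 2 / 2 * (c / 4) ≤ A ^ 2 / 2 * ‖G.fourier ξ (G.W * Qc * Qc)‖ := by gcongr
    linarith
  have hFK : ‖G.fourier ξ q‖ ≤ 4 * ‖G.fourier ξ (G.K q)‖ := by
    have h1 := congrArg norm (fourier_K hqp (hosc ξ hξ))
    have e : ((1 : ℂ) + (ξ : ℂ) ^ 2) = ((1 + ξ ^ 2 : ℝ) : ℂ) := by push_cast; rfl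
    rw [e, norm_mul, norm_mul, Complex.norm_real, Real.norm_of_nonneg (by positivity)] at h1
    simp only [norm_neg, Complex.norm_mul, Complex.norm_I, one_mul, Complex.norm_real,
      Real.norm_eq_abs] at h1
    rw [abs_of_pos (by linarith)] at h1
    have h2 := norm_nonneg (G.fourier ξ (G.K q))
    -- the multiplier has modulus `ξ / (1 + ξ ^ 2) ≥ 1 / 4` on `[1/2, 3/2]`
    have h3 : 1 + ξ ^ 2 ≤ 4 * ξ := by nlinarith
    have h4 : ξ * ‖G.fourier ξ q‖ ≤ ξ * (4 * ‖G.fourier ξ (G.K q)‖) := by nlinarith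
    exact le_of_mul_le_mul_left h4 (by linarith)
  set t := T / A ^ 2 with ht
  have htA : t * A ^ 2 = T := by rw [ht]; field_simp
  have ht0 : 0 < t := by positivity
  have hexp := norm_solution_sub_le hU (A := B * A) (κ := κ) (t := t)
    (one_le_mul_of_one_le_of_one_le hB1 hA1) (by rw [hκ]; linarith) hU0n ht0.le (by
      have : 8 * κ * (B * A) * t = 8 * κ * B * T / A := by rw [ht]; field_simp
      rw [this, div_le_one hA0]
      exact hAT)
  have hrem : ‖G.fourier ξ (U t - U 0 - t • G.field (U 0))‖
      ≤ m * (12 * κ ^ 2 * (B * A) ^ 3 * t ^ 2) :=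
    (G.norm_fourier_apply_le ξ _).trans (by gcongr)
  have hsplit : G.fourier ξ (U t) - G.fourier ξ (U 0)
      = t • G.fourier ξ (G.K q) + G.fourier ξ (U t - U 0 - t • G.field (U 0)) := by
    rw [map_sub, map_sub, map_smul, field, ← hq]
    ring
  have hfin := norm_sub_le_norm_add (t • G.fourier ξ (G.K q))
    (G.fourier ξ (U t - U 0 - t • G.field (U 0)))
  rw [← hsplit, norm_smul, Real.norm_of_nonneg ht0.le] at hfin
  have hK : t * ((A ^ 2 * c / 8 - m * (3 * B ^ 2 * A)) / 4) ≤ t * ‖G.fourier ξ (G.K q)‖ := by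
    gcongr
    linarith
  have htA' : t * A = T / A := by rw [ht]; field_simp
  have e1 : t * ((A ^ 2 * c / 8 - m * (3 * B ^ 2 * A)) / 4)
      = T * c / 32 - 3 / 4 * (T * m * B ^ 2 / A) := by
    linear_combination (c / 32) * htA - (3 / 4 * m * B ^ 2) * htA'
  have e2 : m * (12 * κ ^ 2 * (B * A) ^ 3 * t ^ 2) = 12 * m * κ ^ 2 * B ^ 3 * T ^ 2 / A := by
    rw [ht]; field_simp
  have e3 : T * c / 32 = |R| + 1 := by rw [hT]; field_simp
  have hDA : T * m * B ^ 2 / A + 12 * m * κ ^ 2 * B ^ 3 * T ^ 2 / A ≤ 1 := by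
    rw [← add_div, div_le_one hA0]
    exact hAD
  have h6 : 0 ≤ T * m * B ^ 2 / A := by positivity
  have := le_abs_self R
  linarith

/-! ### Fourier–Lebesgue norms on a frequency group -/

theorem continuous_fourier (U : ℝ →ᵇ ℝ) : Continuous fun ξ => G.fourier ξ U := by
  have hU := G.continuous_val U
  simp only [fourier_apply]
  refine continuous_of_dominated (bound := fun x => ‖U‖ * G.w x) (fun ξ => ?_) (fun ξ => ?_)
    (G.w_integrable.const_mul _) (Eventually.of_forall fun x => ?_)
  · have := continuous_osc ξ
    exact (by fun_prop : Continuous fun x => (G.val U x : ℂ) * osc ξ x).aestronglyMeasurable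
  · refine Eventually.of_forall fun x => ?_
    rw [norm_mul, Complex.norm_real, norm_osc, mul_one]
    exact G.abs_val_le U x
  · unfold osc
    fun_prop

/-- The Fourier transform of a smooth element decays faster than any power. -/
theorem exists_fourier_decay {U : ℝ → ℝ →ᵇ ℝ} (hU : ∀ n, G.SpaceSmooth n U) {t : ℝ}
    (hper : G.IsPeriodic (U t)) (m : ℕ) :
    ∃ C, 0 ≤ C ∧ ∀ ξ, Function.Periodic (osc ξ) G.σ →
      (1 + ξ ^ 2) ^ m * ‖G.fourier ξ (U t)‖ ≤ C := by
  induction m generalizing U with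
  | zero =>
    refine ⟨_, mul_nonneg G.integral_w_nonneg (norm_nonneg (U t)), fun ξ _ => ?_⟩
    simpa using G.norm_fourier_apply_le ξ (U t)
  | succ m ih =>
    obtain ⟨V, hV, hd⟩ := exists_isDeriv_of_forall_spaceSmooth hU
    obtain ⟨V₂, hV₂, hd₂⟩ := exists_isDeriv_of_forall_spaceSmooth hV
    have hVp := (hd t).isPeriodic hper
    obtain ⟨C, hC0, hC⟩ := ih (U := fun t => U t - V₂ t) (fun n => (hU n).sub (hV₂ n))
      (hper.sub ((hd₂ t).isPeriodic hVp))
    refine ⟨C, hC0, fun ξ hξ => ?_⟩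
    have e : G.fourier ξ (U t - V₂ t) = ((1 + ξ ^ 2 : ℝ) : ℂ) * G.fourier ξ (U t) := by
      rw [map_sub, (hd₂ t).fourier_eq hVp hξ, (hd t).fourier_eq hper hξ]
      push_cast
      linear_combination -(ξ ^ 2 * G.fourier ξ (U t)) * Complex.I_sq
    have h := hC ξ hξ
    simp only [e, norm_mul, Complex.norm_real] at h
    rw [Real.norm_of_nonneg (by positivity)] at h
    rw [pow_succ, mul_assoc]
    exact h

theorem fourier_modulated {Q Qc : ℝ →ᵇ ℝ} {N : ℝ}
    (h : ∀ x, G.val Qc x = G.val Q x * Real.cos (N * x)) (ξ : ℝ) :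
    G.fourier ξ Qc = (G.fourier (ξ + N) Q + G.fourier (ξ - N) Q) / 2 := by
  have hi : ∀ η, Integrable (fun x => (G.val Q x : ℂ) * osc η x) G.μ := fun η =>
    G.integrable_val_mul _ (continuous_osc η) fun x => (norm_osc η x).le
  simp only [fourier_apply]
  rw [← integral_add (hi _) (hi _), ← integral_div]
  congr 1
  ext x
  rw [h]
  simp only [sub_eq_add_neg, osc_add, Complex.ofReal_mul, cos_eq_osc]
  ring

end Geometry

theorem bracketPow_pos (s ξ : ℝ) : 0 < bracketPow s ξ := Real.rpow_pos_of_pos (by positivity) _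

theorem continuous_bracketPow (s : ℝ) : Continuous (bracketPow s) := by
  unfold bracketPow
  exact (by fun_prop : Continuous fun ξ : ℝ => 1 + ξ ^ 2).rpow_const
    fun ξ => Or.inl (by positivity)

/-- Peetre's inequality for a negative exponent. -/
theorem bracketPow_le_peetre {s : ℝ} (hs : s ≤ 0) (ξ h : ℝ) :
    bracketPow s ξ ≤ 2 ^ (-s / 2) * bracketPow s h * bracketPow (-s) (ξ - h) := by
  have h1 : 1 + h ^ 2 ≤ 2 * (1 + ξ ^ 2) * (1 + (ξ - h) ^ 2) := by
    nlinarith [sq_nonneg (2 * ξ - h), sq_nonneg (ξ * (ξ - h))]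
  have h2 : (1 + h ^ 2) ^ (-s / 2) ≤ (2 * (1 + ξ ^ 2) * (1 + (ξ - h) ^ 2)) ^ (-s / 2) :=
    Real.rpow_le_rpow (by positivity) h1 (by linarith)
  rw [Real.mul_rpow (by positivity) (by positivity), Real.mul_rpow (by positivity) (by positivity)]
    at h2
  have e : ∀ y : ℝ, bracketPow s y * (1 + y ^ 2) ^ (-s / 2) = 1 := fun y => by
    rw [bracketPow, ← Real.rpow_add (by positivity)]
    ring_nf
    simp
  have p1 := bracketPow_pos s ξ
  have p2 := bracketPow_pos s h
  calc bracketPow s ξ = bracketPow s ξ * bracketPow s h * (1 + h ^ 2) ^ (-s / 2) := by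
        rw [mul_assoc, e, mul_one]
    _ ≤ bracketPow s ξ * bracketPow s h *
        (2 ^ (-s / 2) * (1 + ξ ^ 2) ^ (-s / 2) * (1 + (ξ - h) ^ 2) ^ (-s / 2)) := by gcongr
    _ = (bracketPow s ξ * (1 + ξ ^ 2) ^ (-s / 2)) *
        (2 ^ (-s / 2) * bracketPow s h * bracketPow (-s) (ξ - h)) := by
        rw [bracketPow, bracketPow, bracketPow]; ring
    _ = _ := by rw [e, one_mul]

theorem bracketPow_le_rpow {s : ℝ} (hs : s ≤ 0) {N : ℝ} (hN : 0 < N) :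
    bracketPow s N ≤ N ^ s := by
  have h : (N ^ 2) ^ (s / 2) = N ^ s := by
    rw [← Real.rpow_natCast, ← Real.rpow_mul hN.le]
    congr 1
    push_cast
    ring
  rw [← h]
  exact Real.rpow_le_rpow_of_nonpos (by positivity) (by linarith) (by linarith)

/-- The norm `‖⟨ξ⟩ ^ s f‖_{L^p(ν)}` of a function `f` on a group of frequencies, each of which has
a real value `ι ξ`. -/
noncomputable def freqNorm {A : Type*} [MeasurableSpace A] (ν : Measure A) (ι : A → ℝ) (s : ℝ)
    (p : ℝ≥0∞) (f : A → ℂ) : ℝ≥0∞ :=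
  eLpNorm (fun ξ => (bracketPow s (ι ξ) : ℂ) * f ξ) p ν

theorem memLp_of_integrable_of_le_one {A : Type*} [MeasurableSpace A] {ν : Measure A} {p : ℝ≥0∞}
    (hp : 1 ≤ p) (hp' : p ≠ ⊤) {g : A → ℝ} (hg : Integrable g ν)
    (h0 : ∀ ξ, 0 ≤ g ξ) (h1 : ∀ ξ, g ξ ≤ 1) : MemLp g p ν := by
  rw [← integrable_norm_rpow_iff hg.aestronglyMeasurable (zero_lt_one.trans_le hp).ne' hp']
  have hp1 : 1 ≤ p.toReal := by
    have := ENNReal.toReal_mono hp' hp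
    simpa using this
  refine hg.mono' (hg.aestronglyMeasurable.norm.aemeasurable.pow_const _).aestronglyMeasurable
    (Eventually.of_forall fun ξ => ?_)
  rw [Real.norm_of_nonneg (h0 ξ), Real.norm_of_nonneg (Real.rpow_nonneg (h0 ξ) _)]
  simpa using Real.rpow_le_rpow_of_exponent_ge' (h0 ξ) (h1 ξ) zero_le_one hp1

section Frequency

open _root_.BBM.Geometry

variable {A : Type*} [AddCommGroup A] [MeasurableSpace A] {ν : Measure A} {ι : A →+ ℝ} {s : ℝ}
  {p : ℝ≥0∞}

theorem aestronglyMeasurable_weighted (hι : Measurable ι) (s : ℝ) {f : A → ℂ}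
    (hf : AEStronglyMeasurable f ν) :
    AEStronglyMeasurable (fun ξ => (bracketPow s (ι ξ) : ℂ) * f ξ) ν :=
  (Complex.measurable_ofReal.comp
    ((continuous_bracketPow s).measurable.comp hι)).aestronglyMeasurable.mul hf

theorem freqNorm_add_le (hι : Measurable ι) (hp : 1 ≤ p) {f g : A → ℂ}
    (hf : AEStronglyMeasurable f ν) (hg : AEStronglyMeasurable g ν) :
    freqNorm ν ι s p (fun ξ => f ξ + g ξ) ≤ freqNorm ν ι s p f + freqNorm ν ι s p g := by
  unfold freqNorm
  simp only [mul_add]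
  exact eLpNorm_add_le (aestronglyMeasurable_weighted hι s hf)
    (aestronglyMeasurable_weighted hι s hg) hp

theorem freqNorm_const_mul (c : ℂ) (f : A → ℂ) :
    freqNorm ν ι s p (fun ξ => c * f ξ) = ‖c‖ₑ * freqNorm ν ι s p f := by
  unfold freqNorm
  simp only [mul_left_comm _ c]
  exact eLpNorm_const_smul c _ p ν

theorem freqNorm_sub_comm (f g : A → ℂ) :
    freqNorm ν ι s p (fun ξ => f ξ - g ξ) = freqNorm ν ι s p (fun ξ => g ξ - f ξ) := by
  have h := freqNorm_const_mul (ν := ν) (ι := ι) (s := s) (p := p) (-1) (fun ξ => f ξ - g ξ)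
  simpa using h.symm

/-- Translating a function to frequency `h` costs at most a factor `⟨h⟩ ^ s`. -/
theorem freqNorm_translate_le [MeasurableAdd A] [ν.IsAddRightInvariant] (hι : Measurable ι)
    (hs : s ≤ 0) {f : A → ℂ} (hf : AEStronglyMeasurable f ν) (h : A) :
    freqNorm ν ι s p (fun ξ => f (ξ - h))
      ≤ ENNReal.ofReal (2 ^ (-s / 2) * bracketPow s (ι h)) * freqNorm ν ι (-s) p f := by
  have hmp : MeasurePreserving (fun ξ : A => ξ - h) ν ν := by
    simpa only [sub_eq_add_neg] using measurePreserving_add_right ν (-h)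
  have e : freqNorm ν ι (-s) p f
      = eLpNorm (fun ξ => (bracketPow (-s) (ι (ξ - h)) : ℂ) * f (ξ - h)) p ν :=
    (eLpNorm_comp_measurePreserving (aestronglyMeasurable_weighted hι (-s) hf) hmp).symm
  rw [e, freqNorm]
  refine eLpNorm_le_mul_eLpNorm_of_ae_le_mul (Eventually.of_forall fun ξ => ?_) p
  rw [norm_mul, norm_mul, Complex.norm_real, Complex.norm_real,
    Real.norm_of_nonneg (bracketPow_pos _ _).le, Real.norm_of_nonneg (bracketPow_pos _ _).le,
    map_sub, ← mul_assoc]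
  gcongr
  exact bracketPow_le_peetre hs _ _

theorem le_freqNorm_of_le (hp : 1 ≤ p) (hp' : p ≠ ⊤) (hs : s ≤ 0) {Ξ : Set A}
    (hΞ : MeasurableSet Ξ) (hν : 1 ≤ ν Ξ) (hι : ∀ ξ ∈ Ξ, ι ξ ∈ Icc (1 / 2 : ℝ) (3 / 2))
    {f : A → ℂ} {R : ℝ} (hR : 0 ≤ R) (hf : ∀ ξ ∈ Ξ, R ≤ ‖f ξ‖) :
    ENNReal.ofReal (4 ^ (s / 2) * R) ≤ freqNorm ν ι s p f := by
  have hp0 : p ≠ 0 := (zero_lt_one.trans_le hp).ne'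
  have h1 : ∀ ξ, ‖Ξ.indicator (fun _ => (4 : ℝ) ^ (s / 2) * R) ξ‖
      ≤ ‖(bracketPow s (ι ξ) : ℂ) * f ξ‖ := by
    intro ξ
    by_cases hξ : ξ ∈ Ξ
    · rw [indicator_of_mem hξ, Real.norm_of_nonneg (by positivity), norm_mul, Complex.norm_real,
        Real.norm_of_nonneg (bracketPow_pos _ _).le]
      have h2 : (4 : ℝ) ^ (s / 2) ≤ bracketPow s (ι ξ) :=
        Real.rpow_le_rpow_of_nonpos (by positivity)
          (by obtain ⟨h, h'⟩ := hι ξ hξ; nlinarith) (by linarith)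
      have := (bracketPow_pos s (ι ξ)).le
      have := hf ξ hξ
      gcongr
    · rw [indicator_of_notMem hξ, norm_zero]
      exact norm_nonneg _
  refine le_trans ?_ (eLpNorm_mono h1)
  rw [eLpNorm_indicator_const hΞ hp0 hp', Real.enorm_of_nonneg (by positivity)]
  refine le_mul_of_one_le_right' ?_
  exact ENNReal.one_le_rpow hν (one_div_pos.2 (ENNReal.toReal_pos hp0 hp'))

/-- The Fourier transform of a smooth element has finite Fourier–Lebesgue norms of all orders. -/
theorem freqNorm_fourier_lt_top {G : Geometry} {U : ℝ → ℝ →ᵇ ℝ}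
    (hν : MemLp (fun ξ => (1 + ι ξ ^ 2)⁻¹) p ν) (hosc : ∀ ξ, Function.Periodic (osc (ι ξ)) G.σ)
    (hU : ∀ n, G.SpaceSmooth n U) {t : ℝ} (hper : G.IsPeriodic (U t)) (r : ℝ) :
    freqNorm ν ι r p (fun ξ => G.fourier (ι ξ) (U t)) < ⊤ := by
  obtain ⟨m, hm⟩ := exists_nat_ge (r / 2)
  obtain ⟨C, hC0, hC⟩ := Geometry.exists_fourier_decay hU hper (m + 1)
  refine (eLpNorm_le_mul_eLpNorm_of_ae_le_mul (c := C) (g := fun ξ => (1 + ι ξ ^ 2)⁻¹)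
    (Eventually.of_forall fun ξ => ?_) p).trans_lt (ENNReal.mul_lt_top ENNReal.ofReal_lt_top hν.2)
  have h1 : 0 < 1 + ι ξ ^ 2 := by positivity
  have h2 : bracketPow r (ι ξ) ≤ (1 + ι ξ ^ 2) ^ m := by
    rw [bracketPow, ← Real.rpow_natCast (1 + ι ξ ^ 2) m]
    have h3 : 1 ≤ 1 + ι ξ ^ 2 := by nlinarith [sq_nonneg (ι ξ)]
    exact Real.rpow_le_rpow_of_exponent_le h3 hm
  rw [norm_mul, Complex.norm_real, Real.norm_of_nonneg (bracketPow_pos _ _).le, norm_inv,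
    Real.norm_of_nonneg h1.le, ← div_eq_mul_inv, le_div_iff₀ h1]
  refine le_trans ?_ (hC (ι ξ) (hosc ξ))
  rw [pow_succ (1 + ι ξ ^ 2) m]
  calc _ ≤ (1 + ι ξ ^ 2) ^ m * ‖G.fourier (ι ξ) (U t)‖ * (1 + ι ξ ^ 2) := by gcongr
    _ = _ := by ring

set_option maxHeartbeats 1000000 in
/-- Norm inflation at general data, for both geometries at once. The data `φ` approximate the target
`b` on the Fourier side, `l` is the normalization of the Fourier transform, and the modulated bump
`ψ` triggers the inflation on the set `Ξ` of low frequencies. Since the norm at time `0` stays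
bounded, it is enough that the difference of the Fourier transforms at times `t` and `0` is
large. -/
theorem exists_inflation [MeasurableAdd A] [ν.IsAddRightInvariant] {G : Geometry} {φ ψ : ℝ → ℝ}
    {Ξ : Set A} {b : A → ℂ} {l c ε : ℝ} (hp : 1 ≤ p) (hp' : p ≠ ⊤) (hs : s < 0)
    (hι : Measurable ι) (hν : MemLp (fun ξ => (1 + ι ξ ^ 2)⁻¹) p ν)
    (hosc : ∀ ξ, Function.Periodic (osc (ι ξ)) G.σ) (hN : ∀ N : ℕ, ∃ h, ι h = N)
    (hφ : G.IsNice φ) (hψ : G.IsNice ψ)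
    (hnice : ∀ (a : ℝ) (N : ℕ), G.IsNice fun x => φ x + a * (ψ x * Real.cos (N * x)))
    (hΞ : MeasurableSet Ξ) (hνΞ : 1 ≤ ν Ξ) (hιΞ : ∀ ξ ∈ Ξ, ι ξ ∈ Icc (1 / 2 : ℝ) (3 / 2))
    (hc : 0 < c) (hlow : ∀ ξ ∈ Ξ, c ≤ ‖∫ x, ((ψ x ^ 2 : ℝ) : ℂ) * osc (ι ξ) x ∂G.μ‖)
    (hl : 0 < l) (hε : 0 < ε) (hb : AEStronglyMeasurable b ν) (hbfin : freqNorm ν ι s p b < ⊤)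
    (happrox : freqNorm ν ι s p (fun ξ => l * (∫ x, (φ x : ℂ) * osc (ι ξ) x ∂G.μ) - b ξ)
      < ENNReal.ofReal (ε / 2)) :
    ∃ U : ℝ → ℝ →ᵇ ℝ, (∀ t, HasDerivAt U (G.field (U t)) t) ∧ (∀ t, G.IsPeriodic (U t)) ∧
      (∀ n, G.SpaceSmooth n U) ∧ ∃ t, 0 < t ∧ t < ε ∧
      freqNorm ν ι s p (fun ξ => l * G.fourier (ι ξ) (U 0) - b ξ) < ENNReal.ofReal ε ∧
      ENNReal.ofReal ε⁻¹ < freqNorm ν ι s p (fun ξ => l * G.fourier (ι ξ) (U t)) ∧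
      freqNorm ν ι s p (fun ξ => l * G.fourier (ι ξ) (U t)) < ⊤ := by
  obtain ⟨P, hP, -⟩ := hφ.exists_val_eq
  obtain ⟨Q, hQ, hQp⟩ := hψ.exists_val_eq
  have hmeas : ∀ V : ℝ →ᵇ ℝ, Measurable fun ξ => G.fourier (ι ξ) V := fun V =>
    (Geometry.continuous_fourier V).measurable.comp hι
  have hoscN : ∀ N : ℕ, Function.Periodic (osc N) G.σ := fun N => by
    obtain ⟨h, hh⟩ := hN N
    rw [← hh]
    exact hosc h
  set b' := (freqNorm ν ι s p b).toReal with hb'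
  set R := (ε⁻¹ + ε + b' + 1) / (4 ^ (s / 2) * l) with hR
  have hb0 : 0 ≤ b' := ENNReal.toReal_nonneg
  have hR0 : 0 ≤ R := by positivity
  have hinfl := Geometry.eventually_inflation (Ξ := ι '' Ξ) (a := -s / 2) (by linarith) hc hφ hψ
    hnice (by rintro _ ⟨ξ, hξ, rfl⟩; exact hιΞ ξ hξ) (by rintro _ ⟨ξ, -, rfl⟩; exact hosc ξ) hoscN
    (by rintro _ ⟨ξ, hξ, rfl⟩; exact hlow ξ hξ) R hε
  set D := freqNorm ν ι (-s) p (fun ξ => G.fourier (ι ξ) Q) with hD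
  have hDfin : D < ⊤ := freqNorm_fourier_lt_top (t := 0) hν hosc (hψ.spaceSmooth hQ) hQp (-s)
  set κ := ENNReal.ofReal (l * 2 ^ (-s / 2)) * D with hκ
  have hκfin : κ ≠ ⊤ := (ENNReal.mul_lt_top ENNReal.ofReal_lt_top hDfin).ne
  have hsmall : ∀ᶠ N : ℕ in atTop, ENNReal.ofReal ((N : ℝ) ^ (s / 2)) * κ
      < ENNReal.ofReal (ε / 2) := by
    have h1 : Tendsto (fun N : ℕ => (N : ℝ) ^ (s / 2)) atTop (𝓝 0) := by
      have := (tendsto_rpow_neg_atTop (y := -s / 2) (by linarith)).comp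
        (tendsto_natCast_atTop_atTop (R := ℝ))
      refine this.congr fun N => ?_
      simp only [Function.comp_apply]
      congr 1
      ring
    have h2 := ENNReal.Tendsto.mul_const (ENNReal.tendsto_ofReal h1) (Or.inr hκfin)
    rw [ENNReal.ofReal_zero, zero_mul] at h2
    exact h2.eventually_lt_const (ENNReal.ofReal_pos.2 (by positivity))
  obtain ⟨N, ⟨U, hU0, hU, hper, hsm, t, ht0, htε, hdiff⟩, hNs, hN1⟩ :=
    (hinfl.and (hsmall.and (eventually_ge_atTop 1))).exists
  have hNpos : (0 : ℝ) < N := by exact_mod_cast hN1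
  set a := (N : ℝ) ^ (-s / 2) with ha
  have ha0 : 0 ≤ a := by positivity
  have hQcb : ∀ x, |ψ x * Real.cos (N * x)| ≤ ‖Q‖ * G.w x := fun x => by
    rw [abs_mul, ← hQ]
    refine (mul_le_of_le_one_right (abs_nonneg _) (Real.abs_cos_le_one _)).trans ?_
    exact G.abs_val_le Q x
  have hQcc : Continuous fun x => ψ x * Real.cos (N * x) := by
    have := hψ.contDiff.continuous
    fun_prop
  set Qc := G.lift _ hQcc _ hQcb with hQc
  have hQcv : ∀ x, G.val Qc x = G.val Q x * Real.cos (N * x) := fun x => by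
    rw [hQc, Geometry.val_lift, hQ]
  have hU0' : U 0 = P + a • Qc := G.val_injective fun x => by
    rw [hU0, Geometry.val_add, Geometry.val_smul, hP, hQcv, hQ]
  have hPf : ∀ ξ, ∫ x, (φ x : ℂ) * osc (ι ξ) x ∂G.μ = G.fourier (ι ξ) P := fun ξ => by
    rw [Geometry.fourier_apply, hP]
  obtain ⟨h, hh⟩ := hN N
  have hmod : freqNorm ν ι s p (fun ξ => G.fourier (ι ξ) Qc)
      ≤ ENNReal.ofReal (2 ^ (-s / 2) * bracketPow s N) * D := by
    have e : (fun ξ => G.fourier (ι ξ) Qc) = fun ξ => (2 : ℂ)⁻¹ *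
        (G.fourier (ι (ξ - -h)) Q + G.fourier (ι (ξ - h)) Q) := funext fun ξ => by
      rw [Geometry.fourier_modulated hQcv, sub_neg_eq_add, map_add, map_sub, hh]
      ring
    have h1 := freqNorm_translate_le (p := p) hι hs.le (hmeas Q).aestronglyMeasurable (ν := ν) (-h)
    have h2 := freqNorm_translate_le (p := p) hι hs.le (hmeas Q).aestronglyMeasurable (ν := ν) h
    have hneg : bracketPow s (ι (-h)) = bracketPow s N := by
      rw [map_neg, hh, bracketPow, neg_sq, bracketPow]
    rw [hneg] at h1
    rw [hh] at h2
    rw [e, freqNorm_const_mul]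
    have hm1 : Measurable fun ξ => G.fourier (ι (ξ - -h)) Q := by
      simp only [map_sub]
      exact (Geometry.continuous_fourier Q).measurable.comp (hι.sub_const _)
    have hm2 : Measurable fun ξ => G.fourier (ι (ξ - h)) Q := by
      simp only [map_sub]
      exact (Geometry.continuous_fourier Q).measurable.comp (hι.sub_const _)
    have h3 := freqNorm_add_le (s := s) hι hp hm1.aestronglyMeasurable (ν := ν)
      hm2.aestronglyMeasurable
    have h4 : ‖(2 : ℂ)⁻¹‖ₑ = 2⁻¹ := by
      rw [enorm_inv two_ne_zero]
      congr 1
      rw [← ofReal_norm]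
      simp
    rw [h4]
    calc _ ≤ 2⁻¹ * (ENNReal.ofReal (2 ^ (-s / 2) * bracketPow s N) * D
          + ENNReal.ofReal (2 ^ (-s / 2) * bracketPow s N) * D) := by
            gcongr
            exact h3.trans (add_le_add h1 h2)
      _ = _ := by
        rw [← two_mul, ← mul_assoc, ENNReal.inv_mul_cancel (by simp) (by simp), one_mul]
  have hhighnorm : freqNorm ν ι s p (fun ξ => ((l * a : ℝ) : ℂ) * G.fourier (ι ξ) Qc)
      < ENNReal.ofReal (ε / 2) := by
    rw [freqNorm_const_mul]
    refine lt_of_le_of_lt ?_ hNs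
    have e1 : ‖((l * a : ℝ) : ℂ)‖ₑ = ENNReal.ofReal (l * a) := by
      rw [← ofReal_norm, Complex.norm_real, Real.norm_of_nonneg (by positivity)]
    rw [e1, hκ, ← mul_assoc, ← ENNReal.ofReal_mul (by positivity)]
    refine (mul_le_mul_right hmod _).trans ?_
    rw [← mul_assoc, ← ENNReal.ofReal_mul (by positivity)]
    gcongr ENNReal.ofReal ?_ * D
    have h1 := bracketPow_le_rpow hs.le hNpos
    have h2 : a * (N : ℝ) ^ s = (N : ℝ) ^ (s / 2) := by
      rw [ha, ← Real.rpow_add hNpos]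
      congr 1
      ring
    calc l * a * (2 ^ (-s / 2) * bracketPow s N) ≤ l * a * (2 ^ (-s / 2) * (N : ℝ) ^ s) := by
          gcongr
      _ = (N : ℝ) ^ (s / 2) * (l * 2 ^ (-s / 2)) := by rw [← h2]; ring
  have hinit : freqNorm ν ι s p (fun ξ => l * G.fourier (ι ξ) (U 0) - b ξ) < ENNReal.ofReal ε := by
    have e : (fun ξ => l * G.fourier (ι ξ) (U 0) - b ξ)
        = fun ξ => (l * (∫ x, (φ x : ℂ) * osc (ι ξ) x ∂G.μ) - b ξ)
          + ((l * a : ℝ) : ℂ) * G.fourier (ι ξ) Qc := funext fun ξ => by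
      rw [hPf, hU0', map_add, map_smul, Complex.real_smul]
      push_cast
      ring
    rw [e]
    simp only [hPf] at happrox ⊢
    refine (freqNorm_add_le hι hp (((hmeas P).const_mul _).aestronglyMeasurable.sub hb)
      ((hmeas Qc).const_mul _).aestronglyMeasurable).trans_lt ?_
    have h2 : ENNReal.ofReal ε = ENNReal.ofReal (ε / 2) + ENNReal.ofReal (ε / 2) := by
      rw [← ENNReal.ofReal_add (by positivity) (by positivity), add_halves]
    rw [h2]
    exact ENNReal.add_lt_add happrox hhighnorm
  have hmt : ∀ t, AEStronglyMeasurable (fun ξ => (l : ℂ) * G.fourier (ι ξ) (U t)) ν := fun t =>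
    ((hmeas _).const_mul _).aestronglyMeasurable
  refine ⟨U, hU, hper, hsm, t, ht0, htε, hinit, ?_, ?_⟩
  · have hlarge := le_freqNorm_of_le (ν := ν) (p := p) (s := s) (R := l * R) hp hp' hs.le hΞ hνΞ hιΞ
      (f := fun ξ => l * G.fourier (ι ξ) (U t) - l * G.fourier (ι ξ) (U 0)) (by positivity)
      (fun ξ hξ => by
        rw [← mul_sub, norm_mul, Complex.norm_real, Real.norm_of_nonneg hl.le]
        gcongr
        exact hdiff _ ⟨ξ, hξ, rfl⟩)
    have e1 : (4 : ℝ) ^ (s / 2) * (l * R) = ε⁻¹ + ε + b' + 1 := by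
      rw [hR]
      field_simp
    rw [e1] at hlarge
    have e2 : (fun ξ => l * G.fourier (ι ξ) (U t) - l * G.fourier (ι ξ) (U 0))
        = fun ξ => l * G.fourier (ι ξ) (U t)
          + ((b ξ - l * G.fourier (ι ξ) (U 0)) + (-1) * b ξ) := funext fun ξ => by ring
    have h1 : freqNorm ν ι s p (fun ξ => l * G.fourier (ι ξ) (U t) - l * G.fourier (ι ξ) (U 0))
        ≤ freqNorm ν ι s p (fun ξ => l * G.fourier (ι ξ) (U t))
          + (freqNorm ν ι s p (fun ξ => l * G.fourier (ι ξ) (U 0) - b ξ)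
            + freqNorm ν ι s p b) := by
      rw [e2]
      refine (freqNorm_add_le (g := fun ξ => (b ξ - l * G.fourier (ι ξ) (U 0)) + (-1) * b ξ)
        hι hp (hmt t) ((hb.sub (hmt 0)).add (hb.const_mul (-1)))).trans ?_
      gcongr
      have h3 := freqNorm_add_le (s := s) hι hp
        (f := fun ξ => b ξ - l * G.fourier (ι ξ) (U 0)) (g := fun ξ => (-1) * b ξ)
        (hb.sub (hmt 0)) (hb.const_mul (-1))
      rw [freqNorm_const_mul, freqNorm_sub_comm] at h3
      simpa using h3
    by_contra hcon
    push Not at hcon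
    have h2 : freqNorm ν ι s p b = ENNReal.ofReal b' := (ENNReal.ofReal_toReal hbfin.ne).symm
    have h3 := hlarge.trans (h1.trans (add_le_add hcon (add_le_add hinit.le h2.le)))
    rw [← ENNReal.ofReal_add hε.le hb0, ← ENNReal.ofReal_add (by positivity) (by positivity),
      ENNReal.ofReal_le_ofReal_iff (by positivity)] at h3
    linarith
  · rw [freqNorm_const_mul]
    exact ENNReal.mul_lt_top enorm_lt_top (freqNorm_fourier_lt_top hν hosc hsm (hper t) s)

end Frequency

open _root_.BBM.Geometry

/-! ### The torus -/

theorem periodic_osc_int (n : ℤ) : Function.Periodic (osc n) (2 * Real.pi) := fun x => by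
  have h := Complex.exp_int_mul_two_pi_mul_I (-n)
  have e : -(Complex.I * ((n : ℝ) : ℂ) * ((x + 2 * Real.pi : ℝ) : ℂ))
      = -(Complex.I * ((n : ℝ) : ℂ) * x) + (-n : ℤ) * (2 * Real.pi * Complex.I) := by
    push_cast; ring
  rw [osc, e, Complex.exp_add, h, mul_one, osc]

/-- The torus: no weight, period `2π`. -/
noncomputable def torus : Geometry where
  w := fun _ => 1
  σ := 2 * Real.pi
  μ := volume.restrict (Ioc 0 (2 * Real.pi))
  c := 1
  w_cont := continuous_const
  w_pos := fun _ => one_pos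
  w_le_one := fun _ => le_rfl
  w_shift := fun x z => by
    have : 1 ≤ Real.exp (|z| / 2) := Real.one_le_exp (by positivity)
    linarith
  w_periodic := fun _ => rfl
  w_integrable := integrable_const 1
  integral_deriv_eq_zero := fun F F' C h hc hp _ _ => by
    rw [← intervalIntegral.integral_of_le (by positivity),
      intervalIntegral.integral_eq_sub_of_hasDerivAt (fun x _ => h x) (hc.intervalIntegrable _ _)]
    have := hp 0
    rw [zero_add] at this
    rw [this, sub_self]
  unit_integral_le := fun g C hc h0 hp _ x => by
    rw [← intervalIntegral.integral_of_le (by positivity)]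
    have h1 := hp.intervalIntegral_add_eq x 0
    rw [zero_add] at h1
    rw [← h1]
    exact intervalIntegral.integral_mono_interval le_rfl (by linarith)
      (by linarith [Real.pi_gt_three]) (Eventually.of_forall h0) (hc.intervalIntegrable _ _)

theorem torus_integral (f : ℝ → ℂ) :
    ∫ x, f x ∂torus.μ = ∫ x in (0 : ℝ)..(2 * Real.pi), f x :=
  (intervalIntegral.integral_of_le (by positivity)).symm

theorem isNice_torus {f : ℝ → ℝ} (hf : ContDiff ℝ ∞ f) (hp : Function.Periodic f (2 * Real.pi)) :
    torus.IsNice f := by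
  refine ⟨hf, hp, fun k => ?_⟩
  have hk : Function.Periodic (iteratedDeriv k f) (2 * Real.pi) := fun x => by
    have h := congrFun (iteratedDeriv_comp_add_const k f (2 * Real.pi)) x
    rw [show (fun z => f (z + 2 * Real.pi)) = f from funext hp] at h
    exact h.symm
  obtain ⟨C, hC⟩ := (hk.isBounded_of_continuous (by positivity)
    (hf.continuous_iteratedDeriv k (by exact_mod_cast le_top))).exists_norm_le
  exact ⟨C, fun x => by simpa [torus] using hC _ ⟨x, rfl⟩⟩

theorem integral_osc {n : ℤ} (hn : n ≠ 0) : ∫ x in (0 : ℝ)..(2 * Real.pi), osc n x = 0 := by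
  have h := intervalIntegral.integral_eq_sub_of_hasDerivAt (a := 0) (b := 2 * Real.pi)
    (fun x _ => hasDerivAt_osc n x)
    ((continuous_const.mul (continuous_osc n)).intervalIntegrable _ _)
  have hp := periodic_osc_int n 0
  rw [zero_add] at hp
  rw [hp, sub_self, intervalIntegral.integral_const_mul] at h
  refine (mul_eq_zero.1 h).resolve_left ?_
  simpa using hn

theorem integral_osc_int (n : ℤ) :
    ∫ x in (0 : ℝ)..(2 * Real.pi), osc n x = if n = 0 then (2 * Real.pi : ℂ) else 0 := by
  split_ifs with h
  · simp [h, osc]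
  · exact integral_osc h

/-- The trigonometric polynomial with the coefficients `a k`, `|k| ≤ M`. -/
noncomputable def trigPoly (a : ℤ → ℂ) (M : ℕ) (x : ℝ) : ℝ :=
  (∑ k ∈ Finset.Icc (-(M : ℤ)) M, a k * osc (-k) x).re

theorem contDiff_osc (ξ : ℝ) : ContDiff ℝ ∞ (osc ξ) := by
  have hc : ContDiff ℝ ∞ fun x : ℝ => (x : ℂ) := Complex.ofRealCLM.contDiff
  unfold osc
  fun_prop

theorem isNice_trigPoly (a : ℤ → ℂ) (M : ℕ) : torus.IsNice (trigPoly a M) := by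
  refine isNice_torus ?_ fun x => ?_
  · exact Complex.reCLM.contDiff.comp
      (ContDiff.sum fun k _ => contDiff_const.mul (contDiff_osc _))
  · have h : ∀ k : ℤ, osc (-k) (x + 2 * Real.pi) = osc (-k) x := fun k => by
      have := periodic_osc_int (-k) x
      push_cast at this
      exact this
    simp only [trigPoly, h]

theorem ofReal_trigPoly {a : ℤ → ℂ} (ha : ∀ k, a (-k) = (starRingEnd ℂ) (a k)) (M : ℕ) (x : ℝ) :
    (trigPoly a M x : ℂ) = ∑ k ∈ Finset.Icc (-(M : ℤ)) M, a k * osc (-k) x := by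
  rw [trigPoly]
  refine Complex.conj_eq_iff_re.1 ?_
  rw [map_sum]
  refine Finset.sum_equiv (Equiv.neg ℤ) (fun k => ?_) fun k _ => ?_
  · simp only [Finset.mem_Icc, Equiv.neg_apply]
    omega
  · rw [map_mul, conj_osc, Equiv.neg_apply, ha]
    simp

theorem integral_trigPoly_mul_osc {a : ℤ → ℂ} (ha : ∀ k, a (-k) = (starRingEnd ℂ) (a k)) (M : ℕ)
    (n : ℤ) : ∫ x in (0 : ℝ)..(2 * Real.pi), (trigPoly a M x : ℂ) * osc n x
      = if n ∈ Finset.Icc (-(M : ℤ)) M then 2 * Real.pi * a n else 0 := by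
  simp only [ofReal_trigPoly ha, Finset.sum_mul]
  have e : ∀ (k : ℤ) (x : ℝ), a k * osc (-k) x * osc n x = a k * osc ((n - k : ℤ) : ℝ) x :=
    fun k x => by
      rw [mul_assoc, ← osc_add]
      congr 2
      push_cast
      ring
  simp only [e]
  have hi : ∀ k ∈ Finset.Icc (-(M : ℤ)) M, IntervalIntegrable
      (fun x => a k * osc ((n - k : ℤ) : ℝ) x) volume 0 (2 * Real.pi) := fun k _ =>
    (continuous_const.mul (continuous_osc _)).intervalIntegrable _ _
  rw [intervalIntegral.integral_finsetSum hi]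
  simp only [intervalIntegral.integral_const_mul, integral_osc_int, sub_eq_zero, mul_ite, mul_zero,
    Finset.sum_ite_eq]
  split_ifs <;> ring

/-- The Fourier coefficients of a real distribution are conjugate symmetric. -/
theorem torusCoeff_neg {v : TorusDistribution} (hv : IsRealTorus v) (n : ℤ) :
    torusCoeff v (-n) = (starRingEnd ℂ) (torusCoeff v n) := by
  have hval : ∀ (k : ℤ) (x : ℝ), (torusExp k : ℝ → ℂ) x = osc k x := fun k x => by
    simp [torusExp, osc]
  have e : ∀ x, osc ((-n : ℤ) : ℝ) x = (starRingEnd ℂ) (osc n x) := fun x => by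
    rw [conj_osc]; push_cast; rfl
  have h1 := hv (torusExp n + torusExp (-n)) fun x => by
    change ((torusExp n : ℝ → ℂ) x + (torusExp (-n) : ℝ → ℂ) x).im = 0
    rw [hval, hval, e]
    simp
  have h2 := hv (Complex.I • (torusExp n - torusExp (-n))) fun x => by
    change (Complex.I * ((torusExp n : ℝ → ℂ) x - (torusExp (-n) : ℝ → ℂ) x)).im = 0
    rw [hval, hval, e]
    simp
  rw [map_add, Complex.add_im] at h1
  rw [map_smul, map_sub, smul_eq_mul, Complex.I_mul_im, Complex.sub_re] at h2
  rw [torusCoeff, torusCoeff, map_mul]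
  congr 1
  · simp [Complex.conj_ofNat]
  · apply Complex.ext
    · rw [Complex.conj_re]; linarith
    · rw [Complex.conj_im]; linarith

theorem torusCoeff_torusDistribution {f : ℝ → ℝ} (hf : Continuous f) (n : ℤ) :
    torusCoeff (torusDistribution f hf) n
      = ((2 * Real.pi)⁻¹ : ℝ) * ∫ x in (0 : ℝ)..(2 * Real.pi), (f x : ℂ) * osc n x := by
  rw [torusCoeff]
  push_cast
  rfl

theorem isSmoothSolutionTorus_val {U : ℝ → ℝ →ᵇ ℝ} (hU : ∀ t, HasDerivAt U (torus.field (U t)) t)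
    (hper : ∀ t, torus.IsPeriodic (U t)) (hsm : ∀ n, torus.SpaceSmooth n U) :
    IsSmoothSolutionTorus fun t => torus.val (U t) where
  smooth := (contDiff_val hsm).contDiffOn
  periodic := fun t _ => torus.isPeriodic_iff.1 (hper t)
  equation := satisfiesBBM hU hsm

theorem torus_low_frequency :
    ∫ x, (((1 + Real.cos x) ^ 2 : ℝ) : ℂ) * osc 1 x ∂torus.μ = 2 * Real.pi := by
  have e : ∀ x : ℝ, (((1 + Real.cos x) ^ 2 : ℝ) : ℂ) * osc 1 x
      = osc (0 : ℤ) x + ((3 / 2 : ℂ) * osc (1 : ℤ) x + (osc (2 : ℤ) x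
        + ((1 / 4 : ℂ) * osc (3 : ℤ) x + (1 / 4 : ℂ) * osc (-1 : ℤ) x))) := fun x => by
    have h1 := cos_eq_osc 1 x
    rw [one_mul] at h1
    have h2 : osc (2 : ℤ) x = osc 1 x * osc 1 x := by rw [← osc_add]; norm_num
    have h3 : osc (3 : ℤ) x = osc 1 x * osc 1 x * osc 1 x := by
      rw [← osc_add, ← osc_add]; norm_num
    have h4 := osc_neg_mul 1 x
    rw [h2, h3]
    push_cast [h1]
    have h5 : osc 0 x = 1 := by simp [osc]
    rw [h5]
    linear_combination (1 + osc 1 x / 2 + osc (-1) x / 4) * h4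
  have hi : ∀ n : ℤ, IntervalIntegrable (osc n) volume 0 (2 * Real.pi) := fun n =>
    (continuous_osc n).intervalIntegrable _ _
  have hi' : ∀ (n : ℤ) (c : ℂ),
      IntervalIntegrable (fun x => c * osc n x) volume 0 (2 * Real.pi) := fun n c =>
    (hi n).const_mul c
  rw [torus_integral]
  simp only [e]
  rw [intervalIntegral.integral_add (hi 0)
      ((hi' 1 _).add ((hi 2).add ((hi' 3 _).add (hi' (-1) _)))),
    intervalIntegral.integral_add (hi' 1 _) ((hi 2).add ((hi' 3 _).add (hi' (-1) _))),
    intervalIntegral.integral_add (hi 2) ((hi' 3 _).add (hi' (-1) _)),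
    intervalIntegral.integral_add (hi' 3 _) (hi' (-1) _)]
  simp only [intervalIntegral.integral_const_mul, integral_osc_int]
  norm_num

theorem exists_torus_approx {p : ℝ≥0∞} (hp' : p ≠ ⊤) {s : ℝ} {a : ℤ → ℂ}
    (ha : freqNorm Measure.count (Int.castAddHom ℝ) s p a < ⊤) {η : ℝ} (hη : 0 < η) :
    ∃ M : ℕ, freqNorm Measure.count (Int.castAddHom ℝ) s p
      (fun n => (if n ∈ Finset.Icc (-(M : ℤ)) M then a n else 0) - a n) < ENNReal.ofReal η := by
  have hm : MemLp (fun n : ℤ => (bracketPow s (Int.castAddHom ℝ n) : ℂ) * a n) p Measure.count :=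
    ⟨(measurable_of_countable _).aestronglyMeasurable, ha⟩
  obtain ⟨S, -, hS, hlt⟩ := hm.exists_eLpNorm_indicator_compl_lt hp'
    (ENNReal.ofReal_pos.2 hη).ne'
  have hfin : S.Finite := Measure.count_apply_lt_top.1 hS
  obtain ⟨M, hM⟩ : ∃ M : ℕ, ∀ n ∈ S, n ∈ Finset.Icc (-(M : ℤ)) M := by
    obtain ⟨M, hM⟩ := (hfin.image Int.natAbs).bddAbove
    refine ⟨M, fun n hn => ?_⟩
    have := hM ⟨n, hn, rfl⟩
    rw [Finset.mem_Icc]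
    omega
  refine ⟨M, lt_of_le_of_lt (eLpNorm_mono fun n => ?_) hlt⟩
  by_cases hn : n ∈ S
  · simp only [if_pos (hM n hn), sub_self, mul_zero, norm_zero]
    exact norm_nonneg _
  · rw [indicator_of_mem (by simpa using hn)]
    dsimp only
    split_ifs
    · rw [sub_self, mul_zero, norm_zero]
      exact norm_nonneg _
    · simp

/-- Norm inflation on the torus. -/
theorem torus_inflation {p : ℝ≥0∞} (hp : 1 ≤ p) (hp' : p ≠ ⊤) {s : ℝ} (hs : s < 0)
    (u₀ : TorusDistribution) (hreal : IsRealTorus u₀) (hfin : normFLTorus s p u₀ < ⊤) {ε : ℝ}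
    (hε : 0 < ε) :
    ∃ (u : ℝ → ℝ → ℝ) (hu : IsSmoothSolutionTorus u) (t : ℝ) (ht : 0 < t), t < ε ∧
      normFLTorus s p (torusDistribution (u 0) (hu.continuous le_rfl) - u₀) < ENNReal.ofReal ε ∧
      ENNReal.ofReal ε⁻¹ < normFLTorus s p (torusDistribution (u t) (hu.continuous ht.le)) ∧
      normFLTorus s p (torusDistribution (u t) (hu.continuous ht.le)) < ⊤ := by
  have hsym := torusCoeff_neg hreal
  obtain ⟨M, hM⟩ := exists_torus_approx hp' (a := torusCoeff u₀) hfin (half_pos hε)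
  have hψ : ∀ (φ : ℝ → ℝ), torus.IsNice φ → ∀ (a : ℝ) (N : ℕ),
      torus.IsNice fun x => φ x + a * ((1 + Real.cos x) * Real.cos (N * x)) := by
    intro φ hφ a N
    refine isNice_torus ?_ fun x => ?_
    · have := hφ.contDiff
      have hc := Real.contDiff_cos (n := ∞)
      fun_prop
    · have h1 : Real.cos (N * (x + 2 * Real.pi)) = Real.cos (N * x) := by
        rw [mul_add]
        exact Real.cos_add_nat_mul_two_pi _ _
      rw [h1, Real.cos_add_two_pi, show φ (x + 2 * Real.pi) = φ x from hφ.periodic x]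
  have hsumm : Integrable (fun n : ℤ => (1 + (Int.castAddHom ℝ n) ^ 2)⁻¹) Measure.count := by
    rw [integrable_count_iff]
    have h1 : Summable fun n : ℤ => ((n : ℝ) ^ 2)⁻¹ := by
      simpa using (Real.summable_one_div_int_pow (p := 2)).2 one_lt_two
    refine Summable.norm (h1.of_norm_bounded_eventually ?_)
    have h0 : ∀ᶠ n : ℤ in cofinite, n ≠ 0 := by
      simpa using (Set.finite_singleton (0 : ℤ)).eventually_cofinite_notMem
    filter_upwards [h0] with n hn
    have h2 : (n : ℝ) ≠ 0 := by exact_mod_cast hn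
    have h3 : 0 < (n : ℝ) ^ 2 := by positivity
    rw [Int.coe_castAddHom, Real.norm_of_nonneg (by positivity)]
    gcongr
    linarith
  have hν := memLp_of_integrable_of_le_one hp hp' hsumm (fun n => by positivity)
    (fun n => inv_le_one_of_one_le₀ (by nlinarith [sq_nonneg (Int.castAddHom ℝ n)]))
  have hcoeff : ∀ (u : ℝ →ᵇ ℝ) (hu : Continuous (torus.val u)) (n : ℤ),
      torusCoeff (torusDistribution (torus.val u) hu) n
        = ((2 * Real.pi)⁻¹ : ℝ) * torus.fourier (Int.castAddHom ℝ n) u := fun u hu n => by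
    rw [torusCoeff_torusDistribution, Geometry.fourier_apply, torus_integral]
    rfl
  have hψ0 : torus.IsNice fun x => 1 + Real.cos x := by
    have hc := Real.contDiff_cos (n := ∞)
    exact isNice_torus (by fun_prop) fun x => by rw [Real.cos_add_two_pi]
  obtain ⟨U, hU, hper, hsm, t, ht, htε, h1, h2, h3⟩ := exists_inflation (G := torus)
    (ν := (Measure.count : Measure ℤ)) (ι := Int.castAddHom ℝ) (Ξ := {1}) (c := 1)
    (l := (2 * Real.pi)⁻¹) (b := torusCoeff u₀) (φ := trigPoly (torusCoeff u₀) M)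
    (ψ := fun x => 1 + Real.cos x) hp hp' hs (measurable_of_countable _) hν periodic_osc_int
    (fun N => ⟨N, by simp⟩) (isNice_trigPoly _ _) hψ0 (hψ _ (isNice_trigPoly _ _))
    (measurableSet_singleton _) (by simp) (fun ξ hξ => by
      rw [mem_singleton_iff.1 hξ]
      norm_num) one_pos (fun ξ hξ => by
      rw [mem_singleton_iff.1 hξ, show Int.castAddHom ℝ 1 = 1 by simp, torus_low_frequency,
        norm_mul, Complex.norm_ofNat, Complex.norm_real, Real.norm_of_nonneg (by positivity)]
      linarith [Real.pi_gt_three]) (by positivity) hε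
    (measurable_of_countable _).aestronglyMeasurable hfin (by
      refine lt_of_eq_of_lt ?_ hM
      congr 1
      ext n
      rw [torus_integral, Int.coe_castAddHom, integral_trigPoly_mul_osc hsym]
      congr 1
      split_ifs
      · push_cast
        have : (Real.pi : ℂ) ≠ 0 := by exact_mod_cast Real.pi_ne_zero
        field_simp
      · rw [mul_zero])
  have hu := isSmoothSolutionTorus_val hU hper hsm
  have hnorm : ∀ (τ : ℝ) (hτ : 0 ≤ τ),
      normFLTorus s p (torusDistribution (torus.val (U τ)) (hu.continuous hτ))
        = freqNorm Measure.count (Int.castAddHom ℝ) s p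
          (fun n => ((2 * Real.pi)⁻¹ : ℝ) * torus.fourier (Int.castAddHom ℝ n) (U τ)) :=
    fun τ hτ => by
      unfold normFLTorus freqNorm
      simp only [hcoeff]
      rfl
  refine ⟨fun t => torus.val (U t), hu, t, ht, htε, ?_, ?_, ?_⟩
  · refine lt_of_eq_of_lt ?_ h1
    unfold normFLTorus freqNorm
    congr 1
    ext n
    dsimp only
    rw [← hcoeff (U 0) (hu.continuous le_rfl)]
    simp only [torusCoeff, Submodule.coe_sub, LinearMap.sub_apply, mul_sub]
    rfl
  · rw [hnorm t ht.le]; exact h2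
  · rw [hnorm t ht.le]; exact h3

/-! ### Smooth solutions on the line -/

/-- The line: the weight `(1 + x²)⁻¹`, and the trivial period `0`. -/
noncomputable def line : Geometry where
  w := fun x => (1 + x ^ 2)⁻¹
  σ := 0
  μ := volume
  c := 18
  w_cont := by
    have h : ∀ x : ℝ, 1 + x ^ 2 ≠ 0 := fun x => by positivity
    fun_prop (disch := simp [h])
  w_pos := fun x => by positivity
  w_le_one := fun x => inv_le_one_of_one_le₀ (by nlinarith [sq_nonneg x])
  w_shift := fun x z => by
    have h1 : 1 + x ^ 2 ≤ 2 * (1 + z ^ 2) * (1 + (x + z) ^ 2) := by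
      nlinarith [sq_nonneg (x + 2 * z), sq_nonneg (z * (x + z))]
    have h2 := Real.quadratic_le_exp_of_nonneg (x := |z| / 2) (by positivity)
    have h3 : 1 + z ^ 2 ≤ 9 * Real.exp (|z| / 2) := by
      rw [← sq_abs]
      nlinarith [abs_nonneg z, sq_nonneg (|z|)]
    rw [← div_eq_mul_inv, le_div_iff₀ (by positivity), ← div_eq_inv_mul,
      div_le_iff₀ (by positivity)]
    refine h1.trans ?_
    have : 0 ≤ 1 + (x + z) ^ 2 := by positivity
    nlinarith
  w_periodic := fun _ => by simp
  w_integrable := integrable_inv_one_add_sq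
  integral_deriv_eq_zero := fun F F' C h hc _ hF hF' => by
    have hFc : Continuous F := continuous_iff_continuousAt.2 fun x => (h x).continuousAt
    refine integral_eq_zero_of_hasDerivAt_of_integrable h ?_ ?_
    · exact (integrable_inv_one_add_sq.const_mul C).mono' hc.aestronglyMeasurable
        (Eventually.of_forall hF')
    · exact (integrable_inv_one_add_sq.const_mul C).mono' hFc.aestronglyMeasurable
        (Eventually.of_forall hF)
  unit_integral_le := fun g C hc h0 _ hg x => by
    rw [intervalIntegral.integral_of_le (by linarith)]
    refine setIntegral_le_integral ?_ (Eventually.of_forall h0)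
    refine (integrable_inv_one_add_sq.const_mul C).mono' hc.aestronglyMeasurable
      (Eventually.of_forall fun y => ?_)
    rw [Real.norm_of_nonneg (h0 y)]
    exact hg y

theorem line_w (x : ℝ) : line.w x = (1 + x ^ 2)⁻¹ := rfl

theorem line_μ : line.μ = volume := rfl

theorem line_σ : line.σ = 0 := rfl

theorem periodic_zero {E : Type*} (f : ℝ → E) : Function.Periodic f line.σ := fun x => by
  rw [line_σ, add_zero]

theorem isNice_line (f : 𝓢(ℝ, ℝ)) : line.IsNice f := by
  refine ⟨f.smooth _, periodic_zero _, fun k => ?_⟩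
  obtain ⟨C, -, hC⟩ := f.decay 0 k
  obtain ⟨D, -, hD⟩ := f.decay 2 k
  refine ⟨C + D, fun x => ?_⟩
  have h1 := hC x
  have h2 := hD x
  simp only [norm_iteratedFDeriv_eq_norm_iteratedDeriv, Real.norm_eq_abs, sq_abs, pow_zero,
    one_mul] at h1 h2
  rw [line_w, ← div_eq_mul_inv, le_div_iff₀ (by positivity)]
  linarith

theorem memLp_line_w : MemLp line.w 2 volume :=
  memLp_of_integrable_of_le_one one_le_two ENNReal.ofNat_ne_top integrable_inv_one_add_sq
    (fun x => (line.w_pos x).le) line.w_le_one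

theorem eLpNorm_line_val_le (U : ℝ →ᵇ ℝ) :
    eLpNorm (line.val U) 2 volume ≤ ENNReal.ofReal ‖U‖ * eLpNorm line.w 2 volume :=
  eLpNorm_le_mul_eLpNorm_of_ae_le_mul (Eventually.of_forall fun x => by
    rw [Real.norm_eq_abs, Real.norm_of_nonneg (line.w_pos x).le]
    exact line.abs_val_le U x) 2

theorem memLp_line_val (U : ℝ →ᵇ ℝ) : MemLp (line.val U) 2 volume :=
  ⟨(line.continuous_val U).aestronglyMeasurable, (eLpNorm_line_val_le U).trans_lt
    (ENNReal.mul_lt_top ENNReal.ofReal_lt_top memLp_line_w.2)⟩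

theorem isSmoothSolutionLine_val {U : ℝ → ℝ →ᵇ ℝ} (hU : ∀ t, HasDerivAt U (line.field (U t)) t)
    (hsm : ∀ n, line.SpaceSmooth n U) : IsSmoothSolutionLine fun t => line.val (U t) where
  smooth := (contDiff_val hsm).contDiffOn
  equation := satisfiesBBM hU hsm
  memLp := fun k t _ => by
    obtain ⟨V, -, hV⟩ := exists_iteratedDeriv_eq hsm k
    rw [hV]
    exact memLp_line_val _
  continuous_in_time := fun k t _ => by
    obtain ⟨V, hVs, hV⟩ := exists_iteratedDeriv_eq hsm k
    simp only [hV, ← Geometry.val_sub]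
    have hc : Continuous V := (hVs 0).contDiff.continuous
    have h1 : Tendsto (fun τ => ENNReal.ofReal ‖V τ - V t‖ * eLpNorm line.w 2 volume)
        (𝓝[Ici 0] t) (𝓝 0) := by
      have h2 : Tendsto (fun τ => ‖V τ - V t‖) (𝓝[Ici 0] t) (𝓝 0) := by
        have h3 := ((hc.sub continuous_const).norm (f := fun τ => V τ - V t)).tendsto t
        rw [sub_self, norm_zero] at h3
        exact h3.mono_left nhdsWithin_le_nhds
      have h4 := ENNReal.Tendsto.mul_const (ENNReal.tendsto_ofReal h2)
        (Or.inr memLp_line_w.2.ne)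
      rwa [ENNReal.ofReal_zero, zero_mul] at h4
    exact tendsto_of_tendsto_of_tendsto_of_le_of_le tendsto_const_nhds h1 (fun _ => zero_le)
      fun τ => eLpNorm_line_val_le (V τ - V t)

/-! ### Fourier transforms of tempered distributions that are functions -/

theorem locallyIntegrable_of_forall_schwartz {F : ℝ → ℂ}
    (h : ∀ φ : 𝓢(ℝ, ℂ), Integrable (fun x => F x * φ x)) : LocallyIntegrable F := by
  intro x
  let χ : ContDiffBump x := ⟨1, 2, one_pos, one_lt_two⟩
  have hs : HasCompactSupport fun y => (χ y : ℂ) :=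
    χ.hasCompactSupport.comp_left Complex.ofReal_zero
  have hd : ContDiff ℝ ∞ fun y => (χ y : ℂ) := Complex.ofRealCLM.contDiff.comp χ.contDiff
  refine ⟨Metric.closedBall x 1, Metric.closedBall_mem_nhds x one_pos, ?_⟩
  refine ((h (hs.toSchwartzMap hd)).integrableOn (s := Metric.closedBall x 1)).congr_fun
    (fun y hy => ?_) Metric.isClosed_closedBall.measurableSet
  change F y * (χ y : ℂ) = F y
  rw [χ.one_of_mem_closedBall hy, Complex.ofReal_one, mul_one]

theorem ae_of_ae_comp_mul {a : ℝ} (ha : a ≠ 0) {P : ℝ → Prop} (h : ∀ᵐ x, P (a * x)) :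
    ∀ᵐ x, P x := by
  have hq : Measure.QuasiMeasurePreserving (fun x : ℝ => a⁻¹ * x) volume volume := by
    refine ⟨measurable_const_mul _, ?_⟩
    rw [Real.map_volume_mul_left (inv_ne_zero ha)]
    exact Measure.smul_absolutelyContinuous
  filter_upwards [hq.ae h] with x hx
  rwa [mul_inv_cancel_left₀ ha] at hx

theorem HasFourierTransform.ae_eq {v : 𝓢'(ℝ, ℂ)} {f g : ℝ → ℂ} (hf : HasFourierTransform v f)
    (hg : HasFourierTransform v g) : f =ᵐ[volume] g := by
  refine ae_of_ae_comp_mul Real.two_pi_pos.ne' ?_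
  refine ae_eq_of_integral_contDiff_smul_eq
    (locallyIntegrable_of_forall_schwartz fun φ => (hf.2 φ).1)
    (locallyIntegrable_of_forall_schwartz fun φ => (hg.2 φ).1) fun χ hχ hs => ?_
  have hs' : HasCompactSupport fun y => (χ y : ℂ) := hs.comp_left Complex.ofReal_zero
  have hd : ContDiff ℝ ∞ fun y => (χ y : ℂ) := Complex.ofRealCLM.contDiff.comp hχ
  have h1 : ∫ ξ, f (2 * Real.pi * ξ) * (χ ξ : ℂ) = ∫ ξ, g (2 * Real.pi * ξ) * (χ ξ : ℂ) :=
    (hf.2 (hs'.toSchwartzMap hd)).2.symm.trans (hg.2 (hs'.toSchwartzMap hd)).2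
  simp only [Complex.real_smul, mul_comm _ (f _), mul_comm _ (g _)]
  exact h1

theorem normFLLine_eq {v : 𝓢'(ℝ, ℂ)} {f : ℝ → ℂ} (hf : HasFourierTransform v f) (s : ℝ)
    (p : ℝ≥0∞) : normFLLine s p v = freqNorm volume (AddMonoidHom.id ℝ) s p f := by
  refine le_antisymm (iInf₂_le f hf) (le_iInf₂ fun g hg => le_of_eq ?_)
  refine eLpNorm_congr_ae ?_
  filter_upwards [hf.ae_eq hg] with ξ hξ
  rw [hξ]
  rfl

theorem HasFourierTransform.sub {v v' : 𝓢'(ℝ, ℂ)} {f f' : ℝ → ℂ} (hf : HasFourierTransform v f)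
    (hf' : HasFourierTransform v' f') : HasFourierTransform (v - v') fun ξ => f ξ - f' ξ := by
  refine ⟨hf.1.sub hf'.1, fun φ => ?_⟩
  have h1 := hf.2 φ
  have h2 := hf'.2 φ
  simp only [sub_mul]
  refine ⟨h1.1.sub h2.1, ?_⟩
  rw [integral_sub h1.1 h2.1, ← h1.2, ← h2.2]
  rfl

theorem fourier_eq_integral_osc (f : ℝ → ℂ) (ξ : ℝ) :
    𝓕 f ξ = ∫ x, f x * osc (2 * Real.pi * ξ) x := by
  rw [Real.fourier_real_eq_integral_exp_smul]
  congr 1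
  ext x
  rw [smul_eq_mul, mul_comm, osc]
  congr 2
  push_cast
  ring

theorem integrable_line_val (U : ℝ →ᵇ ℝ) : Integrable fun x => (line.val U x : ℂ) := by
  have h : Integrable (fun x => (line.val U x : ℂ) * 1) volume :=
    line.integrable_val_mul U (k := fun _ => 1) continuous_const fun _ => by simp
  simpa using h

theorem hasFourierTransform_line (U : ℝ →ᵇ ℝ) (hU : MemLp (line.val U) 2 volume) :
    HasFourierTransform (lineDistribution (line.val U) hU) fun ξ => line.fourier ξ U := by
  have hc : Continuous fun ξ => line.fourier ξ U := continuous_fourier U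
  have hF : ∀ ξ, 𝓕 (fun x => (line.val U x : ℂ)) ξ = line.fourier (2 * Real.pi * ξ) U := fun ξ => by
    rw [fourier_eq_integral_osc, Geometry.fourier_apply, line_μ]
  refine ⟨hc.aestronglyMeasurable, fun φ => ⟨?_, ?_⟩⟩
  · refine φ.integrable.bdd_mul (c := (∫ x, line.w x ∂line.μ) * ‖U‖)
      (hc.comp (continuous_const.mul continuous_id)).aestronglyMeasurable
      (Eventually.of_forall fun ξ => ?_)
    exact line.norm_fourier_apply_le _ U
  · rw [TemperedDistribution.fourier_apply, lineDistribution, Lp.toTemperedDistribution_apply]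
    have h1 : ∫ x, (𝓕 φ) x • ((hU.ofReal (K := ℂ)).toLp : ℝ → ℂ) x
        = ∫ x, (line.val U x : ℂ) * 𝓕 (φ : ℝ → ℂ) x := by
      refine integral_congr_ae ?_
      filter_upwards [(hU.ofReal (K := ℂ)).coeFn_toLp] with x hx
      rw [hx, smul_eq_mul, mul_comm]
      rfl
    rw [h1]
    have h2 := VectorFourier.integral_fourierIntegral_smul_eq_flip (L := innerₗ ℝ)
      Real.continuous_fourierChar continuous_inner
      (integrable_line_val U) (φ.integrable (μ := volume))
    simp only [smul_eq_mul, flip_innerₗ] at h2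
    refine h2.symm.trans (integral_congr_ae (Eventually.of_forall fun ξ => ?_))
    dsimp only
    rw [← hF]
    rfl

/-- The complex conjugate of a Schwartz function. -/
noncomputable def conjSchwartz (φ : 𝓢(ℝ, ℂ)) : 𝓢(ℝ, ℂ) :=
  φ.postcompCLM (Complex.conjCLE : ℂ →L[ℝ] ℂ)

theorem conjSchwartz_apply (φ : 𝓢(ℝ, ℂ)) (x : ℝ) : conjSchwartz φ x = (starRingEnd ℂ) (φ x) := rfl

theorem IsRealLine.apply_conj {v : 𝓢'(ℝ, ℂ)} (hv : IsRealLine v) (φ : 𝓢(ℝ, ℂ)) :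
    v (conjSchwartz φ) = (starRingEnd ℂ) (v φ) := by
  have h1 := hv (φ + conjSchwartz φ) fun x => by
    rw [add_apply, conjSchwartz_apply]; simp
  have h2 := hv (Complex.I • (φ - conjSchwartz φ)) fun x => by
    rw [smul_apply, sub_apply, conjSchwartz_apply]; simp
  rw [map_add, Complex.add_im] at h1
  rw [map_smul, map_sub, smul_eq_mul, Complex.I_mul_im, Complex.sub_re] at h2
  apply Complex.ext
  · rw [Complex.conj_re]; linarith
  · rw [Complex.conj_im]; linarith

/-- The reflected complex conjugate of a Schwartz function. -/
noncomputable def reflSchwartz (φ : 𝓢(ℝ, ℂ)) : 𝓢(ℝ, ℂ) :=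
  SchwartzMap.compCLMOfContinuousLinearEquiv ℂ (ContinuousLinearEquiv.neg ℝ) (conjSchwartz φ)

theorem reflSchwartz_apply (φ : 𝓢(ℝ, ℂ)) (x : ℝ) :
    reflSchwartz φ x = (starRingEnd ℂ) (φ (-x)) := rfl

theorem fourier_reflSchwartz (φ : 𝓢(ℝ, ℂ)) : 𝓕 (reflSchwartz φ) = conjSchwartz (𝓕 φ) := by
  ext ξ
  rw [conjSchwartz_apply, SchwartzMap.fourier_coe, SchwartzMap.fourier_coe,
    fourier_eq_integral_osc, fourier_eq_integral_osc, ← integral_conj, ← integral_neg_eq_self]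
  congr 1
  ext x
  rw [reflSchwartz_apply, neg_neg, map_mul, conj_osc]
  congr 1
  simp [osc]

/-- The Fourier transform of a real distribution is conjugate symmetric. -/
theorem HasFourierTransform.refl {v : 𝓢'(ℝ, ℂ)} {f : ℝ → ℂ} (hv : IsRealLine v)
    (hf : HasFourierTransform v f) :
    HasFourierTransform v fun ξ => (starRingEnd ℂ) (f (-ξ)) := by
  refine ⟨?_, fun φ => ?_⟩
  · exact Complex.continuous_conj.comp_aestronglyMeasurable
      (hf.1.comp_measurePreserving (Measure.measurePreserving_neg volume))
  have h := hf.2 (reflSchwartz φ)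
  have e : ∀ ξ : ℝ, (starRingEnd ℂ) (f (-(2 * Real.pi * ξ))) * φ ξ
      = (starRingEnd ℂ) (f (2 * Real.pi * -ξ) * reflSchwartz φ (-ξ)) := fun ξ => by
    rw [reflSchwartz_apply, neg_neg, map_mul, Complex.conj_conj, mul_neg]
  simp only [e]
  constructor
  · exact (Complex.conjCLE : ℂ →L[ℝ] ℂ).integrable_comp h.1.comp_neg
  · rw [integral_conj, integral_neg_eq_self (fun ξ => f (2 * Real.pi * ξ) * reflSchwartz φ ξ),
      ← h.2, TemperedDistribution.fourier_apply, TemperedDistribution.fourier_apply,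
      fourier_reflSchwartz, hv.apply_conj, Complex.conj_conj]

/-! ### Approximation by real Schwartz functions on the line -/

theorem integral_re_mul_osc (φ : 𝓢(ℝ, ℂ)) (ξ : ℝ) :
    ∫ x, ((φ.postcompCLM Complex.reCLM x : ℝ) : ℂ) * osc ξ x
      = (2 : ℂ)⁻¹ * ((∫ x, φ x * osc ξ x) + (starRingEnd ℂ) (∫ x, φ x * osc (-ξ) x)) := by
  have hi : ∀ η, Integrable fun x => φ x * osc η x := fun η =>
    φ.integrable.mul_bdd (c := 1) (continuous_osc η).aestronglyMeasurable
      (Eventually.of_forall fun x => (norm_osc η x).le)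
  have hi' : Integrable fun x => (starRingEnd ℂ) (φ x * osc (-ξ) x) :=
    (Complex.conjCLE : ℂ →L[ℝ] ℂ).integrable_comp (hi (-ξ))
  rw [← integral_conj, ← integral_add (hi ξ) hi', ← integral_const_mul]
  congr 1
  ext x
  rw [SchwartzMap.postcompCLM_apply, map_mul, conj_osc, neg_neg, ← add_mul, Complex.add_conj,
    ← mul_assoc]
  simp

theorem freqNorm_refl (f : ℝ → ℂ) (hf : AEStronglyMeasurable f volume) (s : ℝ) (p : ℝ≥0∞) :
    freqNorm volume (AddMonoidHom.id ℝ) s p (fun ξ => (starRingEnd ℂ) (f (-ξ)))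
      = freqNorm volume (AddMonoidHom.id ℝ) s p f := by
  have h := eLpNorm_comp_measurePreserving (p := p)
    (aestronglyMeasurable_weighted (ι := AddMonoidHom.id ℝ) measurable_id s hf)
    (Measure.measurePreserving_neg volume)
  refine Eq.trans (eLpNorm_congr_norm_ae (Eventually.of_forall fun ξ => ?_)) h
  simp [bracketPow]

/-- Real Schwartz functions are dense in the real part of `FL^{s,p}(ℝ)`: the real part of the
inverse Fourier transform of a smooth compactly supported approximation of `f` does it, since taking
real parts averages `f` with its reflected conjugate, which is again `f`. -/
theorem exists_line_approx {p : ℝ≥0∞} (hp : 1 ≤ p) (hp' : p ≠ ⊤) {s : ℝ} {f : ℝ → ℂ}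
    (hm : AEStronglyMeasurable f volume)
    (hf : freqNorm volume (AddMonoidHom.id ℝ) s p f < ⊤)
    (hsym : f =ᵐ[volume] fun ξ => (starRingEnd ℂ) (f (-ξ))) {η : ℝ} (hη : 0 < η) :
    ∃ φ : 𝓢(ℝ, ℝ), freqNorm volume (AddMonoidHom.id ℝ) s p
      (fun ξ => (∫ x, (φ x : ℂ) * osc ξ x) - f ξ) < ENNReal.ofReal η := by
  have hmem : MemLp (fun ξ => (bracketPow s (AddMonoidHom.id ℝ ξ) : ℂ) * f ξ) p volume :=
    ⟨aestronglyMeasurable_weighted measurable_id s hm, hf⟩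
  obtain ⟨g, hgs, hgd, hg⟩ := hmem.exist_eLpNorm_sub_le hp' hp (half_pos hη)
  have hb0 : ∀ ξ, (bracketPow s ξ : ℂ) ≠ 0 := fun ξ => by
    exact_mod_cast (bracketPow_pos s ξ).ne'
  set h : ℝ → ℂ := fun ξ => (bracketPow s ξ)⁻¹ • g ξ with hh
  have hbd : ContDiff ℝ ∞ (bracketPow s) := by
    refine ContDiff.rpow_const_of_ne (by fun_prop) fun ξ => ?_
    positivity
  have hhd : ContDiff ℝ ∞ h := (hbd.inv fun ξ => (bracketPow_pos s ξ).ne').smul hgd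
  have hhs : HasCompactSupport h := by
    refine hgs.mono fun ξ hξ hg0 => hξ ?_
    rw [hh]
    simp [hg0]
  -- the kernel `exp (-2 π i x ξ)` of `𝓕` calls for the dilated function `ξ ↦ h (2 π ξ)`
  let D := (hhs.comp_homeomorph (Homeomorph.mulLeft₀ (2 * Real.pi)
    Real.two_pi_pos.ne')).toSchwartzMap (hhd.comp (contDiff_const.mul contDiff_id))
  have hD : ∀ ξ, ∫ x, (𝓕⁻ D) x * osc ξ x = h ξ := fun ξ => by
    have h1 : 𝓕 (𝓕⁻ D) ((2 * Real.pi)⁻¹ * ξ) = D ((2 * Real.pi)⁻¹ * ξ) := by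
      rw [FourierTransform.fourier_fourierInv_eq]
    rw [SchwartzMap.fourier_coe, fourier_eq_integral_osc,
      mul_inv_cancel_left₀ Real.two_pi_pos.ne'] at h1
    rw [h1]
    change h (2 * Real.pi * ((2 * Real.pi)⁻¹ * ξ)) = h ξ
    rw [mul_inv_cancel_left₀ Real.two_pi_pos.ne']
  set d : ℝ → ℂ := fun ξ => h ξ - f ξ with hd
  have hdm : AEStronglyMeasurable d volume := hhd.continuous.aestronglyMeasurable.sub hm
  have hdn : freqNorm volume (AddMonoidHom.id ℝ) s p d ≤ ENNReal.ofReal (η / 2) := by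
    rw [hd, freqNorm_sub_comm]
    refine le_trans (le_of_eq ?_) hg
    rw [freqNorm]
    congr 1
    ext ξ
    have := hb0 ξ
    simp only [hh, Pi.sub_apply, AddMonoidHom.id_apply, Complex.real_smul, Complex.ofReal_inv]
    field_simp
  refine ⟨(𝓕⁻ D).postcompCLM Complex.reCLM, ?_⟩
  have e : freqNorm volume (AddMonoidHom.id ℝ) s p
      (fun ξ => (∫ x, (((𝓕⁻ D).postcompCLM Complex.reCLM x : ℝ) : ℂ) * osc ξ x) - f ξ)
      = freqNorm volume (AddMonoidHom.id ℝ) s p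
        (fun ξ => (2 : ℂ)⁻¹ * (d ξ + (starRingEnd ℂ) (d (-ξ)))) := by
    refine eLpNorm_congr_ae ?_
    filter_upwards [hsym] with ξ hξ
    have h2 : f ξ = (2 : ℂ)⁻¹ * (f ξ + (starRingEnd ℂ) (f (-ξ))) := by
      rw [← hξ]; ring
    rw [integral_re_mul_osc, hD, hD, h2, hd, map_sub]
    ring
  rw [e, freqNorm_const_mul]
  have hdm' : AEStronglyMeasurable (fun ξ => (starRingEnd ℂ) (d (-ξ))) volume :=
    Complex.continuous_conj.comp_aestronglyMeasurable
      (hdm.comp_measurePreserving (Measure.measurePreserving_neg volume))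
  have h3 := freqNorm_add_le (ι := AddMonoidHom.id ℝ) (s := s) measurable_id hp hdm hdm'
  rw [freqNorm_refl d hdm] at h3
  have h4 : ‖(2 : ℂ)⁻¹‖ₑ = ENNReal.ofReal (2⁻¹ : ℝ) := by
    rw [← ofReal_norm]; simp
  calc _ ≤ ENNReal.ofReal (2⁻¹ : ℝ) * (ENNReal.ofReal (η / 2) + ENNReal.ofReal (η / 2)) := by
        rw [h4]
        exact mul_le_mul_right (h3.trans (add_le_add hdn hdn)) _
    _ = ENNReal.ofReal (η / 2) := by
        rw [← ENNReal.ofReal_add (by positivity) (by positivity),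
          ← ENNReal.ofReal_mul (by positivity)]
        congr 1
        ring
    _ < ENNReal.ofReal η := (ENNReal.ofReal_lt_ofReal_iff hη).2 (by linarith)

/-! ### Norm inflation on the line -/

theorem re_osc (ξ x : ℝ) : (osc ξ x).re = Real.cos (ξ * x) := by
  rw [osc, show -(Complex.I * ξ * x) = ((-(ξ * x) : ℝ) : ℂ) * Complex.I by push_cast; ring,
    Complex.exp_ofReal_mul_I_re, Real.cos_neg]

/-- If `ψ` is supported in `[-1/2, 1/2]`, the phases `ξ x` with `|ξ| ≤ 3/2` are at most `3/4` on
its support, so that `ψ²` is hardly affected by the oscillation. -/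
theorem half_integral_le_norm_integral_osc {ψ : ℝ → ℝ} (hc : Continuous ψ)
    (hs : HasCompactSupport ψ) (h0 : ∀ x, ψ x ≠ 0 → |x| ≤ 1 / 2) {ξ : ℝ}
    (hξ : ξ ∈ Icc (1 / 2 : ℝ) (3 / 2)) :
    (∫ x, ψ x ^ 2) / 2 ≤ ‖∫ x, ((ψ x ^ 2 : ℝ) : ℂ) * osc ξ x‖ := by
  have hs2 : HasCompactSupport fun x => ψ x ^ 2 := hs.comp_left (g := fun y => y ^ 2) (by simp)
  have hi : Integrable fun x => ψ x ^ 2 := (hc.pow 2).integrable_of_hasCompactSupport hs2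
  have hi2 : Integrable fun x => ((ψ x ^ 2 : ℝ) : ℂ) * osc ξ x :=
    hi.ofReal.mul_bdd (c := 1) (continuous_osc ξ).aestronglyMeasurable
      (Eventually.of_forall fun x => (norm_osc ξ x).le)
  refine le_trans ?_ (Complex.re_le_norm _)
  have h1 : (∫ x, ((ψ x ^ 2 : ℝ) : ℂ) * osc ξ x).re
      = ∫ x, (((ψ x ^ 2 : ℝ) : ℂ) * osc ξ x).re := (Complex.reCLM.integral_comp_comm hi2).symm
  rw [h1, ← integral_div]
  refine integral_mono (hi.div_const 2) hi2.re fun x => ?_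
  change ψ x ^ 2 / 2 ≤ (((ψ x ^ 2 : ℝ) : ℂ) * osc ξ x).re
  rw [Complex.re_ofReal_mul, re_osc]
  by_cases hx : ψ x = 0
  · simp [hx]
  have h2 : (ξ * x) ^ 2 ≤ 1 := by
    have h3 : |ξ| ≤ 3 / 2 := abs_le.2 ⟨by linarith [hξ.1], hξ.2⟩
    have h4 : |ξ * x| ≤ 1 := by
      rw [abs_mul]
      nlinarith [h0 x hx, abs_nonneg x, abs_nonneg ξ]
    rw [← sq_abs]
    nlinarith [abs_nonneg (ξ * x)]
  have h5 := Real.one_sub_sq_div_two_le_cos (x := ξ * x)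
  nlinarith [sq_nonneg (ψ x)]

/-- Norm inflation on the line. -/
theorem line_inflation {p : ℝ≥0∞} (hp : 1 ≤ p) (hp' : p ≠ ⊤) {s : ℝ} (hs : s < 0)
    (u₀ : 𝓢'(ℝ, ℂ)) (hreal : IsRealLine u₀) (hfin : normFLLine s p u₀ < ⊤) {ε : ℝ} (hε : 0 < ε) :
    ∃ (u : ℝ → ℝ → ℝ) (hu : IsSmoothSolutionLine u) (t : ℝ) (ht : 0 < t), t < ε ∧
      normFLLine s p (lineDistribution (u 0) (hu.memLp_two le_rfl) - u₀) < ENNReal.ofReal ε ∧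
      ENNReal.ofReal ε⁻¹ < normFLLine s p (lineDistribution (u t) (hu.memLp_two ht.le)) ∧
      normFLLine s p (lineDistribution (u t) (hu.memLp_two ht.le)) < ⊤ := by
  have hex := hfin
  simp only [normFLLine, iInf_lt_iff] at hex
  obtain ⟨f, hf, -⟩ := hex
  have hffin : freqNorm volume (AddMonoidHom.id ℝ) s p f < ⊤ := by
    rwa [normFLLine_eq hf] at hfin
  obtain ⟨φ, hφ⟩ := exists_line_approx hp hp' hf.1 hffin (hf.ae_eq (hf.refl hreal)) (half_pos hε)
  let ψ : ContDiffBump (0 : ℝ) := ⟨1 / 4, 1 / 2, by norm_num, by norm_num⟩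
  have hψ2 : 0 < ∫ x, ψ x ^ 2 := by
    refine (ψ.continuous.pow 2).integral_pos_of_hasCompactSupport_nonneg_nonzero
      (ψ.hasCompactSupport.comp_left (g := fun y : ℝ => y ^ 2) (by simp)) (fun x => sq_nonneg _)
      (x := 0) ?_
    rw [ψ.one_of_mem_closedBall (by simp [ψ])]
    norm_num
  have hψs : ∀ x, ψ x ≠ 0 → |x| ≤ 1 / 2 := fun x hx => by
    by_contra hcon
    push Not at hcon
    refine hx (ψ.zero_of_le_dist ?_)
    rw [Real.dist_0_eq_abs]
    exact hcon.le
  have hnice : ∀ (a : ℝ) (N : ℕ), line.IsNice fun x => φ x + a * (ψ x * Real.cos (N * x)) := by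
    intro a N
    have h1 : HasCompactSupport fun x => a * (ψ x * Real.cos (N * x)) :=
      (ψ.hasCompactSupport.mul_right (f' := fun x => Real.cos (N * x))).mul_left
        (f := fun _ => a)
    have h2 : ContDiff ℝ ∞ fun x => a * (ψ x * Real.cos (N * x)) := by
      have h3 : ContDiff ℝ ∞ ψ := ψ.contDiff
      have hc := Real.contDiff_cos (n := ∞)
      fun_prop
    exact isNice_line (φ + h1.toSchwartzMap h2)
  have hν := memLp_of_integrable_of_le_one hp hp' integrable_inv_one_add_sq
    (fun ξ : ℝ => by positivity) (fun ξ => inv_le_one_of_one_le₀ (by nlinarith [sq_nonneg ξ]))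
  obtain ⟨U, hU, -, hsm, t, ht, htε, h1, h2, h3⟩ := exists_inflation (G := line)
    (ν := (volume : Measure ℝ)) (ι := AddMonoidHom.id ℝ) (Ξ := Icc (1 / 2) (3 / 2))
    (c := (∫ x, ψ x ^ 2) / 2) (l := 1) (b := f) (φ := φ) (ψ := ψ) hp hp' hs measurable_id hν
    (fun ξ => periodic_zero _) (fun N => ⟨N, rfl⟩) (isNice_line φ)
    (isNice_line (ψ.hasCompactSupport.toSchwartzMap ψ.contDiff)) hnice measurableSet_Icc
    (by rw [Real.volume_Icc]; norm_num) (fun ξ hξ => hξ) (half_pos hψ2)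
    (fun ξ hξ => half_integral_le_norm_integral_osc ψ.continuous ψ.hasCompactSupport hψs hξ)
    one_pos hε hf.1 hffin (by
      simp only [Complex.ofReal_one, one_mul]
      exact hφ)
  simp only [Complex.ofReal_one, one_mul] at h1 h2 h3
  have hu := isSmoothSolutionLine_val hU hsm
  have hnorm : ∀ (τ : ℝ) (hτ : 0 ≤ τ),
      normFLLine s p (lineDistribution (line.val (U τ)) (hu.memLp_two hτ))
        = freqNorm volume (AddMonoidHom.id ℝ) s p (fun ξ => line.fourier ξ (U τ)) := fun τ hτ =>
    normFLLine_eq (hasFourierTransform_line _ _) s p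
  refine ⟨fun t => line.val (U t), hu, t, ht, htε, ?_, ?_, ?_⟩
  · rw [normFLLine_eq ((hasFourierTransform_line (U 0) _).sub hf)]
    exact h1
  · rw [hnorm t ht.le]; exact h2
  · rw [hnorm t ht.le]; exact h3

end BBM

theorem theorem5p1 (p : ℝ≥0∞) (hp : 1 ≤ p) (hp' : p ≠ ⊤) (s : ℝ) (hs : s < 0) :
    (∀ u₀ : 𝓢'(ℝ, ℂ), BBM.IsRealLine u₀ → BBM.normFLLine s p u₀ < ⊤ → ∀ ε : ℝ, 0 < ε →
      ∃ (u : ℝ → ℝ → ℝ) (hu : BBM.IsSmoothSolutionLine u) (t : ℝ) (ht : 0 < t), t < ε ∧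
        BBM.normFLLine s p (BBM.lineDistribution (u 0) (hu.memLp_two le_rfl) - u₀)
          < ENNReal.ofReal ε ∧
        ENNReal.ofReal ε⁻¹ < BBM.normFLLine s p (BBM.lineDistribution (u t) (hu.memLp_two ht.le)) ∧
        BBM.normFLLine s p (BBM.lineDistribution (u t) (hu.memLp_two ht.le)) < ⊤) ∧
    (∀ u₀ : BBM.TorusDistribution, BBM.IsRealTorus u₀ → BBM.normFLTorus s p u₀ < ⊤ →
      ∀ ε : ℝ, 0 < ε →
      ∃ (u : ℝ → ℝ → ℝ) (hu : BBM.IsSmoothSolutionTorus u) (t : ℝ) (ht : 0 < t), t < ε ∧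
        BBM.normFLTorus s p (BBM.torusDistribution (u 0) (hu.continuous le_rfl) - u₀)
          < ENNReal.ofReal ε ∧
        ENNReal.ofReal ε⁻¹ < BBM.normFLTorus s p (BBM.torusDistribution (u t) (hu.continuous ht.le)) ∧
        BBM.normFLTorus s p (BBM.torusDistribution (u t) (hu.continuous ht.le)) < ⊤) :=
  ⟨fun u₀ hreal hfin _ hε => BBM.line_inflation hp hp' hs u₀ hreal hfin hε,
    fun u₀ hreal hfin _ hε => BBM.torus_inflation hp hp' hs u₀ hreal hfin hε⟩
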